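/- **Theorem 3.4.** Let $n\ge 1$ and let $(X,T^{1,0}X)$ be a compact connected CR manifold of dimension $2n+1$ (so $T^{1,0}X\subset\mathbb C TX$ is a smooth complex subbundle of rank $n$, closed under Lie brackets, with $T^{1,0}X\cap T^{0,1}X=0$, $T^{0,1}X=\overline{T^{1,0}X}$), with a smooth $S^1$-action $e^{i\theta}$ that is CR, locally free and transversal: its generating vector field $T$ vanishes nowhere, $[T,C^\infty(X,T^{1,0}X)]\subset C^\infty(X,T^{1,0}X)$, and $\mathbb C T\oplus T^{1,0}X\oplus T^{0,1}X=\mathbb C TX$. Let $\omega_0$ be the real one-form with $\omega_0(T)=-1$ and $\omega_0=0$ on $T^{1,0}X\oplus T^{0,1}X$, and assume that $X$ is strongly pseudoconvex: the Levi form $\mathcal L_p(U,\overline V)=-\frac1{2i}d\omega_0(U,\overline V)$ is positive definite on $T^{1,0}_pX$ for every $p\in X$. (Conventions: $d\eta(U,V)=U\eta(V)-V\eta(U)-\eta([U,V])$ and $(\alpha\wedge\beta)(U,V)=\alpha(U)\beta(V)-\alpha(V)\beta(U)$ for one-forms.) *Rigid scalar curvature.* A BRT trivialization $(D,(z,\theta),\varphi)$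 consists of smooth coordinates $(z,\theta)=(x_1,\dots,x_{2n+1})$, $z_j=x_{2j-1}+ix_{2j}$, $\theta=x_{2n+1}$, on an open set $D\subset X$, identifying $D$ with $\{|z|<\delta,\ |\theta|<\varepsilon\}$, $\delta>0$, $0<\varepsilon<\pi$, and a real function $\varphi\in C^\infty(\{|z|<\delta\})$, such that on $D$ one has $T=\partial/\partial\theta$ and the fields $Z_j=\frac{\partial}{\partial z_j}+i\frac{\partial\varphi}{\partial z_j}(z)\frac{\partial}{\partial\theta}$, $j=1,\dots,n$, form a basis of $T^{1,0}X$. Let $\langle U\,|\,V\rangle_{\mathcal L}=\frac1{2\pi}\,i\,d\omega_0(U,\overline V)$ for $U,V\in T^{1,0}X$, let $e_1,\dots,e_n$ be the frame of $T^{*1,0}X$ dual to $Z_1,\dots,Z_n$, with the inner products $\langle e_j\,|\,e_k\rangle_{\mathcal L}$ induced on covectors, and put $$\triangle_{\mathcal L}=-2\sum_{j,k=1}^n\langle e_j\,|\,e_k\rangle_{\mathcal L}\,Z_j\overline{Z_k},\qquad \frac1{n!}\Bigl(-\frac1{2\pi}d\omega_0\Bigr)^n\wedge(-\omega_0)=a(x)\,dx_1\cdots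 dx_{2n+1}\ \text{ on } D .$$ The rigid scalar curvature is $S_{\mathcal L}=\triangle_{\mathcal L}(\log a)$ on $D$. *Tanaka–Webster scalar curvature.* Let $\theta_0=-\omega_0$, let $HX=\{W+\overline W:\ W\in T^{1,0}X\}$, $J(W+\overline W)=iW-i\overline W$, and let $\xi$ be the vector field with $\theta_0(\xi)=1$, $d\theta_0(\xi,\cdot)=0$. Let $\nabla$ be the Tanaka–Webster connection, that is, the linear connection on $TX$ for which $HX$, $\xi$, $J$ and $d\theta_0$ are parallel and whose torsion $\tau(U,V)=\nabla_UV-\nabla_VU-[U,V]$ satisfies $\tau(U,V)=d\theta_0(U,V)\xi$ and $\tau(\xi,JU)=-J\tau(\xi,U)$ for $U,V$ in $HX$. For a local frame $\{W_\alpha\}$ of $T^{1,0}X$ with dual forms $\theta^\alpha$ (vanishing on $T^{0,1}X$ and $\xi$), write $\nabla W_\alpha=\sum_\beta\omega_\alpha^\beta\otimes W_\beta$, $\Theta_\alpha^\beta=d\omega_\alpha^\beta-\sum_\gamma\omega_\alpha^\gamma\wedge\omega_\gamma^\beta$, let $R_{\alpha\ j\overline k}^{\ \ \beta}=\Theta_\alpha^\beta(W_j,\overline{W_k})$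 be the coefficient of $\theta^j\wedge\overline{\theta^k}$ in $\Theta_\alpha^\beta$, and let $d\theta_0=i\sum g_{\alpha\overline\beta}\,\theta^\alpha\wedge\overline{\theta^\beta}$. The Tanaka–Webster scalar curvature is $$R=\sum_{\alpha,k}g^{\overline k\alpha}R_{\alpha\overline k},\qquad R_{\alpha\overline k}=\sum_{j}R_{\alpha\ j\overline k}^{\ \ j},$$ where $(g^{\overline k\alpha})$ is the inverse matrix of $(g_{\alpha\overline k})$. Then $S_{\mathcal L}(x)=4\pi R(x)$: for every BRT trivialization with domain $D$, every local frame of $T^{1,0}X$ on an open set $D'$, and every $x\in D\cap D'$, the value at $x$ of $\triangle_{\mathcal L}(\log a)$ computed in the BRT trivialization equals $4\pi$ times the value at $x$ of the scalar curvature $R$ computed in the frame. -/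

import Mathlib

open scoped Manifold ContDiff TensorProduct

noncomputable section

namespace RigidCR

/-! ### Complexification of a real vector space -/

section Complexification

variable {V : Type*} [AddCommGroup V] [Module ℝ V]

/-- The real part `u` of `U = u + i v ∈ ℂ ⊗ V`. -/
def cRe : (ℂ ⊗[ℝ] V) →ₗ[ℝ] V :=
  (TensorProduct.lid ℝ V).toLinearMap ∘ₗ LinearMap.rTensor V Complex.reLm

/-- The imaginary part `v` of `U = u + i v ∈ ℂ ⊗ V`. -/
def cIm : (ℂ ⊗[ℝ] V) →ₗ[ℝ] V :=
  (TensorProduct.lid ℝ V).toLinearMap ∘ₗ LinearMap.rTensor V Complex.imLm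

/-- The complex vector `u + i v`. -/
def cMk (u v : V) : ℂ ⊗[ℝ] V := (1 : ℂ) ⊗ₜ[ℝ] u + Complex.I ⊗ₜ[ℝ] v

/-- Complex conjugation `u + i v ↦ u - i v`. -/
def cConj : (ℂ ⊗[ℝ] V) →ₗ[ℝ] (ℂ ⊗[ℝ] V) :=
  LinearMap.rTensor V Complex.conjAe.toLinearMap

/-- The complex linear extension of a real linear function, evaluated at `U = u + i v`. -/
def cEval (f : V → ℂ) (U : ℂ ⊗[ℝ] V) : ℂ := f (cRe U) + Complex.I * f (cIm U)

/-- The complex bilinear extension of a real bilinear form. -/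
def cEval₂ (α : V → V → ℝ) (U W : ℂ ⊗[ℝ] V) : ℂ :=
  cEval (fun u => cEval (fun w => (α u w : ℂ)) W) U

@[simp] theorem cRe_tmul (z : ℂ) (v : V) : cRe (z ⊗ₜ[ℝ] v) = z.re • v := by
  simp [cRe]

@[simp] theorem cIm_tmul (z : ℂ) (v : V) : cIm (z ⊗ₜ[ℝ] v) = z.im • v := by
  simp [cIm]

@[simp] theorem cConj_tmul (z : ℂ) (v : V) :
    cConj (z ⊗ₜ[ℝ] v) = (starRingEnd ℂ z) ⊗ₜ[ℝ] v := by
  simp [cConj]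

theorem cMk_cRe_cIm (U : ℂ ⊗[ℝ] V) : cMk (cRe U) (cIm U) = U := by
  induction U using TensorProduct.induction_on with
  | zero => simp [cMk]
  | tmul z v =>
    simp only [cMk, cRe_tmul, cIm_tmul]
    rw [← TensorProduct.smul_tmul, ← TensorProduct.smul_tmul, ← TensorProduct.add_tmul]
    congr 1
    apply Complex.ext <;> simp
  | add a b ha hb =>
    rw [map_add, map_add]
    conv_rhs => rw [← ha, ← hb]
    simp only [cMk, TensorProduct.tmul_add]
    abel

theorem cConj_smul (c : ℂ) (U : ℂ ⊗[ℝ] V) : cConj (c • U) = (starRingEnd ℂ c) • cConj U := by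
  induction U using TensorProduct.induction_on with
  | zero => simp
  | tmul z v => simp [TensorProduct.smul_tmul']
  | add a b ha hb => rw [smul_add, map_add, ha, hb, map_add, smul_add]

@[simp] theorem cConj_cConj (U : ℂ ⊗[ℝ] V) : cConj (cConj U) = U := by
  induction U using TensorProduct.induction_on with
  | zero => simp
  | tmul z v => simp
  | add a b ha hb => rw [map_add, map_add, ha, hb]

theorem add_cConj (U : ℂ ⊗[ℝ] V) : U + cConj U = (2 : ℂ) ⊗ₜ[ℝ] cRe U := by
  induction U using TensorProduct.induction_on with
  | zero => simp
  | tmul z v =>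
    rw [cConj_tmul, cRe_tmul, ← TensorProduct.add_tmul, ← TensorProduct.smul_tmul]
    congr 1
    apply Complex.ext
    · simp; ring
    · simp
  | add a b ha hb =>
    rw [map_add, map_add, TensorProduct.tmul_add, ← ha, ← hb]
    abel

/-- The conjugate of a complex subspace of `ℂ ⊗ V`. -/
def conjSubmodule (S : Submodule ℂ (ℂ ⊗[ℝ] V)) : Submodule ℂ (ℂ ⊗[ℝ] V) where
  carrier := {U | cConj U ∈ S}
  add_mem' := by
    intro a b ha hb
    simpa using S.add_mem ha hb
  zero_mem' := by simp
  smul_mem' := by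
    intro c U hU
    simpa [cConj_smul] using S.smul_mem _ hU

/-- If `ℂ ⊗ V = ℂ T ⊕ (S ⊕ S̄)` with `0 ≠ T ∈ V` real, then there is exactly one real linear form
with `ω(T) = -1` whose complex linear extension vanishes on `S ⊕ S̄`. -/
theorem existsUnique_form {T : V} (hT : T ≠ 0)
    {S : Submodule ℂ (ℂ ⊗[ℝ] V)}
    (h : IsCompl (Submodule.span ℂ {(1 : ℂ) ⊗ₜ[ℝ] T}) (S ⊔ conjSubmodule S)) :
    ∃! η : V →ₗ[ℝ] ℝ, η T = -1 ∧ ∀ U ∈ S ⊔ conjSubmodule S, cEval (fun v => (η v : ℂ)) U = 0 := by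
  have hT1 : (1 : ℂ) ⊗ₜ[ℝ] T ≠ 0 := by
    intro h0
    apply hT
    have := congrArg (cRe (V := V)) h0
    simpa using this
  have hconj : ∀ U ∈ S ⊔ conjSubmodule S, cConj U ∈ S ⊔ conjSubmodule S := by
    intro U hU
    obtain ⟨a, ha, b, hb, rfl⟩ := Submodule.mem_sup.1 hU
    rw [map_add, add_comm]
    refine Submodule.add_mem_sup hb ?_
    change cConj (cConj a) ∈ S
    simpa using ha
  have hre : ∀ U ∈ S ⊔ conjSubmodule S, (1 : ℂ) ⊗ₜ[ℝ] cRe U ∈ S ⊔ conjSubmodule S := by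
    intro U hU
    have h2 := Submodule.smul_mem _ ((2 : ℂ)⁻¹) (Submodule.add_mem _ hU (hconj U hU))
    rw [add_cConj, TensorProduct.smul_tmul'] at h2
    simpa using h2
  have him : ∀ U : ℂ ⊗[ℝ] V, cIm U = cRe ((-Complex.I) • U) := by
    intro U
    induction U using TensorProduct.induction_on with
    | zero => simp
    | tmul z v => simp [TensorProduct.smul_tmul']
    | add a b ha hb => rw [map_add, smul_add, map_add, ha, hb]
  let e := LinearEquiv.toSpanNonzeroSingleton ℂ (ℂ ⊗[ℝ] V) _ hT1
  let ell : (ℂ ⊗[ℝ] V) →ₗ[ℂ] ℂ := e.symm.toLinearMap ∘ₗ Submodule.projectionOnto _ _ h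
  have hell : ∀ U ∈ S ⊔ conjSubmodule S, ell U = 0 := by
    intro U hU
    have := (Submodule.projectionOnto_apply_eq_zero_iff h).2 hU
    simp [ell, this]
  have hellT : ell ((1 : ℂ) ⊗ₜ[ℝ] T) = 1 := by
    have h1 := Submodule.projectionOnto_apply_left h
      ⟨(1 : ℂ) ⊗ₜ[ℝ] T, Submodule.mem_span_singleton_self _⟩
    simp only [ell, LinearMap.comp_apply]
    erw [h1]
    exact LinearEquiv.coord_self ℂ _ _ hT1
  let η : V →ₗ[ℝ] ℝ :=
    -(Complex.reLm ∘ₗ ell.restrictScalars ℝ ∘ₗ TensorProduct.mk ℝ ℂ V 1)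
  have hη : ∀ v, η v = -(ell ((1 : ℂ) ⊗ₜ[ℝ] v)).re := fun v => rfl
  refine ⟨η, ⟨by rw [hη, hellT]; simp, ?_⟩, ?_⟩
  · intro U hU
    have h1 : η (cRe U) = 0 := by rw [hη, hell _ (hre U hU)]; simp
    have h2 : η (cIm U) = 0 := by
      rw [hη, him, hell _ (hre _ (Submodule.smul_mem _ _ hU))]; simp
    simp [cEval, h1, h2]
  · rintro η' ⟨h1, h2⟩
    have key : ∀ U ∈ S ⊔ conjSubmodule S, η' (cRe U) = 0 := by
      intro U hU
      have := congrArg Complex.re (h2 U hU)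
      simpa [cEval] using this
    have key' : ∀ U ∈ S ⊔ conjSubmodule S, η (cRe U) = 0 := by
      intro U hU
      rw [hη, hell _ (hre U hU)]; simp
    ext v
    have hv : (1 : ℂ) ⊗ₜ[ℝ] v ∈ Submodule.span ℂ {(1 : ℂ) ⊗ₜ[ℝ] T} ⊔ (S ⊔ conjSubmodule S) := by
      rw [h.sup_eq_top]; trivial
    obtain ⟨a, ha, w, hw, hvw⟩ := Submodule.mem_sup.1 hv
    obtain ⟨c, rfl⟩ := Submodule.mem_span_singleton.1 ha
    have hv' : v = c.re • T + cRe w := by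
      have := congrArg (cRe (V := V)) hvw
      simpa [TensorProduct.smul_tmul'] using this.symm
    have hηT : η T = -1 := by rw [hη, hellT]; simp
    rw [hv', map_add, map_add, map_smul, map_smul, h1, hηT, key w hw, key' w hw]

end Complexification

/-! ### Complex vector fields and forms on a manifold of real dimension `2n+1` -/

section Fields

variable (n : ℕ) (X : Type*) [TopologicalSpace X]
  [ChartedSpace (EuclideanSpace ℝ (Fin (2 * n + 1))) X]

/-- The real tangent space `T_x X`. -/
abbrev RT {X : Type*} [TopologicalSpace X]
    [ChartedSpace (EuclideanSpace ℝ (Fin (2 * n + 1))) X] (x : X) : Type :=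
  TangentSpace (𝓡 (2 * n + 1)) x

/-- The complexified tangent space `ℂ T_x X`. -/
abbrev CT {X : Type*} [TopologicalSpace X]
    [ChartedSpace (EuclideanSpace ℝ (Fin (2 * n + 1))) X] (x : X) : Type :=
  ℂ ⊗[ℝ] RT n x

/-- Real vector fields (not assumed smooth). -/
abbrev RField : Type _ := Π x : X, RT n x

/-- Complex vector fields (not assumed smooth). -/
abbrev CField : Type _ := Π x : X, CT n x

/-- Real one-forms. -/
abbrev OneForm : Type _ := Π x : X, RT n x →ₗ[ℝ] ℝ

variable {n X}
variable [IsManifold (𝓡 (2 * n + 1)) ∞ X]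

/-- The real vector field `V` is smooth on `D`. -/
def RSmoothOn (V : RField n X) (D : Set X) : Prop :=
  ContMDiffOn (𝓡 (2 * n + 1)) (𝓡 (2 * n + 1)).tangent ∞
    (fun x => (⟨x, V x⟩ : TangentBundle (𝓡 (2 * n + 1)) X)) D

/-- The complex vector field `Z` is smooth on `D`. -/
def CSmoothOn (Z : CField n X) (D : Set X) : Prop :=
  RSmoothOn (fun x => cRe (Z x)) D ∧ RSmoothOn (fun x => cIm (Z x)) D

/-- The derivative `U f` at `x` of a complex function `f` along a complex tangent vector `U`. -/
def cDeriv {x : X} (U : CT n x) (f : X → ℂ) : ℂ :=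
  cEval (fun u : RT n x => mvfderiv (𝓡 (2 * n + 1)) f x u) U

/-- The Lie bracket of complex vector fields, the complex bilinear extension of the Lie bracket. -/
def cBracket (Z W : CField n X) : CField n X := fun x =>
  cMk (VectorField.mlieBracket (𝓡 (2 * n + 1)) (fun y => cRe (Z y)) (fun y => cRe (W y)) x
      - VectorField.mlieBracket (𝓡 (2 * n + 1)) (fun y => cIm (Z y)) (fun y => cIm (W y)) x)
    (VectorField.mlieBracket (𝓡 (2 * n + 1)) (fun y => cRe (Z y)) (fun y => cIm (W y)) x
      + VectorField.mlieBracket (𝓡 (2 * n + 1)) (fun y => cIm (Z y)) (fun y => cRe (W y)) x)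

/-- The exterior derivative of a real one-form at `x`, as a bilinear form on `T_x X`:
`dη(u, v) = U(η(V)) - V(η(U)) - η([U, V])`, where `U`, `V` are differentiable vector fields that
extend `u`, `v`; for a differentiable form `η` the value does not depend on the extension. -/
def dForm (η : OneForm n X) (x : X) (u v : RT n x) : ℝ :=
  let U : RField n X := FiberBundle.extend (EuclideanSpace ℝ (Fin (2 * n + 1))) u
  let V : RField n X := FiberBundle.extend (EuclideanSpace ℝ (Fin (2 * n + 1))) v
  mvfderiv (𝓡 (2 * n + 1)) (fun y => η y (V y)) x u
    - mvfderiv (𝓡 (2 * n + 1)) (fun y => η y (U y)) x v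
    - η x (VectorField.mlieBracket (𝓡 (2 * n + 1)) U V x)

/-- The exterior derivative of a complex one-form `η`, evaluated on complex vector fields:
`dη(U, V) = U(η(V)) - V(η(U)) - η([U, V])`. -/
def cdForm (η : Π x : X, CT n x → ℂ) (U V : CField n X) (x : X) : ℂ :=
  cDeriv (U x) (fun y => η y (V y)) - cDeriv (V x) (fun y => η y (U y)) - η x (cBracket U V x)

end Fields

/-! ### CR structures and circle actions -/

/-- A CR structure `T^{1,0}X` of rank `n` on a manifold of dimension `2n+1`: a smooth complex
subbundle of rank `n` of `ℂTX` with `T^{1,0}X ∩ T^{0,1}X = 0`, closed under Lie brackets. -/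
structure CRStructure (n : ℕ) (X : Type*) [TopologicalSpace X]
    [ChartedSpace (EuclideanSpace ℝ (Fin (2 * n + 1))) X]
    [IsManifold (𝓡 (2 * n + 1)) ∞ X] where
  /-- The fibres of `T^{1,0}X`. -/
  T10 : Π x : X, Submodule ℂ (CT n x)
  exists_frame : ∀ x : X, ∃ D : Set X, IsOpen D ∧ x ∈ D ∧ ∃ Z : Fin n → CField n X,
    (∀ j, CSmoothOn (Z j) D) ∧ ∀ y ∈ D, LinearIndependent ℂ (fun j => Z j y) ∧
      Submodule.span ℂ (Set.range fun j => Z j y) = T10 y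
  disjoint : ∀ x : X, Disjoint (T10 x) (conjSubmodule (T10 x))
  integrable : ∀ Z W : CField n X, CSmoothOn Z Set.univ → CSmoothOn W Set.univ →
    (∀ x, Z x ∈ T10 x) → (∀ x, W x ∈ T10 x) → ∀ x, cBracket Z W x ∈ T10 x

/-- The real vector field `T` induced by a circle action: `T(x)` is the velocity at `θ = 0` of the
curve `θ ↦ e^{iθ} x`. -/
def circleField (n : ℕ) (X : Type*) [TopologicalSpace X]
    [ChartedSpace (EuclideanSpace ℝ (Fin (2 * n + 1))) X] [MulAction Circle X] : RField n X :=
  fun x =>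
    have h : Circle.exp 0 • x = x := by simp
    h ▸ (show RT n (Circle.exp 0 • x) from
      mfderiv 𝓘(ℝ, ℝ) (𝓡 (2 * n + 1)) (fun θ : ℝ => Circle.exp θ • x) 0 (1 : ℝ))

namespace CRStructure

variable {n : ℕ} {X : Type*} [TopologicalSpace X]
  [ChartedSpace (EuclideanSpace ℝ (Fin (2 * n + 1))) X]
  [IsManifold (𝓡 (2 * n + 1)) ∞ X]

/-- The fibre of `T^{0,1}X`, the conjugate of `T^{1,0}X`. -/
def T01 (S : CRStructure n X) (x : X) : Submodule ℂ (CT n x) := conjSubmodule (S.T10 x)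

/-- The circle action on `X` is CR, locally free and transversal. -/
structure IsTransversalCRAction (S : CRStructure n X) [MulAction Circle X] : Prop where
  cr : ∀ Z : CField n X, CSmoothOn Z Set.univ → (∀ x, Z x ∈ S.T10 x) →
    ∀ x, cBracket (fun y => (1 : ℂ) ⊗ₜ[ℝ] circleField n X y) Z x ∈ S.T10 x
  locallyFree : ∀ x, circleField n X x ≠ 0
  transversal : ∀ x,
    IsCompl (Submodule.span ℂ {(1 : ℂ) ⊗ₜ[ℝ] circleField n X x}) (S.T10 x ⊔ S.T01 x)

/-- The real one-form `ω₀` determined by `ω₀(T) = -1` and `ω₀ = 0` on `T^{1,0}X ⊕ T^{0,1}X`. -/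
def omega₀ (S : CRStructure n X) [MulAction Circle X] (hS : S.IsTransversalCRAction) :
    OneForm n X :=
  fun x => (existsUnique_form (hS.locallyFree x) (hS.transversal x)).choose

theorem omega₀_spec (S : CRStructure n X) [MulAction Circle X] (hS : S.IsTransversalCRAction)
    (x : X) : S.omega₀ hS x (circleField n X x) = -1 ∧
      ∀ U ∈ S.T10 x ⊔ S.T01 x, cEval (fun v => (S.omega₀ hS x v : ℂ)) U = 0 :=
  (existsUnique_form (hS.locallyFree x) (hS.transversal x)).choose_spec.1

/-- The pseudohermitian structure `θ₀ = -ω₀`. -/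
def theta₀ (S : CRStructure n X) [MulAction Circle X] (hS : S.IsTransversalCRAction) :
    OneForm n X :=
  fun x => -(S.omega₀ hS x)

/-- The Levi form `L_p(U, V̄) = -(1/2i) dω₀(U, V̄)` for `U, V ∈ T^{1,0}_p X`. -/
def leviForm (S : CRStructure n X) [MulAction Circle X] (hS : S.IsTransversalCRAction)
    {p : X} (U V : CT n p) : ℂ :=
  -(1 / (2 * Complex.I)) * cEval₂ (dForm (S.omega₀ hS) p) U (cConj V)

/-- The Levi form (a Hermitian form) is positive definite at every point. -/
def IsStronglyPseudoconvex (S : CRStructure n X) [MulAction Circle X]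
    (hS : S.IsTransversalCRAction) : Prop :=
  ∀ p : X, ∀ U ∈ S.T10 p, U ≠ 0 → 0 < (S.leviForm hS U U).re

/-- The Hermitian metric `⟨U | V⟩ = (1/2π) (i dω₀)(U, V̄)` on `T^{1,0}X`. -/
def leviMetric (S : CRStructure n X) [MulAction Circle X] (hS : S.IsTransversalCRAction)
    {p : X} (U V : CT n p) : ℂ :=
  1 / (2 * Real.pi) * (Complex.I * cEval₂ (dForm (S.omega₀ hS) p) U (cConj V))

end CRStructure

/-! ### Canonical coordinates and the rigid scalar curvature -/

/-- The standard basis of `ℝ^{2n+1}` in the coordinates `(z, θ) ∈ ℂⁿ × ℝ`: for `j < n` the vectors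
number `2j` and `2j+1` are the directions of `Re z_j` and `Im z_j`, the last one that of `θ`. -/
def coordBasis (n : ℕ) (k : Fin (2 * n + 1)) : EuclideanSpace ℂ (Fin n) × ℝ :=
  if h : (k : ℕ) / 2 < n then
    (EuclideanSpace.single ⟨(k : ℕ) / 2, h⟩ (if (k : ℕ) % 2 = 0 then (1 : ℂ) else Complex.I), 0)
  else (0, 1)

/-- The index `2j` (of `Re z_j`). -/
def idxRe {n : ℕ} (j : Fin n) : Fin (2 * n + 1) := ⟨2 * j, by omega⟩

/-- The index `2j+1` (of `Im z_j`). -/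
def idxIm {n : ℕ} (j : Fin n) : Fin (2 * n + 1) := ⟨2 * j + 1, by omega⟩

/-- The index `2n` (of `θ`). -/
def idxLast {n : ℕ} : Fin (2 * n + 1) := ⟨2 * n, by omega⟩

/-- The Wirtinger derivative `∂φ/∂z_j` of a real function `φ` on `ℂⁿ`. -/
def wirtinger {n : ℕ} (φ : EuclideanSpace ℂ (Fin n) → ℝ) (j : Fin n)
    (z : EuclideanSpace ℂ (Fin n)) : ℂ :=
  1 / 2 * ((fderiv ℝ φ z (EuclideanSpace.single j 1) : ℝ)
    - Complex.I * (fderiv ℝ φ z (EuclideanSpace.single j Complex.I) : ℝ))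

/-- The value `(αⁿ ∧ β)(v_0, …, v_{2n})` of the exterior product of `n` copies of a two-form `α` and
a one-form `β`, for the convention `(β₁ ∧ β₂)(v, w) = β₁(v) β₂(w) - β₁(w) β₂(v)`. -/
def wedgePow {n : ℕ} {V : Type*} (α : V → V → ℝ) (β : V → ℝ) (v : Fin (2 * n + 1) → V) : ℝ :=
  1 / 2 ^ n * ∑ σ : Equiv.Perm (Fin (2 * n + 1)), ((Equiv.Perm.sign σ : ℤ) : ℝ) *
    ((∏ j : Fin n, α (v (σ (idxRe j))) (v (σ (idxIm j)))) * β (v (σ idxLast)))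

section BRT

variable {n : ℕ} {X : Type*} [TopologicalSpace X]
  [ChartedSpace (EuclideanSpace ℝ (Fin (2 * n + 1))) X]
  [IsManifold (𝓡 (2 * n + 1)) ∞ X]

/-- The coordinate vector field `∂/∂x_k` of coordinates `e = (z, θ)`, where `z_j` has the real and
imaginary parts number `2j` and `2j+1` and `θ` has number `2n` (counted from `0`). -/
def coordField (e : OpenPartialHomeomorph X (EuclideanSpace ℂ (Fin n) × ℝ))
    (k : Fin (2 * n + 1)) : RField n X :=
  VectorField.mpullback (𝓡 (2 * n + 1)) 𝓘(ℝ, EuclideanSpace ℂ (Fin n) × ℝ) e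
    (fun _ => coordBasis n k)

/-- The complex vector field `Z_j = ∂/∂z_j + i (∂φ/∂z_j)(z) ∂/∂θ` in the coordinates
`e = (z, θ)`. -/
def brtFrame (e : OpenPartialHomeomorph X (EuclideanSpace ℂ (Fin n) × ℝ))
    (φ : EuclideanSpace ℂ (Fin n) → ℝ) (j : Fin n) : CField n X := fun x =>
  (1 / 2 : ℂ) • ((1 : ℂ) ⊗ₜ[ℝ] coordField e (idxRe j) x
      - Complex.I ⊗ₜ[ℝ] coordField e (idxIm j) x)
    + (Complex.I * wirtinger φ j (e x).1) ⊗ₜ[ℝ] coordField e idxLast x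

/-- A Baouendi–Rothschild–Treves (BRT) trivialization `(D, (z, θ), φ)`: smooth coordinates
`(z, θ)` on an open set `D`, identified with `{|z| < δ, |θ| < ε}`, and a real smooth function
`φ(z)`, such that `T = ∂/∂θ` and the `Z_j = ∂/∂z_j + i (∂φ/∂z_j)(z) ∂/∂θ` form a basis of
`T^{1,0}X` at each point of `D`. -/
structure BRTTrivialization (S : CRStructure n X) [MulAction Circle X] where
  /-- The coordinates `(z, θ)` on `D = coord.source`. -/
  coord : OpenPartialHomeomorph X (EuclideanSpace ℂ (Fin n) × ℝ)
  coord_smooth : ContMDiffOn (𝓡 (2 * n + 1)) 𝓘(ℝ, EuclideanSpace ℂ (Fin n) × ℝ) ∞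
    coord coord.source
  coord_symm_smooth : ContMDiffOn 𝓘(ℝ, EuclideanSpace ℂ (Fin n) × ℝ) (𝓡 (2 * n + 1)) ∞
    coord.symm coord.target
  /-- The size of `D` in the `z` directions. -/
  δ : ℝ
  δ_pos : 0 < δ
  /-- The size of `D` in the `θ` direction. -/
  ε : ℝ
  ε_pos : 0 < ε
  ε_lt_pi : ε < Real.pi
  target_eq : coord.target = {p | ‖p.1‖ < δ ∧ |p.2| < ε}
  /-- The potential `φ`. -/
  φ : EuclideanSpace ℂ (Fin n) → ℝ
  φ_smooth : ContDiffOn ℝ ∞ φ (Metric.ball 0 δ)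
  circleField_eq : ∀ x ∈ coord.source, circleField n X x = coordField coord idxLast x
  frame_linearIndependent : ∀ x ∈ coord.source,
    LinearIndependent ℂ (fun j => brtFrame coord φ j x)
  frame_span : ∀ x ∈ coord.source,
    Submodule.span ℂ (Set.range fun j => brtFrame coord φ j x) = S.T10 x

namespace BRTTrivialization

variable {S : CRStructure n X} [MulAction Circle X]

/-- The domain `D`. -/
def D (B : BRTTrivialization S) : Set X := B.coord.source

/-- The BRT frame `Z_j`. -/
def Z (B : BRTTrivialization S) (j : Fin n) : CField n X := brtFrame B.coord B.φ j

/-- The inner product `⟨e_j | e_k⟩` of the elements of the frame of `T^{*1,0}X` dual to `Z_j`, for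
the metric on covectors induced by `⟨· | ·⟩`. If `h_{jk} = ⟨Z_j | Z_k⟩`, this is the entry `(k, j)`
of `h⁻¹` (for an orthonormal basis `E_a` of `T^{1,0}_x X`, it is
`∑ a, e_j(E_a) * conj (e_k(E_a))`). -/
def dualMetric (B : BRTTrivialization S) (hS : S.IsTransversalCRAction) (j k : Fin n) (x : X) : ℂ :=
  (Matrix.of fun l m => S.leviMetric hS (B.Z l x) (B.Z m x))⁻¹ k j

/-- The rigid CR Laplacian `Δ = (-2) ∑ ⟨e_j | e_k⟩ Z_j Z̄_k` on `D`. -/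
def laplacian (B : BRTTrivialization S) (hS : S.IsTransversalCRAction) (f : X → ℂ) (x : X) : ℂ :=
  (-2) * ∑ j, ∑ k, B.dualMetric hS j k x *
    cDeriv (B.Z j x) (fun y => cDeriv (cConj (B.Z k y)) f)

/-- The density `a` with `(1/n!) (-(1/2π) dω₀)ⁿ ∧ (-ω₀) = a(x) dx_1 ⋯ dx_{2n+1}` on `D`. -/
def volumeDensity (B : BRTTrivialization S) (hS : S.IsTransversalCRAction) (x : X) : ℝ :=
  1 / (n.factorial : ℝ) *
    wedgePow (fun u v => -(1 / (2 * Real.pi)) * dForm (S.omega₀ hS) x u v)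
      (fun v => -(S.omega₀ hS x v)) (fun k => coordField B.coord k x)

/-- The rigid scalar curvature `Δ (log a)`, computed in the BRT trivialization. -/
def rigidScalarCurvature (B : BRTTrivialization S) (hS : S.IsTransversalCRAction) (x : X) : ℂ :=
  B.laplacian hS (fun y => (Real.log (B.volumeDensity hS y) : ℂ)) x

end BRTTrivialization

end BRT

/-! ### Pseudohermitian geometry -/

namespace CRStructure

variable {n : ℕ} {X : Type*} [TopologicalSpace X]
  [ChartedSpace (EuclideanSpace ℝ (Fin (2 * n + 1))) X]
  [IsManifold (𝓡 (2 * n + 1)) ∞ X]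

/-- `u ∈ H_x X`, that is `u = W + W̄` for some `W ∈ T^{1,0}_x X`. -/
def IsHorizontal (S : CRStructure n X) {x : X} (u : RT n x) : Prop :=
  ∃ W ∈ S.T10 x, (1 : ℂ) ⊗ₜ[ℝ] u = W + cConj W

open Classical in
/-- The complex structure `J : HX → HX`, `J(W + W̄) = i W - i W̄` for `W ∈ T^{1,0}X` (extended by `0`
to vectors outside `HX`). The right side is the real vector `2 Re(i W)`. -/
def J (S : CRStructure n X) {x : X} (u : RT n x) : RT n x :=
  if h : S.IsHorizontal u then (2 : ℝ) • cRe (Complex.I • h.choose) else 0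

end CRStructure

/-- `ξ` is the smooth vector field with `θ₀(ξ) = 1` and `dθ₀(ξ, ·) = 0`. -/
structure IsReebField {n : ℕ} {X : Type*} [TopologicalSpace X]
    [ChartedSpace (EuclideanSpace ℝ (Fin (2 * n + 1))) X] [IsManifold (𝓡 (2 * n + 1)) ∞ X]
    (θ₀ : OneForm n X) (ξ : RField n X) : Prop where
  smooth : RSmoothOn ξ Set.univ
  apply_eq_one : ∀ x, θ₀ x (ξ x) = 1
  d_eq_zero : ∀ x (v : RT n x), dForm θ₀ x (ξ x) v = 0

section TanakaWebster

variable {n : ℕ} {X : Type*} [TopologicalSpace X]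
  [ChartedSpace (EuclideanSpace ℝ (Fin (2 * n + 1))) X]
  [IsManifold (𝓡 (2 * n + 1)) ∞ X]

/-- Linear connections on `TX`. Note that `nab V x u` is `∇_u V` at `x`. -/
abbrev Connection (n : ℕ) (X : Type*) [TopologicalSpace X]
    [ChartedSpace (EuclideanSpace ℝ (Fin (2 * n + 1))) X]
    [IsManifold (𝓡 (2 * n + 1)) ∞ X] : Type _ :=
  CovariantDerivative (𝓡 (2 * n + 1)) (EuclideanSpace ℝ (Fin (2 * n + 1)))
    (TangentSpace (𝓡 (2 * n + 1)) : X → Type)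

/-- `nab` is the Tanaka–Webster connection of the CR structure `S` and the pseudohermitian
structure `θ₀` with the Reeb field `ξ`. -/
structure IsTanakaWebster (S : CRStructure n X) (θ₀ : OneForm n X) (ξ : RField n X)
    (nab : Connection n X) : Prop where
  smooth : CovariantDerivative.ContMDiffCovariantDerivative nab ∞
  /-- `HX` is parallel. -/
  horizontal_parallel : ∀ V : RField n X, RSmoothOn V Set.univ → (∀ x, S.IsHorizontal (V x)) →
    ∀ x (u : RT n x), S.IsHorizontal (nab V x u)
  /-- `∇ξ = 0`. -/
  reeb_parallel : ∀ x (u : RT n x), nab ξ x u = 0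
  /-- `∇J = 0`. -/
  J_parallel : ∀ V : RField n X, RSmoothOn V Set.univ → (∀ x, S.IsHorizontal (V x)) →
    ∀ x (u : RT n x), nab (fun y => S.J (V y)) x u = S.J (nab V x u)
  /-- `∇dθ₀ = 0`. -/
  d_parallel : ∀ V W : RField n X, RSmoothOn V Set.univ → RSmoothOn W Set.univ →
    ∀ x (u : RT n x), mvfderiv (𝓡 (2 * n + 1)) (fun y => dForm θ₀ y (V y) (W y)) x u
      = dForm θ₀ x (nab V x u) (W x) + dForm θ₀ x (V x) (nab W x u)
  /-- `τ(u, v) = dθ₀(u, v) ξ` for horizontal `u`, `v`, where `τ` is the torsion. -/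
  torsion_horizontal : ∀ x (u v : RT n x), S.IsHorizontal u → S.IsHorizontal v →
    nab.torsion x u v = dForm θ₀ x u v • ξ x
  /-- `τ(ξ, J u) = - J τ(ξ, u)` for horizontal `u`. -/
  torsion_reeb : ∀ x (u : RT n x), S.IsHorizontal u →
    nab.torsion x (ξ x) (S.J u) = -S.J (nab.torsion x (ξ x) u)

/-- The complex linear extension of a connection: `∇_U Z` at `x` for a complex tangent vector `U` at
`x` and a complex vector field `Z`. -/
def cNabla (nab : Connection n X) (Z : CField n X) (x : X) (U : CT n x) : CT n x :=
  cMk (nab (fun y => cRe (Z y)) x (cRe U) - nab (fun y => cIm (Z y)) x (cIm U))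
    (nab (fun y => cIm (Z y)) x (cRe U) + nab (fun y => cRe (Z y)) x (cIm U))

/-- A smooth frame `Z_α` of `T^{1,0}X` on an open set `D`, with its dual frame `θ^α`: the complex
one-forms with `θ^β(Z_α) = δ_α^β` that vanish on `T^{0,1}X` and on the Reeb field. -/
structure CRFrame (S : CRStructure n X) (ξ : RField n X) where
  /-- The domain of the frame. -/
  D : Set X
  isOpen : IsOpen D
  /-- The frame. -/
  Z : Fin n → CField n X
  smooth : ∀ α, CSmoothOn (Z α) D
  linearIndependent : ∀ x ∈ D, LinearIndependent ℂ (fun α => Z α x)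
  span : ∀ x ∈ D, Submodule.span ℂ (Set.range fun α => Z α x) = S.T10 x
  /-- The dual frame. -/
  θ : Fin n → Π x : X, CT n x →ₗ[ℂ] ℂ
  θ_apply_Z : ∀ x ∈ D, ∀ α β, θ β x (Z α x) = if α = β then 1 else 0
  θ_apply_T01 : ∀ x ∈ D, ∀ β, ∀ U ∈ S.T01 x, θ β x U = 0
  θ_apply_reeb : ∀ x ∈ D, ∀ β, θ β x ((1 : ℂ) ⊗ₜ[ℝ] ξ x) = 0

namespace CRFrame

variable {S : CRStructure n X} {ξ : RField n X}

/-- The connection forms `ω_α^β`, `∇ Z_α = ω_α^β ⊗ Z_β`. -/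
def connectionForm (F : CRFrame S ξ) (nab : Connection n X) (α β : Fin n) (x : X) (U : CT n x) : ℂ :=
  F.θ β x (cNabla nab (F.Z α) x U)

/-- The curvature forms `Θ_α^β = dω_α^β - ω_α^γ ∧ ω_γ^β`, evaluated on vector fields. -/
def curvatureForm (F : CRFrame S ξ) (nab : Connection n X) (α β : Fin n) (U V : CField n X) (x : X) :
    ℂ :=
  cdForm (F.connectionForm nab α β) U V x
    - ∑ γ, (F.connectionForm nab α γ x (U x) * F.connectionForm nab γ β x (V x)
      - F.connectionForm nab α γ x (V x) * F.connectionForm nab γ β x (U x))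

/-- The pseudohermitian curvature tensor `R_α^β_{j k̄}`, the coefficient of `θ^j ∧ θ^{k̄}` in
`Θ_α^β`, that is `Θ_α^β(Z_j, Z_{k̄})`. -/
def curvature (F : CRFrame S ξ) (nab : Connection n X) (α β j k : Fin n) (x : X) : ℂ :=
  F.curvatureForm nab α β (F.Z j) (fun y => cConj (F.Z k y)) x

/-- The pseudohermitian Ricci tensor `R_{α k̄} = ∑_j R_α^j_{j k̄}`. -/
def ricci (F : CRFrame S ξ) (nab : Connection n X) (α k : Fin n) (x : X) : ℂ :=
  ∑ j, F.curvature nab α j j k x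

/-- The matrix `g_{α β̄}` with `dθ₀ = i g_{α β̄} θ^α ∧ θ^{β̄}`, so `dθ₀(Z_α, Z_{β̄}) = i g_{α β̄}`. -/
def metric (F : CRFrame S ξ) (θ₀ : OneForm n X) (x : X) : Matrix (Fin n) (Fin n) ℂ :=
  Matrix.of fun α β => -Complex.I * cEval₂ (dForm θ₀ x) (F.Z α x) (cConj (F.Z β x))

/-- The Tanaka–Webster scalar curvature `R = g^{k̄ α} R_{α k̄}` on the domain of the frame. -/
def scalarCurvature (F : CRFrame S ξ) (θ₀ : OneForm n X) (nab : Connection n X) (x : X) : ℂ :=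
  ∑ α, ∑ k, (F.metric θ₀ x)⁻¹ k α * F.ricci nab α k x

end CRFrame

end TanakaWebster

end RigidCR

end

/-! In a BRT trivialization both curvatures depend only on the complex Hessian `G = (∂²φ/∂z_j∂z̄_k)`
of the potential, and both are multiples of `tr(G⁻¹ ∂∂̄ log det G)`. The theorem compares the two
multiples.

The contact form is `θ₀ = dθ - dφ(i dz)` (`theta₀_eq`), so `dθ₀(Z_j, Z̄_k) = 2i G_{jk}` and the
other pairings of the frame `Z_j, Z̄_k, T` vanish (`dtheta₀_Z_Zbar`, `dtheta₀_Z_Z`, `dtheta₀_T`).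
The coefficients of `Z_j` do not depend on `θ`, hence `[T, Z_j] = 0` and `[Z_j, Z̄_k] = -2i G_{jk}
T`. Strong pseudoconvexity makes `G` invertible (`det_hess_ne_zero`), which forces the Reeb field to
be `T` (`reeb_eq`).

Tanaka–Webster side. The connection preserves types. The torsion axioms give `∇_{Z̄_k} Z_j = 0`
(`cNabla_mixed`) and `∇_T Z_j = 0` (`cNabla_T`), and `∇dθ₀ = 0` gives the matrix `∂_j G · G⁻¹` for
`∇_{Z_j}` (`cNabla_Z_Z`). This is the Chern connection of the Kähler metric `G` on the space of the
coordinates `z`. Its curvature is `∂̄(∂G · G⁻¹)`, and the Kähler symmetry with Jacobi's formula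
(`sum_gam`) turns the Ricci contraction into `-∂∂̄ log det G`. An arbitrary frame differs from the
BRT frame by an invertible matrix `A`; curvature and metric transform by `A` (`curvatureForm_gauge`,
`metric_eq`), and the trace does not see it. Since the metric is `2G`, the scalar curvature is
`-(1/2) tr(G⁻¹ ∂∂̄ log det G)` (`scalarCurvature_eq`).

Rigid side. The density `a` is a nonzero constant times `det G` (`volumeDensity_eq`), because the
top power of a two-form `∑ r_k ∧ s_k` is a universal constant times a determinant. The constant
disappears in the derivatives of `log a`. The Levi metric is `G/π`, so its dual is `π G⁻¹`, and the
Laplacian of `log a` is `-2π tr(G⁻¹ ∂∂̄ log det G)` (`rigidScalarCurvature_eq`). -/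

open scoped Manifold ContDiff TensorProduct

noncomputable section

set_option linter.unusedSectionVars false

namespace RigidCR

/-! ### Complex linear and bilinear extensions of real maps. -/

section ComplexAlgebra

variable {V : Type*} [AddCommGroup V] [Module ℝ V]

theorem cExt_ext {U W : ℂ ⊗[ℝ] V} (h1 : cRe U = cRe W) (h2 : cIm U = cIm W) : U = W := by
  rw [← cMk_cRe_cIm U, ← cMk_cRe_cIm W, h1, h2]

@[simp] theorem cRe_cMk (u v : V) : cRe (cMk u v) = u := by simp [cMk]

@[simp] theorem cIm_cMk (u v : V) : cIm (cMk u v) = v := by simp [cMk]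

@[simp] theorem cRe_smul (c : ℂ) (U : ℂ ⊗[ℝ] V) :
    cRe (c • U) = c.re • cRe U - c.im • cIm U := by
  induction U using TensorProduct.induction_on with
  | zero => simp
  | tmul z v =>
    rw [TensorProduct.smul_tmul']
    simp only [smul_eq_mul, cRe_tmul, cIm_tmul, Complex.mul_re]
    module
  | add a b ha hb => rw [smul_add, map_add, map_add, map_add, ha, hb]; module

@[simp] theorem cIm_smul (c : ℂ) (U : ℂ ⊗[ℝ] V) :
    cIm (c • U) = c.re • cIm U + c.im • cRe U := by
  induction U using TensorProduct.induction_on with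
  | zero => simp
  | tmul z v =>
    rw [TensorProduct.smul_tmul']
    simp only [smul_eq_mul, cRe_tmul, cIm_tmul, Complex.mul_im]
    module
  | add a b ha hb => rw [smul_add, map_add, map_add, map_add, ha, hb]; module

@[simp] theorem cRe_cConj (U : ℂ ⊗[ℝ] V) : cRe (cConj U) = cRe U := by
  induction U using TensorProduct.induction_on with
  | zero => simp
  | tmul z v => simp
  | add a b ha hb => rw [map_add, map_add, map_add, ha, hb]

@[simp] theorem cIm_cConj (U : ℂ ⊗[ℝ] V) : cIm (cConj U) = -cIm U := by
  induction U using TensorProduct.induction_on with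
  | zero => simp
  | tmul z v => simp
  | add a b ha hb => rw [map_add, map_add, map_add, ha, hb]; module

theorem tmul_eq_smul (z : ℂ) (v : V) : z ⊗ₜ[ℝ] v = z • ((1 : ℂ) ⊗ₜ[ℝ] v) := by
  rw [TensorProduct.smul_tmul', smul_eq_mul, mul_one]

variable {F : Type*} [AddCommGroup F] [Module ℝ F] [Module ℂ F] [IsScalarTower ℝ ℂ F]

/-- The complex linear extension of a real linear map into a complex vector space. -/
def cExt (f : V →ₗ[ℝ] F) : (ℂ ⊗[ℝ] V) →ₗ[ℂ] F where
  toFun U := f (cRe U) + Complex.I • f (cIm U)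
  map_add' U W := by simp only [map_add, smul_add]; abel
  map_smul' c U := by
    simp only [cRe_smul, cIm_smul, map_add, map_sub, map_smul, RingHom.id_apply, smul_add]
    have h : ∀ (r : ℝ) (w : F), r • w = (r : ℂ) • w := fun r w => by
      exact (algebraMap_smul ℂ r w).symm
    simp only [h, smul_smul]
    conv_rhs => rw [← Complex.re_add_im c]
    match_scalars
    · ring
    · linear_combination (-(c.im : ℂ)) * Complex.I_sq

theorem cExt_apply (f : V →ₗ[ℝ] F) (U : ℂ ⊗[ℝ] V) :
    cExt f U = f (cRe U) + Complex.I • f (cIm U) := rfl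

@[simp] theorem cExt_one_tmul (f : V →ₗ[ℝ] F) (v : V) : cExt f ((1 : ℂ) ⊗ₜ[ℝ] v) = f v := by
  simp [cExt_apply]

/-- The complex bilinear extension of a real bilinear map into a complex vector space. -/
def cExt₂ (f : V →ₗ[ℝ] V →ₗ[ℝ] F) : (ℂ ⊗[ℝ] V) →ₗ[ℂ] (ℂ ⊗[ℝ] V) →ₗ[ℂ] F :=
  cExt (F := (ℂ ⊗[ℝ] V) →ₗ[ℂ] F)
    { toFun := fun u => cExt (f u)
      map_add' := fun u v => by
        ext w; simp [cExt_apply]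
      map_smul' := fun r u => by
        apply LinearMap.ext; intro U
        simp only [cExt_apply, map_smul, LinearMap.smul_apply, RingHom.id_apply, smul_add]
        rw [smul_comm] }

theorem cExt₂_apply (f : V →ₗ[ℝ] V →ₗ[ℝ] F) (U W : ℂ ⊗[ℝ] V) :
    cExt₂ f U W = (f (cRe U) (cRe W) + Complex.I • f (cRe U) (cIm W))
      + Complex.I • (f (cIm U) (cRe W) + Complex.I • f (cIm U) (cIm W)) := rfl

@[simp] theorem cExt₂_one_tmul (f : V →ₗ[ℝ] V →ₗ[ℝ] F) (u v : V) :
    cExt₂ f ((1 : ℂ) ⊗ₜ[ℝ] u) ((1 : ℂ) ⊗ₜ[ℝ] v) = f u v := by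
  simp [cExt₂_apply]

/-- `cEval₂` takes a bare function, about which no linearity is known. Passing to a bilinear map
makes expansions in a frame possible through `map_sum` and `map_smul`. -/
theorem cEval₂_eq_cExt₂ (α : V → V → ℝ) (f : V →ₗ[ℝ] V →ₗ[ℝ] ℂ)
    (h : ∀ u v, (α u v : ℂ) = f u v) (U W : ℂ ⊗[ℝ] V) : cEval₂ α U W = cExt₂ f U W := by
  simp only [cEval₂, cEval, h, cExt₂_apply, smul_eq_mul]

end ComplexAlgebra

/-! ### Differentiable complex vector fields and the complexified connection. -/

section Fields

variable {n : ℕ} {X : Type*} [TopologicalSpace X]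
  [ChartedSpace (EuclideanSpace ℝ (Fin (2 * n + 1))) X]
  [IsManifold (𝓡 (2 * n + 1)) ∞ X]

/-- The real vector field `V` is differentiable at `x`. -/
def RDiffAt (V : RField n X) (x : X) : Prop :=
  MDifferentiableAt (𝓡 (2 * n + 1)) (𝓡 (2 * n + 1)).tangent
    (fun y => (⟨y, V y⟩ : TangentBundle (𝓡 (2 * n + 1)) X)) x

/-- The complex vector field `Z` is differentiable at `x`. -/
def CDiffAt (Z : CField n X) (x : X) : Prop :=
  RDiffAt (fun y => cRe (Z y)) x ∧ RDiffAt (fun y => cIm (Z y)) x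

variable {F : Type*} [NormedAddCommGroup F] [NormedSpace ℝ F]

/-- Differentiability at `x` of a function into a real normed space. -/
abbrev FDiffAt (f : X → F) (x : X) : Prop := MDifferentiableAt (𝓡 (2 * n + 1)) 𝓘(ℝ, F) f x

theorem FDiffAt.clm_comp {F' : Type*} [NormedAddCommGroup F'] [NormedSpace ℝ F']
    {f : X → F} {x : X} (hf : FDiffAt (n := n) f x) (L : F →L[ℝ] F') :
    FDiffAt (n := n) (fun y => L (f y)) x :=
  (L.differentiableAt.mdifferentiableAt (x := f x)).comp x hf

theorem mvfderiv_clm_comp {F' : Type*} [NormedAddCommGroup F'] [NormedSpace ℝ F']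
    {f : X → F} {x : X} (hf : FDiffAt (n := n) f x) (L : F →L[ℝ] F') (v : RT n x) :
    mvfderiv (𝓡 (2 * n + 1)) (fun y => L (f y)) x v = L (mvfderiv (𝓡 (2 * n + 1)) f x v) := by
  have := mfderiv_comp_apply x (L.differentiableAt.mdifferentiableAt (x := f x)) hf v
  simp only [mfderiv_eq_fderiv, ContinuousLinearMap.fderiv] at this
  exact this

theorem FDiffAt.congr {f g : X → F} {x : X} (hf : FDiffAt (n := n) f x)
    (h : g =ᶠ[nhds x] f) : FDiffAt (n := n) g x :=
  MDifferentiableAt.congr_of_eventuallyEq hf h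

theorem mvfderiv_congr {f g : X → F} {x : X} (h : f =ᶠ[nhds x] g) :
    mvfderiv (𝓡 (2 * n + 1)) f x = mvfderiv (𝓡 (2 * n + 1)) g x := by
  ext v
  simp only [mvfderiv, h.mfderiv_eq]
  rfl

theorem cDeriv_congr {f g : X → ℂ} {x : X} (h : f =ᶠ[nhds x] g) (U : CT n x) :
    cDeriv U f = cDeriv U g := by
  simp only [cDeriv, mvfderiv_congr h]

theorem cDeriv_eq_cExt {f : X → ℂ} {x : X} (U : CT n x) :
    cDeriv U f = cExt (mvfderiv (𝓡 (2 * n + 1)) f x : RT n x →ₗ[ℝ] ℂ) U := rfl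

theorem RDiffAt.add {V W : RField n X} {x : X} (hV : RDiffAt V x) (hW : RDiffAt W x) :
    RDiffAt (fun y => V y + W y) x :=
  have : IsManifold (𝓡 (2 * n + 1)) 1 X := .of_le (n := ∞) (by simp)
  mdifferentiableAt_add_section hV hW

theorem RDiffAt.neg {V : RField n X} {x : X} (hV : RDiffAt V x) :
    RDiffAt (fun y => -V y) x :=
  have : IsManifold (𝓡 (2 * n + 1)) 1 X := .of_le (n := ∞) (by simp)
  mdifferentiableAt_neg_section hV

theorem RDiffAt.sub {V W : RField n X} {x : X} (hV : RDiffAt V x) (hW : RDiffAt W x) :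
    RDiffAt (fun y => V y - W y) x :=
  have : IsManifold (𝓡 (2 * n + 1)) 1 X := .of_le (n := ∞) (by simp)
  mdifferentiableAt_sub_section hV hW

theorem RDiffAt.smul {f : X → ℝ} {V : RField n X} {x : X} (hf : FDiffAt (n := n) f x)
    (hV : RDiffAt V x) : RDiffAt (fun y => f y • V y) x :=
  have : IsManifold (𝓡 (2 * n + 1)) 1 X := .of_le (n := ∞) (by simp)
  MDifferentiableAt.smul_section hf hV

theorem RDiffAt.zero (x : X) : RDiffAt (fun y => (0 : RT n y)) x :=
  have : IsManifold (𝓡 (2 * n + 1)) 1 X := .of_le (n := ∞) (by simp)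
  Bundle.mdifferentiableAt_zeroSection (𝕜 := ℝ) (IB := 𝓡 (2 * n + 1))
    (F := EuclideanSpace ℝ (Fin (2 * n + 1))) (E := fun y : X => RT n y)

theorem RDiffAt.congr {V W : RField n X} {x : X} (hV : RDiffAt V x)
    (h : ∀ᶠ y in nhds x, W y = V y) : RDiffAt W x :=
  MDifferentiableAt.congr_of_eventuallyEq hV (h.mono fun y hy => by simp only [hy])

theorem RSmoothOn.rDiffAt {V : RField n X} {D : Set X} (hV : RSmoothOn V D) (hD : IsOpen D)
    {x : X} (hx : x ∈ D) : RDiffAt V x :=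
  ((hV x hx).contMDiffAt (hD.mem_nhds hx)).mdifferentiableAt (by simp)

theorem CSmoothOn.cDiffAt {Z : CField n X} {D : Set X} (hZ : CSmoothOn Z D) (hD : IsOpen D)
    {x : X} (hx : x ∈ D) : CDiffAt Z x :=
  ⟨hZ.1.rDiffAt hD hx, hZ.2.rDiffAt hD hx⟩

theorem FDiffAt.re {f : X → ℂ} {x : X} (hf : FDiffAt (n := n) f x) :
    FDiffAt (n := n) (fun y => (f y).re) x := hf.clm_comp Complex.reCLM

theorem FDiffAt.im {f : X → ℂ} {x : X} (hf : FDiffAt (n := n) f x) :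
    FDiffAt (n := n) (fun y => (f y).im) x := hf.clm_comp Complex.imCLM

theorem CDiffAt.add {Z W : CField n X} {x : X} (hZ : CDiffAt Z x) (hW : CDiffAt W x) :
    CDiffAt (fun y => Z y + W y) x :=
  ⟨by simpa only [map_add] using hZ.1.add hW.1, by simpa only [map_add] using hZ.2.add hW.2⟩

theorem CDiffAt.smul {f : X → ℂ} {Z : CField n X} {x : X} (hf : FDiffAt (n := n) f x)
    (hZ : CDiffAt Z x) : CDiffAt (fun y => f y • Z y) x :=
  ⟨by simpa only [cRe_smul] using (RDiffAt.smul hf.re hZ.1).sub (RDiffAt.smul hf.im hZ.2),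
    by simpa only [cIm_smul] using (RDiffAt.smul hf.re hZ.2).add (RDiffAt.smul hf.im hZ.1)⟩

theorem CDiffAt.zero (x : X) : CDiffAt (fun y => (0 : CT n y)) x :=
  ⟨by simpa only [map_zero] using RDiffAt.zero x, by simpa only [map_zero] using RDiffAt.zero x⟩

theorem CDiffAt.sum {ι : Type*} (s : Finset ι) {Z : ι → CField n X} {x : X}
    (hZ : ∀ i ∈ s, CDiffAt (Z i) x) : CDiffAt (fun y => ∑ i ∈ s, Z i y) x := by
  classical
  induction s using Finset.induction_on with
  | empty => simpa using CDiffAt.zero x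
  | insert a s ha ih =>
    simp only [Finset.sum_insert ha]
    exact (hZ a (by simp)).add (ih fun i hi => hZ i (by simp [hi]))

theorem CDiffAt.conj {Z : CField n X} {x : X} (hZ : CDiffAt Z x) :
    CDiffAt (fun y => cConj (Z y)) x :=
  ⟨by simpa only [cRe_cConj] using hZ.1, by simpa only [cIm_cConj] using hZ.2.neg⟩

theorem RDiffAt.ofReal {V : RField n X} {x : X} (hV : RDiffAt V x) :
    CDiffAt (fun y => (1 : ℂ) ⊗ₜ[ℝ] V y) x :=
  ⟨by simpa using hV, by simpa using RDiffAt.zero x⟩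

section Nabla

variable (nab : Connection n X)

/-- A connection acts on arbitrary fields, but its rules are available only where the fields are
differentiable; this is why `RDiffAt` and `CDiffAt` are carried through all computations. -/
theorem nab_congr {V W : RField n X} {x : X} (hV : RDiffAt V x)
    (h : ∀ᶠ y in nhds x, V y = W y) : nab V x = nab W x :=
  have : IsManifold (𝓡 (2 * n + 1)) 1 X := .of_le (n := ∞) (by simp)
  nab.isCovariantDerivativeOn.congr_of_eventuallyEq (s := Set.univ) hV
    (hV.congr (h.mono fun _ hy => hy.symm)) Filter.univ_mem h

theorem nab_add {V W : RField n X} {x : X} (hV : RDiffAt V x) (hW : RDiffAt W x) (u : RT n x) :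
    nab (fun y => V y + W y) x u = nab V x u + nab W x u := by
  have : IsManifold (𝓡 (2 * n + 1)) 1 X := .of_le (n := ∞) (by simp)
  exact congrArg (· u) (nab.isCovariantDerivativeOnUniv.add hV hW)

theorem nab_smul {f : X → ℝ} {V : RField n X} {x : X} (hf : FDiffAt (n := n) f x)
    (hV : RDiffAt V x) (u : RT n x) :
    nab (fun y => f y • V y) x u
      = f x • nab V x u + (mvfderiv (𝓡 (2 * n + 1)) f x u) • V x := by
  have : IsManifold (𝓡 (2 * n + 1)) 1 X := .of_le (n := ∞) (by simp)
  have := congrArg (· u) (nab.isCovariantDerivativeOnUniv.leibniz hV hf)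
  simp only [add_apply, smul_apply,
    ContinuousLinearMap.smulRight_apply] at this
  exact this

theorem nab_neg {V : RField n X} {x : X} (hV : RDiffAt V x) (u : RT n x) :
    nab (fun y => -V y) x u = -nab V x u := by
  have := nab_smul nab (f := fun _ => (-1 : ℝ)) mdifferentiableAt_const hV u
  simpa [mvfderiv_const] using this

theorem nab_sub {V W : RField n X} {x : X} (hV : RDiffAt V x) (hW : RDiffAt W x) (u : RT n x) :
    nab (fun y => V y - W y) x u = nab V x u - nab W x u := by
  have := nab_add nab hV hW.neg u
  simp only [nab_neg nab hW, ← sub_eq_add_neg] at this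
  exact this

theorem nab_zero (x : X) (u : RT n x) : nab (fun y => (0 : RT n y)) x u = 0 := by
  have := nab_smul nab (f := fun _ => (0 : ℝ)) mdifferentiableAt_const (RDiffAt.zero x) u
  simpa [mvfderiv_const] using this

/-- The complex covariant derivative of a complex field along real vectors. -/
def cNablaReal (Z : CField n X) (x : X) : RT n x →ₗ[ℝ] CT n x where
  toFun u := cMk (nab (fun y => cRe (Z y)) x u) (nab (fun y => cIm (Z y)) x u)
  map_add' u v := by apply cExt_ext <;> simp
  map_smul' c u := by apply cExt_ext <;> simp

theorem cNabla_eq_cExt (Z : CField n X) (x : X) (U : CT n x) :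
    cNabla nab Z x U = cExt (cNablaReal nab Z x) U := by
  apply cExt_ext <;> simp [cNabla, cExt_apply, cNablaReal, sub_eq_add_neg]

theorem cNabla_congr {Z W : CField n X} {x : X} (hZ : CDiffAt Z x)
    (h : ∀ᶠ y in nhds x, Z y = W y) (U : CT n x) : cNabla nab Z x U = cNabla nab W x U := by
  simp only [cNabla, nab_congr nab hZ.1 (h.mono fun y hy => congrArg cRe hy),
    nab_congr nab hZ.2 (h.mono fun y hy => congrArg cIm hy)]

theorem cNabla_add {Z W : CField n X} {x : X} (hZ : CDiffAt Z x) (hW : CDiffAt W x)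
    (U : CT n x) :
    cNabla nab (fun y => Z y + W y) x U = cNabla nab Z x U + cNabla nab W x U := by
  apply cExt_ext <;>
  · simp only [cNabla, map_add, nab_add nab hZ.1 hW.1, nab_add nab hZ.2 hW.2, cRe_cMk, cIm_cMk]
    module

theorem cNabla_smul {f : X → ℂ} {Z : CField n X} {x : X} (hf : FDiffAt (n := n) f x)
    (hZ : CDiffAt Z x) (U : CT n x) :
    cNabla nab (fun y => f y • Z y) x U = cDeriv U f • Z x + f x • cNabla nab Z x U := by
  have hre : ∀ u : RT n x, mvfderiv (𝓡 (2 * n + 1)) (fun y => (f y).re) x u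
      = (mvfderiv (𝓡 (2 * n + 1)) f x u).re := mvfderiv_clm_comp hf Complex.reCLM
  have him : ∀ u : RT n x, mvfderiv (𝓡 (2 * n + 1)) (fun y => (f y).im) x u
      = (mvfderiv (𝓡 (2 * n + 1)) f x u).im := mvfderiv_clm_comp hf Complex.imCLM
  apply cExt_ext <;>
  · simp only [cNabla, cRe_smul, cIm_smul, cRe_cMk, cIm_cMk, map_add, cDeriv, cEval,
      nab_sub nab (RDiffAt.smul hf.re hZ.1) (RDiffAt.smul hf.im hZ.2),
      nab_add nab (RDiffAt.smul hf.re hZ.2) (RDiffAt.smul hf.im hZ.1),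
      nab_smul nab hf.re hZ.1, nab_smul nab hf.im hZ.1, nab_smul nab hf.re hZ.2,
      nab_smul nab hf.im hZ.2, hre, him, Complex.add_re, Complex.add_im, Complex.I_mul_re,
      Complex.I_mul_im]
    module

theorem cNabla_zero (x : X) (U : CT n x) : cNabla nab (fun y => (0 : CT n y)) x U = 0 := by
  apply cExt_ext <;> simp [cNabla, nab_zero]

theorem cNabla_sum {ι : Type*} (s : Finset ι) {Z : ι → CField n X} {x : X}
    (hZ : ∀ i ∈ s, CDiffAt (Z i) x) (U : CT n x) :
    cNabla nab (fun y => ∑ i ∈ s, Z i y) x U = ∑ i ∈ s, cNabla nab (Z i) x U := by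
  classical
  induction s using Finset.induction_on with
  | empty => simpa using cNabla_zero nab x U
  | insert a s ha ih =>
    simp only [Finset.sum_insert ha]
    rw [cNabla_add nab (hZ a (by simp)) (CDiffAt.sum s fun i hi => hZ i (by simp [hi])),
      ih fun i hi => hZ i (by simp [hi])]

/-- The connection is real, so it commutes with conjugating the field and the direction together. -/
theorem cNabla_conj {Z : CField n X} {x : X} (hZ : CDiffAt Z x) (U : CT n x) :
    cNabla nab (fun y => cConj (Z y)) x (cConj U) = cConj (cNabla nab Z x U) := by
  apply cExt_ext
  · simp [cNabla, nab_neg nab hZ.2]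
  · simp only [cNabla, cRe_cConj, cIm_cConj, nab_neg nab hZ.2, cIm_cMk, map_neg]
    abel

end Nabla

end Fields

/-! ### Constant fields and exterior derivatives in a smooth chart. -/

section Chart

variable {n : ℕ} {X : Type*} [TopologicalSpace X]
  [ChartedSpace (EuclideanSpace ℝ (Fin (2 * n + 1))) X]
  [IsManifold (𝓡 (2 * n + 1)) ∞ X]

/-- The chart `e` and its inverse are smooth. -/
structure IsSmoothChart (e : OpenPartialHomeomorph X (EuclideanSpace ℂ (Fin n) × ℝ)) : Prop where
  smooth : ContMDiffOn (𝓡 (2 * n + 1)) 𝓘(ℝ, EuclideanSpace ℂ (Fin n) × ℝ) ∞ e e.source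
  symm_smooth : ContMDiffOn 𝓘(ℝ, EuclideanSpace ℂ (Fin n) × ℝ) (𝓡 (2 * n + 1)) ∞
    e.symm e.target

/-- The components of a tangent vector in the chart `e`. -/
def chartVec (e : OpenPartialHomeomorph X (EuclideanSpace ℂ (Fin n) × ℝ)) (y : X) :
    RT n y →L[ℝ] EuclideanSpace ℂ (Fin n) × ℝ :=
  mfderiv (𝓡 (2 * n + 1)) 𝓘(ℝ, EuclideanSpace ℂ (Fin n) × ℝ) e y

/-- The vector field with constant components `p` in the chart `e`. -/
def constField (e : OpenPartialHomeomorph X (EuclideanSpace ℂ (Fin n) × ℝ))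
    (p : EuclideanSpace ℂ (Fin n) × ℝ) : RField n X :=
  VectorField.mpullback (𝓡 (2 * n + 1)) 𝓘(ℝ, EuclideanSpace ℂ (Fin n) × ℝ) e (fun _ => p)

theorem coordField_eq_constField (e : OpenPartialHomeomorph X (EuclideanSpace ℂ (Fin n) × ℝ))
    (k : Fin (2 * n + 1)) : coordField e k = constField e (coordBasis n k) := rfl

theorem mlieBracket_const {E : Type*} [NormedAddCommGroup E] [NormedSpace ℝ E] (p q z : E) :
    VectorField.mlieBracket 𝓘(ℝ, E) (fun _ => p : Π z : E, TangentSpace 𝓘(ℝ, E) z)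
      (fun _ => q : Π z : E, TangentSpace 𝓘(ℝ, E) z) z = 0 := by
  have h := congrFun (VectorField.mlieBracketWithin_eq_lieBracketWithin (𝕜 := ℝ) (E := E)
    (V := fun _ => p) (W := fun _ => q) (s := Set.univ)) z
  refine (congrFun (VectorField.mlieBracketWithin_univ (𝕜 := ℝ) (I := 𝓘(ℝ, E))
    (V := fun _ => p) (W := fun _ => q)) z).symm.trans (h.trans ?_)
  simp only [VectorField.lieBracketWithin, fderivWithin_fun_const, Pi.zero_apply, zero_apply,
    sub_zero]
  rfl

namespace IsSmoothChart

variable {e : OpenPartialHomeomorph X (EuclideanSpace ℂ (Fin n) × ℝ)} (he : IsSmoothChart e)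
include he

theorem mdifferentiable :
    e.MDifferentiable (𝓡 (2 * n + 1)) 𝓘(ℝ, EuclideanSpace ℂ (Fin n) × ℝ) :=
  ⟨he.smooth.mdifferentiableOn (by simp), he.symm_smooth.mdifferentiableOn (by simp)⟩

theorem contMDiffAt {y : X} (hy : y ∈ e.source) :
    ContMDiffAt (𝓡 (2 * n + 1)) 𝓘(ℝ, EuclideanSpace ℂ (Fin n) × ℝ) ∞ e y :=
  (he.smooth y hy).contMDiffAt (e.open_source.mem_nhds hy)

theorem contMDiffAt_symm {p : EuclideanSpace ℂ (Fin n) × ℝ} (hp : p ∈ e.target) :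
    ContMDiffAt 𝓘(ℝ, EuclideanSpace ℂ (Fin n) × ℝ) (𝓡 (2 * n + 1)) ∞ e.symm p :=
  (he.symm_smooth p hp).contMDiffAt (e.open_target.mem_nhds hp)

theorem isInvertible {y : X} (hy : y ∈ e.source) :
    (mfderiv (𝓡 (2 * n + 1)) 𝓘(ℝ, EuclideanSpace ℂ (Fin n) × ℝ) e y).IsInvertible :=
  ⟨he.mdifferentiable.mfderiv hy, rfl⟩

theorem isInvertible_symm {p : EuclideanSpace ℂ (Fin n) × ℝ} (hp : p ∈ e.target) :
    (mfderiv 𝓘(ℝ, EuclideanSpace ℂ (Fin n) × ℝ) (𝓡 (2 * n + 1)) e.symm p).IsInvertible :=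
  ⟨he.mdifferentiable.symm.mfderiv hp, rfl⟩

theorem chartVec_constField {y : X} (hy : y ∈ e.source) (p : EuclideanSpace ℂ (Fin n) × ℝ) :
    chartVec e y (constField e p y) = p :=
  (he.isInvertible hy).self_apply_inverse p

theorem constField_chartVec {y : X} (hy : y ∈ e.source) (v : RT n y) :
    constField e (chartVec e y v) y = v :=
  (he.isInvertible hy).inverse_apply_self v

theorem chartVec_injective {y : X} (hy : y ∈ e.source) : Function.Injective (chartVec e y) :=
  (he.isInvertible hy).injective

theorem rSmoothOn_constField (p : EuclideanSpace ℂ (Fin n) × ℝ) :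
    RSmoothOn (constField e p) e.source := by
  intro y hy
  have : IsManifold (𝓡 (2 * n + 1)) 1 X := .of_le (n := ∞) (by simp)
  refine (ContMDiffAt.mpullback_vectorField_preimage (n := ∞) (m := ∞) ?_ (he.contMDiffAt hy)
    (he.isInvertible hy) (by simp)).contMDiffWithinAt
  exact contMDiffAt_vectorSpace_iff_contDiffAt.2 contDiffAt_const

theorem rDiffAt_constField {y : X} (hy : y ∈ e.source) (p : EuclideanSpace ℂ (Fin n) × ℝ) :
    RDiffAt (constField e p) y :=
  (he.rSmoothOn_constField p).rDiffAt e.open_source hy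

/-- Pullback commutes with brackets, and constant fields on a vector space commute. -/
theorem mlieBracket_constField {y : X} (hy : y ∈ e.source)
    (p q : EuclideanSpace ℂ (Fin n) × ℝ) :
    VectorField.mlieBracket (𝓡 (2 * n + 1)) (constField e p) (constField e q) y = 0 := by
  have : IsManifold (𝓡 (2 * n + 1)) 3 X := .of_le (n := ∞) (WithTop.coe_le_coe.2 le_top)
  have : IsManifold (𝓡 (2 * n + 1)) (minSmoothness ℝ 2) X := by
    rw [minSmoothness_of_isRCLikeNormedField]
    exact .of_le (n := ∞) (WithTop.coe_le_coe.2 le_top)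
  have hc : ∀ p : EuclideanSpace ℂ (Fin n) × ℝ,
      MDifferentiableAt 𝓘(ℝ, EuclideanSpace ℂ (Fin n) × ℝ)
        (𝓘(ℝ, EuclideanSpace ℂ (Fin n) × ℝ)).tangent
        (fun z => (⟨z, p⟩ : TangentBundle 𝓘(ℝ, EuclideanSpace ℂ (Fin n) × ℝ)
          (EuclideanSpace ℂ (Fin n) × ℝ))) (e y) := fun p =>
    (contMDiffAt_vectorSpace_iff_contDiffAt (n := 1).2 contDiffAt_const).mdifferentiableAt
      (by simp)
  have h := VectorField.mpullback_mlieBracket (n := ∞) (I := 𝓡 (2 * n + 1)) (hc p) (hc q)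
    (he.contMDiffAt hy) (by
      rw [minSmoothness_of_isRCLikeNormedField]; exact WithTop.coe_le_coe.2 le_top)
  unfold constField
  rw [← h]
  exact (congrArg _ (mlieBracket_const p q (e y))).trans (map_zero _)

/-- Exhibiting the components of a field as a pullback along the inverse chart gives access to the
regularity theorems for pulled-back fields. -/
theorem mpullback_symm {V : RField n X} {p : EuclideanSpace ℂ (Fin n) × ℝ} (hp : p ∈ e.target) :
    VectorField.mpullback 𝓘(ℝ, EuclideanSpace ℂ (Fin n) × ℝ) (𝓡 (2 * n + 1)) e.symm V p
      = chartVec e (e.symm p) (V (e.symm p)) := by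
  have h := congrArg (fun A => A ((mfderiv 𝓘(ℝ, EuclideanSpace ℂ (Fin n) × ℝ) (𝓡 (2 * n + 1))
    e.symm p).inverse (V (e.symm p)))) (he.mdifferentiable.comp_symm_deriv hp)
  simp only [ContinuousLinearMap.comp_apply] at h
  rw [(he.isInvertible_symm hp).self_apply_inverse] at h
  exact h.symm

theorem chartVec_eventuallyEq (V : RField n X) {y : X} (hy : y ∈ e.source) :
    (fun z => chartVec e z (V z)) =ᶠ[nhds y] fun z =>
      VectorField.mpullback 𝓘(ℝ, EuclideanSpace ℂ (Fin n) × ℝ) (𝓡 (2 * n + 1)) e.symm V (e z) := by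
  filter_upwards [e.open_source.mem_nhds hy] with z hz
  rw [he.mpullback_symm (e.map_source hz)]
  -- The two sides live over `z` and `e.symm (e z)`, whose tangent spaces are different types;
  -- generalizing the second point removes the transport.
  have : ∀ z', z' = z → chartVec e z (V z) = chartVec e z' (V z') := by rintro _ rfl; rfl
  exact this _ (e.left_inv hz)

theorem contMDiffAt_chartVec {V : RField n X} {y : X} (hy : y ∈ e.source)
    (hV : ContMDiffAt (𝓡 (2 * n + 1)) (𝓡 (2 * n + 1)).tangent ∞
      (fun x => (⟨x, V x⟩ : TangentBundle (𝓡 (2 * n + 1)) X)) y) :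
    ContMDiffAt (𝓡 (2 * n + 1)) 𝓘(ℝ, EuclideanSpace ℂ (Fin n) × ℝ) ∞
      (fun z => chartVec e z (V z)) y := by
  have : IsManifold (𝓡 (2 * n + 1)) 1 X := .of_le (n := ∞) (by simp)
  rw [← e.left_inv hy] at hV
  have h := ContMDiffAt.mpullback_vectorField_preimage (n := ∞) (m := ∞) hV
    (he.contMDiffAt_symm (e.map_source hy)) (he.isInvertible_symm (e.map_source hy)) (by simp)
  have h2 := (contMDiffAt_vectorSpace_iff_contDiffAt.1 h).contMDiffAt
  exact ContMDiffAt.congr_of_eventuallyEq (ContMDiffAt.comp y h2 (he.contMDiffAt hy))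
    (he.chartVec_eventuallyEq V hy)

theorem fDiffAt_chartVec {V : RField n X} {y : X} (hy : y ∈ e.source) (hV : RDiffAt V y) :
    FDiffAt (n := n) (fun z => chartVec e z (V z)) y := by
  have : IsManifold (𝓡 (2 * n + 1)) 1 X := .of_le (n := ∞) (by simp)
  rw [← e.left_inv hy] at hV
  have h := MDifferentiableAt.mpullback_vectorField (n := ∞) hV
    (he.contMDiffAt_symm (e.map_source hy)) (he.isInvertible_symm (e.map_source hy))
    (WithTop.coe_le_coe.2 le_top)
  have h2 := (mdifferentiableAt_section _ _).1 h
  simp only [trivializationAt_model_space_apply] at h2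
  exact FDiffAt.congr (MDifferentiableAt.comp y h2 ((he.contMDiffAt hy).mdifferentiableAt
    (by simp))) (he.chartVec_eventuallyEq V hy)

theorem mvfderiv_comp {F : Type*} [NormedAddCommGroup F] [NormedSpace ℝ F]
    {g : EuclideanSpace ℂ (Fin n) × ℝ → F} {y : X} (hy : y ∈ e.source)
    (hg : DifferentiableAt ℝ g (e y)) (v : RT n y) :
    mvfderiv (𝓡 (2 * n + 1)) (fun z => g (e z)) y v = fderiv ℝ g (e y) (chartVec e y v) := by
  have h := mfderiv_comp_apply y hg.mdifferentiableAt
    ((he.contMDiffAt hy).mdifferentiableAt (by simp)) v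
  rw [mfderiv_eq_fderiv] at h
  exact h

theorem fDiffAt_comp {F : Type*} [NormedAddCommGroup F] [NormedSpace ℝ F]
    {g : EuclideanSpace ℂ (Fin n) × ℝ → F} {y : X} (hy : y ∈ e.source)
    (hg : DifferentiableAt ℝ g (e y)) : FDiffAt (n := n) (fun z => g (e z)) y :=
  hg.mdifferentiableAt.comp y ((he.contMDiffAt hy).mdifferentiableAt (by simp))

theorem eventuallyEq_comp_symm {F : Type*} (f : X → F) {y : X} (hy : y ∈ e.source) :
    f =ᶠ[nhds y] fun z => (f ∘ e.symm) (e z) := by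
  filter_upwards [e.open_source.mem_nhds hy] with z hz
  simp [e.left_inv hz]

theorem differentiableAt_comp_symm {F : Type*} [NormedAddCommGroup F] [NormedSpace ℝ F]
    {f : X → F} {y : X} (hy : y ∈ e.source) (hf : FDiffAt (n := n) f y) :
    DifferentiableAt ℝ (f ∘ e.symm) (e y) := by
  have hg : FDiffAt (n := n) f (e.symm (e y)) := by rwa [e.left_inv hy]
  exact (hg.comp (e y) ((he.contMDiffAt_symm (e.map_source hy)).mdifferentiableAt
      (by simp))).differentiableAt

/-- The derivative of a function in the chart. -/
theorem mvfderiv_eq {F : Type*} [NormedAddCommGroup F] [NormedSpace ℝ F] {f : X → F} {y : X}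
    (hy : y ∈ e.source) (hf : FDiffAt (n := n) f y) (v : RT n y) :
    mvfderiv (𝓡 (2 * n + 1)) f y v = fderiv ℝ (f ∘ e.symm) (e y) (chartVec e y v) := by
  rw [mvfderiv_congr (he.eventuallyEq_comp_symm f hy),
    he.mvfderiv_comp hy (he.differentiableAt_comp_symm hy hf)]

/-- A one-form that is given in the chart by the differentiable coefficients `L` is
differentiable. -/
theorem fDiffAt_form {F : Type*} [NormedAddCommGroup F] [NormedSpace ℝ F]
    {η : Π z : X, RT n z → F}
    {L : EuclideanSpace ℂ (Fin n) × ℝ → EuclideanSpace ℂ (Fin n) × ℝ →L[ℝ] F} {y : X}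
    (hy : y ∈ e.source) (hL : DifferentiableAt ℝ L (e y))
    (hη : ∀ᶠ z in nhds y, ∀ v, η z v = L (e z) (chartVec e z v)) {V : RField n X}
    (hV : RDiffAt V y) : FDiffAt (n := n) (fun z => η z (V z)) y := by
  have h : FDiffAt (n := n) (fun z => L (e z) (chartVec e z (V z))) y :=
    MDifferentiableAt.clm_apply (he.fDiffAt_comp hy hL) (he.fDiffAt_chartVec hy hV)
  exact h.congr (hη.mono fun z hz => hz _)

theorem mvfderiv_form_constField {F : Type*} [NormedAddCommGroup F] [NormedSpace ℝ F]
    {η : Π z : X, RT n z → F}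
    {L : EuclideanSpace ℂ (Fin n) × ℝ → EuclideanSpace ℂ (Fin n) × ℝ →L[ℝ] F} {y : X}
    (hy : y ∈ e.source) (hL : DifferentiableAt ℝ L (e y))
    (hη : ∀ᶠ z in nhds y, ∀ v, η z v = L (e z) (chartVec e z v))
    (p : EuclideanSpace ℂ (Fin n) × ℝ) (v : RT n y) :
    mvfderiv (𝓡 (2 * n + 1)) (fun z => η z (constField e p z)) y v
      = fderiv ℝ L (e y) (chartVec e y v) p := by
  have h : (fun z => η z (constField e p z)) =ᶠ[nhds y] fun z => L (e z) p := by
    filter_upwards [hη, e.open_source.mem_nhds hy] with z hz hz'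
    rw [hz, he.chartVec_constField hz']
  rw [mvfderiv_congr h, he.mvfderiv_comp (g := fun q => L q p) hy
    (hL.clm_apply (differentiableAt_const p)), fderiv_clm_apply hL (differentiableAt_const p)]
  simp

/-- The exterior derivative of a one-form, evaluated on differentiable fields, in the chart. -/
theorem extDeriv_eq {F : Type*} [NormedAddCommGroup F] [NormedSpace ℝ F]
    {η : Π z : X, RT n z → F}
    {L : EuclideanSpace ℂ (Fin n) × ℝ → EuclideanSpace ℂ (Fin n) × ℝ →L[ℝ] F} {y : X}
    (hy : y ∈ e.source) (hL : DifferentiableAt ℝ L (e y))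
    (hη : ∀ᶠ z in nhds y, ∀ v, η z v = L (e z) (chartVec e z v)) {V W : RField n X}
    (hV : RDiffAt V y) (hW : RDiffAt W y) :
    mvfderiv (𝓡 (2 * n + 1)) (fun z => η z (W z)) y (V y)
        - mvfderiv (𝓡 (2 * n + 1)) (fun z => η z (V z)) y (W y)
        - η y (VectorField.mlieBracket (𝓡 (2 * n + 1)) V W y)
      = fderiv ℝ L (e y) (chartVec e y (V y)) (chartVec e y (W y))
        - fderiv ℝ L (e y) (chartVec e y (W y)) (chartVec e y (V y)) := by
  have i1 : IsManifold (𝓡 (2 * n + 1)) 1 X := .of_le (n := ∞) (by simp)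
  have i2 : IsManifold (𝓡 (2 * n + 1)) 2 X := .of_le (n := ∞) (WithTop.coe_le_coe.2 le_top)
  -- The left side is tensorial in both fields, so each field may be replaced by the constant field
  -- with the same value at `y`. For constant fields the bracket vanishes and the two derivatives
  -- are those of `L`.
  let Φ : RField n X → RField n X → F := fun V W =>
    mvfderiv (𝓡 (2 * n + 1)) (fun z => η z (W z)) y (V y)
        - mvfderiv (𝓡 (2 * n + 1)) (fun z => η z (V z)) y (W y)
        - η y (VectorField.mlieBracket (𝓡 (2 * n + 1)) V W y)
  -- The form `η` is a family of bare functions; its linearity is inherited from `L`, and only near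
  -- `y`.
  have hadd : ∀ᶠ z in nhds y, ∀ v w, η z (v + w) = η z v + η z w :=
    hη.mono fun z hz v w => by simp only [hz, map_add]
  have hsmul : ∀ᶠ z in nhds y, ∀ (c : ℝ) v, η z (c • v) = c • η z v :=
    hη.mono fun z hz c v => by simp only [hz, map_smul]
  have hd := fun {V : RField n X} (hV : RDiffAt V y) => he.fDiffAt_form hy hL hη hV
  have key : ∀ {V V' W : RField n X} {f : X → ℝ}, FDiffAt (n := n) f y → RDiffAt V y →
      RDiffAt V' y → Φ (f • V) W = f y • Φ V W ∧ Φ (V + V') W = Φ V W + Φ V' W := by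
    intro V V' W f hf hV hV'
    constructor
    · have h1 : (fun z => η z ((f • V) z)) =ᶠ[nhds y] f • fun z => η z (V z) :=
        hsmul.mono fun z hz => hz _ _
      simp only [Φ]
      rw [mvfderiv_congr h1, mvfderiv_smul hf (hd hV), VectorField.mlieBracket_smul_left hf hV,
        hadd.self_of_nhds, hsmul.self_of_nhds, hsmul.self_of_nhds]
      simp only [Pi.smul_apply', map_smul, add_apply, smul_apply,
        ContinuousLinearMap.smulRight_apply]
      module
    · have h1 : (fun z => η z ((V + V') z)) =ᶠ[nhds y] (fun z => η z (V z)) + fun z => η z (V' z) :=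
        hadd.mono fun z hz => hz _ _
      simp only [Φ]
      rw [mvfderiv_congr h1, mvfderiv_add (hd hV) (hd hV'),
        VectorField.mlieBracket_add_left hV hV', hadd.self_of_nhds]
      simp only [Pi.add_apply, map_add, add_apply]
      module
  -- Antisymmetry carries tensoriality from the first slot to the second.
  have hsymm : ∀ V W : RField n X, Φ V W = -Φ W V := by
    intro V W
    have h0 : ∀ v, η y (-v) = -η y v := fun v => by
      rw [hη.self_of_nhds, hη.self_of_nhds, map_neg, map_neg]
    simp only [Φ]
    rw [VectorField.mlieBracket_swap, Pi.neg_apply, h0]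
    abel
  have t1 : ∀ W, RDiffAt W y → TensorialAt (𝓡 (2 * n + 1))
      (EuclideanSpace ℝ (Fin (2 * n + 1))) (Φ · W) y := fun W _ =>
    ⟨fun hf hV => (key hf hV hV).1, fun hV hV' => (key (f := fun _ => 0) mdifferentiableAt_const hV hV').2⟩
  have t2 : ∀ V, RDiffAt V y → TensorialAt (𝓡 (2 * n + 1))
      (EuclideanSpace ℝ (Fin (2 * n + 1))) (Φ V ·) y := fun V _ =>
    ⟨fun hf hW => by
      simp only [hsymm V]; rw [(key hf hW hW).1, smul_neg],
     fun hW hW' => by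
      simp only [hsymm V]; rw [(key (f := fun _ => 0) mdifferentiableAt_const hW hW').2, neg_add]⟩
  have h := TensorialAt.pointwise₂ t1 t2 hV (he.rDiffAt_constField hy (chartVec e y (V y))) hW
    (he.rDiffAt_constField hy (chartVec e y (W y))) (he.constField_chartVec hy _).symm
    (he.constField_chartVec hy _).symm
  have h0 : η y 0 = 0 := by rw [hη.self_of_nhds, map_zero, map_zero]
  refine h.trans ?_
  simp only [Φ]
  rw [he.mvfderiv_form_constField hy hL hη, he.mvfderiv_form_constField hy hL hη,
    he.mlieBracket_constField hy, h0, he.chartVec_constField hy, he.chartVec_constField hy, sub_zero]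

end IsSmoothChart

end Chart

/-! ### Exterior derivatives of forms and commutators of complex fields. -/

section ComplexForms

variable {n : ℕ} {X : Type*} [TopologicalSpace X]
  [ChartedSpace (EuclideanSpace ℝ (Fin (2 * n + 1))) X]
  [IsManifold (𝓡 (2 * n + 1)) ∞ X]

/-- The antisymmetrization of a bilinear form in the coordinates of the chart `e`. -/
def chartTwo {F : Type*} [NormedAddCommGroup F] [NormedSpace ℝ F]
    (e : OpenPartialHomeomorph X (EuclideanSpace ℂ (Fin n) × ℝ)) (y : X)
    (A : EuclideanSpace ℂ (Fin n) × ℝ →L[ℝ] EuclideanSpace ℂ (Fin n) × ℝ →L[ℝ] F) :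
    RT n y →ₗ[ℝ] RT n y →ₗ[ℝ] F :=
  LinearMap.mk₂ ℝ (fun v w => A (chartVec e y v) (chartVec e y w)
      - A (chartVec e y w) (chartVec e y v))
    (fun u v w => by simp only [map_add, add_apply]; abel)
    (fun c v w => by simp only [map_smul, smul_apply, smul_sub])
    (fun u v w => by simp only [map_add, add_apply]; abel)
    (fun c v w => by simp only [map_smul, smul_apply, smul_sub])

theorem chartTwo_apply {F : Type*} [NormedAddCommGroup F] [NormedSpace ℝ F]
    (e : OpenPartialHomeomorph X (EuclideanSpace ℂ (Fin n) × ℝ)) (y : X)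
    (A : EuclideanSpace ℂ (Fin n) × ℝ →L[ℝ] EuclideanSpace ℂ (Fin n) × ℝ →L[ℝ] F)
    (v w : RT n y) :
    chartTwo e y A v w = A (chartVec e y v) (chartVec e y w)
      - A (chartVec e y w) (chartVec e y v) := rfl

variable {e : OpenPartialHomeomorph X (EuclideanSpace ℂ (Fin n) × ℝ)}

/-- The extensions chosen in `dForm` are differentiable at `y`, and the coordinate formula depends
only on their values there, so the choice drops out. -/
theorem IsSmoothChart.dForm_eq (he : IsSmoothChart e) {η : OneForm n X}
    {L : EuclideanSpace ℂ (Fin n) × ℝ → EuclideanSpace ℂ (Fin n) × ℝ →L[ℝ] ℝ} {y : X}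
    (hy : y ∈ e.source) (hL : DifferentiableAt ℝ L (e y))
    (hη : ∀ᶠ z in nhds y, ∀ v, η z v = L (e z) (chartVec e z v)) (u v : RT n y) :
    dForm η y u v = chartTwo e y (fderiv ℝ L (e y)) u v := by
  have i1 : IsManifold (𝓡 (2 * n + 1)) 1 X := .of_le (n := ∞) (by simp)
  have i2 : IsManifold (𝓡 (2 * n + 1)) 2 X := .of_le (n := ∞) (WithTop.coe_le_coe.2 le_top)
  have hd : ∀ u : RT n y,
      RDiffAt (FiberBundle.extend (EuclideanSpace ℝ (Fin (2 * n + 1))) u : RField n X) y :=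
    fun u => FiberBundle.mdifferentiableAt_extend ..
  have h := he.extDeriv_eq (η := fun z => η z) hy hL hη (hd u) (hd v)
  simp only [FiberBundle.extend_apply_self] at h
  exact h

/-- The real formula `extDeriv_eq`, applied to the four pairs of real and imaginary parts, is
recombined by complex bilinearity. -/
theorem IsSmoothChart.cdForm_eq (he : IsSmoothChart e) {η : Π z : X, CT n z → ℂ}
    {L : EuclideanSpace ℂ (Fin n) × ℝ → EuclideanSpace ℂ (Fin n) × ℝ →L[ℝ] ℂ} {y : X}
    (hy : y ∈ e.source) (hL : DifferentiableAt ℝ L (e y))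
    (hη : ∀ᶠ z in nhds y, ∀ U, η z U = L (e z) (chartVec e z (cRe U))
      + Complex.I * L (e z) (chartVec e z (cIm U))) {U V : CField n X}
    (hU : CDiffAt U y) (hV : CDiffAt V y) :
    cdForm η U V y = cExt₂ (chartTwo e y (fderiv ℝ L (e y))) (U y) (V y) := by
  set ρ : Π z : X, RT n z → ℂ := fun z v => L (e z) (chartVec e z v) with hρ
  have hρ' : ∀ᶠ z in nhds y, ∀ v, ρ z v = L (e z) (chartVec e z v) :=
    Filter.Eventually.of_forall fun _ _ => rfl
  have hd := fun {V : RField n X} (hV : RDiffAt V y) => he.fDiffAt_form hy hL hρ' hV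
  have hI : ∀ {f : X → ℂ}, FDiffAt (n := n) f y → FDiffAt (n := n) (fun z => Complex.I * f z) y :=
    fun hf => hf.clm_comp (ContinuousLinearMap.mul ℝ ℂ Complex.I)
  have hdI : ∀ {f : X → ℂ}, FDiffAt (n := n) f y → ∀ v,
      mvfderiv (𝓡 (2 * n + 1)) (fun z => Complex.I * f z) y v
        = Complex.I * mvfderiv (𝓡 (2 * n + 1)) f y v := fun hf v =>
    mvfderiv_clm_comp hf (ContinuousLinearMap.mul ℝ ℂ Complex.I) v
  have hη' : ∀ V : CField n X, (fun z => η z (V z)) =ᶠ[nhds y] fun z =>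
      ρ z (cRe (V z)) + Complex.I * ρ z (cIm (V z)) := fun V => hη.mono fun z hz => hz _
  have hexp : ∀ {V : CField n X}, CDiffAt V y → ∀ v,
      mvfderiv (𝓡 (2 * n + 1)) (fun z => η z (V z)) y v
        = mvfderiv (𝓡 (2 * n + 1)) (fun z => ρ z (cRe (V z))) y v
          + Complex.I * mvfderiv (𝓡 (2 * n + 1)) (fun z => ρ z (cIm (V z))) y v := by
    intro V hV v
    rw [mvfderiv_congr (hη' V), mvfderiv_fun_add (hd hV.1) (hI (hd hV.2)), add_apply, hdI (hd hV.2)]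
  have key := fun {V W : RField n X} (hV : RDiffAt V y) (hW : RDiffAt W y) =>
    he.extDeriv_eq hy hL hρ' hV hW
  have k1 := key hU.1 hV.1
  have k2 := key hU.1 hV.2
  have k3 := key hU.2 hV.1
  have k4 := key hU.2 hV.2
  simp only [← chartTwo_apply] at k1 k2 k3 k4
  have hρadd : ∀ v w : RT n y, ρ y (v + w) = ρ y v + ρ y w := fun v w => by
    simp only [hρ, map_add]
  have hρsub : ∀ v w : RT n y, ρ y (v - w) = ρ y v - ρ y w := fun v w => by
    simp only [hρ, map_sub]
  rw [cdForm, cExt₂_apply, ← k1, ← k2, ← k3, ← k4, hη.self_of_nhds]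
  simp only [cDeriv, cEval, hexp hU, hexp hV, cBracket, cRe_cMk, cIm_cMk, smul_eq_mul]
  change _ - (ρ y _ + Complex.I * ρ y _) = _
  rw [hρadd, hρsub]
  ring_nf
  simp only [Complex.I_sq]
  ring

/-- The commutator of two complex fields, acting on functions, is their Lie bracket. -/
theorem IsSmoothChart.cDeriv_cBracket (he : IsSmoothChart e) {f : X → ℂ} {y : X}
    (hy : y ∈ e.source) (hf : ContMDiffAt (𝓡 (2 * n + 1)) 𝓘(ℝ, ℂ) ∞ f y) {U V : CField n X}
    (hU : CDiffAt U y) (hV : CDiffAt V y) :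
    cDeriv (cBracket U V y) f
      = cDeriv (U y) (fun z => cDeriv (V z) f) - cDeriv (V y) (fun z => cDeriv (U z) f) := by
  have hg : ContDiffAt ℝ ∞ (f ∘ e.symm) (e y) := by
    rw [← e.left_inv hy] at hf
    exact (hf.comp (e y) (he.contMDiffAt_symm (e.map_source hy))).contDiffAt
  have hL : DifferentiableAt ℝ (fderiv ℝ (f ∘ e.symm)) (e y) :=
    (hg.fderiv_right (m := 1) (WithTop.coe_le_coe.2 le_top)).differentiableAt (by simp)
  have hev : ∀ᶠ z in nhds y, FDiffAt (n := n) f z := by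
    have h1 := (contMDiffAt_iff_contMDiffAt_nhds (by simp)).1 (hf.of_le (m := 1) (by simp))
    exact h1.mono fun z hz => hz.mdifferentiableAt (by simp)
  -- The form here is `df`. Symmetry of the second derivative gives `d(df) = 0`, which is the
  -- commutator identity written out.
  have h := he.cdForm_eq (η := fun z U => cDeriv U f) (L := fderiv ℝ (f ∘ e.symm)) hy hL ?_ hU hV
  · have hsymm : chartTwo e y (fderiv ℝ (fderiv ℝ (f ∘ e.symm)) (e y)) = 0 := by
      refine LinearMap.ext₂ fun v w => ?_
      rw [chartTwo_apply, (hg.isSymmSndFDerivAt (by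
        rw [minSmoothness_of_isRCLikeNormedField]; exact WithTop.coe_le_coe.2 le_top)).eq]
      simp
    rw [hsymm] at h
    simp only [cdForm, cExt₂_apply, LinearMap.zero_apply, smul_zero, add_zero] at h
    exact (sub_eq_zero.1 h).symm
  · filter_upwards [hev, e.open_source.mem_nhds hy] with z hz hz' U
    simp only [cDeriv, cEval, he.mvfderiv_eq hz' hz]

end ComplexForms

/-! ### Wirtinger calculus and the complex Hessian. -/

section Wirtinger

variable {n : ℕ}

/-- The Wirtinger derivative `∂/∂z_j` of a complex function on `ℂⁿ`. -/
def dz (j : Fin n) (h : EuclideanSpace ℂ (Fin n) → ℂ) (z : EuclideanSpace ℂ (Fin n)) : ℂ :=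
  1 / 2 * (fderiv ℝ h z (EuclideanSpace.single j 1)
    - Complex.I * fderiv ℝ h z (EuclideanSpace.single j Complex.I))

/-- The Wirtinger derivative `∂/∂z̄_j` of a complex function on `ℂⁿ`. -/
def dzbar (j : Fin n) (h : EuclideanSpace ℂ (Fin n) → ℂ) (z : EuclideanSpace ℂ (Fin n)) : ℂ :=
  1 / 2 * (fderiv ℝ h z (EuclideanSpace.single j 1)
    + Complex.I * fderiv ℝ h z (EuclideanSpace.single j Complex.I))

theorem contDiffOn_fderiv_apply {E : Type*} [NormedAddCommGroup E] [NormedSpace ℝ E] {h : E → ℂ}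
    {O : Set E} (hO : IsOpen O) (hh : ContDiffOn ℝ ∞ h O) (v : E) :
    ContDiffOn ℝ ∞ (fun z => fderiv ℝ h z v) O :=
  (hh.fderiv_of_isOpen hO (by simp)).clm_apply contDiffOn_const

theorem contDiffOn_dz {h : EuclideanSpace ℂ (Fin n) → ℂ} {O : Set (EuclideanSpace ℂ (Fin n))}
    (hO : IsOpen O) (hh : ContDiffOn ℝ ∞ h O) (j : Fin n) : ContDiffOn ℝ ∞ (dz j h) O :=
  contDiffOn_const.mul ((contDiffOn_fderiv_apply hO hh _).sub
    (contDiffOn_const.mul (contDiffOn_fderiv_apply hO hh _)))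

theorem contDiffOn_dzbar {h : EuclideanSpace ℂ (Fin n) → ℂ} {O : Set (EuclideanSpace ℂ (Fin n))}
    (hO : IsOpen O) (hh : ContDiffOn ℝ ∞ h O) (j : Fin n) : ContDiffOn ℝ ∞ (dzbar j h) O :=
  contDiffOn_const.mul ((contDiffOn_fderiv_apply hO hh _).add
    (contDiffOn_const.mul (contDiffOn_fderiv_apply hO hh _)))

/-- The second derivative of a function on `ℂⁿ`, as an iterated directional derivative. -/
theorem fderiv_fderiv_apply {E : Type*} [NormedAddCommGroup E] [NormedSpace ℝ E] {h : E → ℂ}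
    {O : Set E} (hO : IsOpen O) (hh : ContDiffOn ℝ ∞ h O) {z : E} (hz : z ∈ O) (v w : E) :
    fderiv ℝ (fun z => fderiv ℝ h z v) z w = fderiv ℝ (fderiv ℝ h) z w v := by
  have hd : DifferentiableAt ℝ (fderiv ℝ h) z :=
    ((hh.fderiv_of_isOpen (m := ∞) hO (by simp)).contDiffAt (hO.mem_nhds hz)).differentiableAt
      (by simp)
  rw [fderiv_clm_apply hd (differentiableAt_const v)]
  simp

theorem fderiv_fderiv_symm {E : Type*} [NormedAddCommGroup E] [NormedSpace ℝ E] {h : E → ℂ}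
    {O : Set E} (hO : IsOpen O) (hh : ContDiffOn ℝ ∞ h O) {z : E} (hz : z ∈ O) (v w : E) :
    fderiv ℝ (fderiv ℝ h) z w v = fderiv ℝ (fderiv ℝ h) z v w :=
  ((hh.contDiffAt (hO.mem_nhds hz)).isSymmSndFDerivAt (by
    rw [minSmoothness_of_isRCLikeNormedField]; exact WithTop.coe_le_coe.2 le_top)).eq w v

theorem differentiableAt_of_contDiffOn {E F : Type*} [NormedAddCommGroup E] [NormedSpace ℝ E]
    [NormedAddCommGroup F] [NormedSpace ℝ F] {h : E → F} {O : Set E} (hO : IsOpen O)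
    (hh : ContDiffOn ℝ ∞ h O) {z : E} (hz : z ∈ O) : DifferentiableAt ℝ h z :=
  (hh.contDiffAt (hO.mem_nhds hz)).differentiableAt (by simp)

theorem fderiv_half_mul {E : Type*} [NormedAddCommGroup E] [NormedSpace ℝ E] {f g : E → ℂ} {z : E}
    (hf : DifferentiableAt ℝ f z) (hg : DifferentiableAt ℝ g z) (c : ℂ) (v : E) :
    fderiv ℝ (fun z => 1 / 2 * (f z + c * g z)) z v
      = 1 / 2 * (fderiv ℝ f z v + c * fderiv ℝ g z v) := by
  have h := ((hf.hasFDerivAt.add (hg.hasFDerivAt.const_mul c)).const_mul (1 / 2 : ℂ)).fderiv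
  refine (congrArg (· v) h).trans ?_
  simp [mul_add]

variable {h : EuclideanSpace ℂ (Fin n) → ℂ} {O : Set (EuclideanSpace ℂ (Fin n))}
  {z : EuclideanSpace ℂ (Fin n)}

theorem fderiv_dz (hO : IsOpen O) (hh : ContDiffOn ℝ ∞ h O) (hz : z ∈ O) (j : Fin n)
    (v : EuclideanSpace ℂ (Fin n)) :
    fderiv ℝ (dz j h) z v = 1 / 2 * (fderiv ℝ (fderiv ℝ h) z v (EuclideanSpace.single j 1)
      - Complex.I * fderiv ℝ (fderiv ℝ h) z v (EuclideanSpace.single j Complex.I)) := by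
  have hd := fun v => differentiableAt_of_contDiffOn hO (contDiffOn_fderiv_apply hO hh v) hz
  have h1 := fderiv_half_mul (hd (EuclideanSpace.single j 1))
    (hd (EuclideanSpace.single j Complex.I)) (-Complex.I) v
  simp only [fderiv_fderiv_apply hO hh hz, neg_mul, ← sub_eq_add_neg] at h1
  exact h1

theorem fderiv_dzbar (hO : IsOpen O) (hh : ContDiffOn ℝ ∞ h O) (hz : z ∈ O) (j : Fin n)
    (v : EuclideanSpace ℂ (Fin n)) :
    fderiv ℝ (dzbar j h) z v = 1 / 2 * (fderiv ℝ (fderiv ℝ h) z v (EuclideanSpace.single j 1)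
      + Complex.I * fderiv ℝ (fderiv ℝ h) z v (EuclideanSpace.single j Complex.I)) := by
  have hd := fun v => differentiableAt_of_contDiffOn hO (contDiffOn_fderiv_apply hO hh v) hz
  have h1 := fderiv_half_mul (hd (EuclideanSpace.single j 1))
    (hd (EuclideanSpace.single j Complex.I)) Complex.I v
  simp only [fderiv_fderiv_apply hO hh hz] at h1
  exact h1

theorem dz_dz_comm (hO : IsOpen O) (hh : ContDiffOn ℝ ∞ h O) (hz : z ∈ O) (j k : Fin n) :
    dz j (dz k h) z = dz k (dz j h) z := by
  rw [dz, dz, fderiv_dz hO hh hz, fderiv_dz hO hh hz, fderiv_dz hO hh hz, fderiv_dz hO hh hz,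
    fderiv_fderiv_symm hO hh hz (EuclideanSpace.single k 1),
    fderiv_fderiv_symm hO hh hz (EuclideanSpace.single k Complex.I),
    fderiv_fderiv_symm hO hh hz (EuclideanSpace.single k 1),
    fderiv_fderiv_symm hO hh hz (EuclideanSpace.single k Complex.I)]
  ring

theorem dz_dzbar_comm (hO : IsOpen O) (hh : ContDiffOn ℝ ∞ h O) (hz : z ∈ O) (j k : Fin n) :
    dz j (dzbar k h) z = dzbar k (dz j h) z := by
  rw [dz, dzbar, fderiv_dz hO hh hz, fderiv_dz hO hh hz, fderiv_dzbar hO hh hz,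
    fderiv_dzbar hO hh hz,
    fderiv_fderiv_symm hO hh hz (EuclideanSpace.single k 1),
    fderiv_fderiv_symm hO hh hz (EuclideanSpace.single k Complex.I),
    fderiv_fderiv_symm hO hh hz (EuclideanSpace.single k 1),
    fderiv_fderiv_symm hO hh hz (EuclideanSpace.single k Complex.I)]
  ring

/-- The complex Hessian `∂²φ/∂z_j∂z̄_k` of a real function on `ℂⁿ`. -/
def hess (φ : EuclideanSpace ℂ (Fin n) → ℝ) (z : EuclideanSpace ℂ (Fin n)) :
    Matrix (Fin n) (Fin n) ℂ :=
  Matrix.of fun j k => dz j (dzbar k fun z => (φ z : ℂ)) z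

theorem contDiffOn_ofReal {φ : EuclideanSpace ℂ (Fin n) → ℝ} (hφ : ContDiffOn ℝ ∞ φ O) :
    ContDiffOn ℝ ∞ (fun z => (φ z : ℂ)) O :=
  Complex.ofRealCLM.contDiff.comp_contDiffOn hφ

theorem fderiv_ofReal {E : Type*} [NormedAddCommGroup E] [NormedSpace ℝ E] {φ : E → ℝ} {z : E}
    (hφ : DifferentiableAt ℝ φ z) (v : E) :
    fderiv ℝ (fun z => (φ z : ℂ)) z v = (fderiv ℝ φ z v : ℝ) := by
  have h := (Complex.ofRealCLM.hasFDerivAt.comp z hφ.hasFDerivAt).fderiv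
  refine (congrArg (· v) h).trans ?_
  simp

theorem wirtinger_eq_dz {φ : EuclideanSpace ℂ (Fin n) → ℝ} (hφ : DifferentiableAt ℝ φ z)
    (j : Fin n) : wirtinger φ j z = dz j (fun z => (φ z : ℂ)) z := by
  simp only [wirtinger, dz, fderiv_ofReal hφ]

theorem conj_wirtinger_eq_dzbar {φ : EuclideanSpace ℂ (Fin n) → ℝ} (hφ : DifferentiableAt ℝ φ z)
    (j : Fin n) : starRingEnd ℂ (wirtinger φ j z) = dzbar j (fun z => (φ z : ℂ)) z := by
  have h2 : starRingEnd ℂ 2 = 2 := map_ofNat _ 2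
  simp [wirtinger, dzbar, fderiv_ofReal hφ, sub_neg_eq_add, h2]

theorem contDiffOn_hess {φ : EuclideanSpace ℂ (Fin n) → ℝ} (hO : IsOpen O)
    (hφ : ContDiffOn ℝ ∞ φ O) (j k : Fin n) : ContDiffOn ℝ ∞ (fun z => hess φ z j k) O :=
  contDiffOn_dz hO (contDiffOn_dzbar hO (contDiffOn_ofReal hφ) k) j

/-- The coordinate formula for `dθ₀` produces real second derivatives of `φ`; this form of the
complex Hessian is the one to compare them with. -/
theorem hess_apply {φ : EuclideanSpace ℂ (Fin n) → ℝ} (hO : IsOpen O)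
    (hφ : ContDiffOn ℝ ∞ φ O) (hz : z ∈ O) (j k : Fin n) :
    hess φ z j k = 1 / 4 * (((fderiv ℝ (fderiv ℝ φ) z (EuclideanSpace.single j 1)
          (EuclideanSpace.single k 1) : ℝ) : ℂ)
        + (fderiv ℝ (fderiv ℝ φ) z (EuclideanSpace.single j Complex.I)
          (EuclideanSpace.single k Complex.I) : ℝ)
        + Complex.I * (fderiv ℝ (fderiv ℝ φ) z (EuclideanSpace.single j 1)
          (EuclideanSpace.single k Complex.I) : ℝ)
        - Complex.I * (fderiv ℝ (fderiv ℝ φ) z (EuclideanSpace.single j Complex.I)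
          (EuclideanSpace.single k 1) : ℝ)) := by
  have hC := contDiffOn_ofReal hφ
  have hd : DifferentiableAt ℝ (fderiv ℝ φ) z :=
    differentiableAt_of_contDiffOn hO (hφ.fderiv_of_isOpen (m := ∞) hO (by simp)) hz
  have h2 : ∀ v w, fderiv ℝ (fderiv ℝ fun z => (φ z : ℂ)) z v w
      = (fderiv ℝ (fderiv ℝ φ) z v w : ℝ) := by
    intro v w
    rw [← fderiv_fderiv_apply hO hC hz]
    have hev : (fun z => fderiv ℝ (fun z => (φ z : ℂ)) z w) =ᶠ[nhds z]
        fun z => ((fderiv ℝ φ z w : ℝ) : ℂ) := by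
      filter_upwards [hO.mem_nhds hz] with y hy
      exact fderiv_ofReal (differentiableAt_of_contDiffOn hO hφ hy) w
    rw [hev.fderiv_eq, fderiv_ofReal (hd.clm_apply (differentiableAt_const w)),
      fderiv_clm_apply hd (differentiableAt_const w)]
    simp
  simp only [hess, Matrix.of_apply]
  rw [dz, fderiv_dzbar hO hC hz, fderiv_dzbar hO hC hz]
  simp only [h2]
  ring_nf
  simp only [Complex.I_sq]
  ring

/-- The third derivatives of a potential are symmetric. -/
theorem dz_hess_symm {φ : EuclideanSpace ℂ (Fin n) → ℝ} (hO : IsOpen O)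
    (hφ : ContDiffOn ℝ ∞ φ O) (hz : z ∈ O) (i j k : Fin n) :
    dz i (fun z => hess φ z j k) z = dz j (fun z => hess φ z i k) z :=
  dz_dz_comm hO (contDiffOn_dzbar hO (contDiffOn_ofReal hφ) k) hz i j

end Wirtinger

/-! ### The coefficients of the contact form in canonical coordinates. -/

theorem coordBasis_idxRe {n : ℕ} (j : Fin n) :
    coordBasis n (idxRe j) = (EuclideanSpace.single j 1, 0) := by
  have h : (2 * (j : ℕ)) / 2 = j := by omega
  have h2 : (2 * (j : ℕ)) % 2 = 0 := by omega
  simp [coordBasis, idxRe, h, h2]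

theorem coordBasis_idxIm {n : ℕ} (j : Fin n) :
    coordBasis n (idxIm j) = (EuclideanSpace.single j Complex.I, 0) := by
  have h : (2 * (j : ℕ) + 1) / 2 = j := by omega
  have h2 : (2 * (j : ℕ) + 1) % 2 = 1 := by omega
  simp [coordBasis, idxIm, h, h2]

theorem coordBasis_idxLast {n : ℕ} : coordBasis n idxLast = (0, 1) := by
  have h : (2 * n) / 2 = n := by omega
  simp [coordBasis, idxLast, h]

/-- Multiplication by `i` on `ℂⁿ`, as a real linear map. -/
def mulI (n : ℕ) : EuclideanSpace ℂ (Fin n) →L[ℝ] EuclideanSpace ℂ (Fin n) :=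
  (Complex.I • ContinuousLinearMap.id ℂ (EuclideanSpace ℂ (Fin n))).restrictScalars ℝ

@[simp] theorem mulI_apply {n : ℕ} (z : EuclideanSpace ℂ (Fin n)) : mulI n z = Complex.I • z := rfl

/-- The contact form `dθ - dφ(i dz)` in canonical coordinates. -/
def thetaCoeff {n : ℕ} (φ : EuclideanSpace ℂ (Fin n) → ℝ) (p : EuclideanSpace ℂ (Fin n) × ℝ) :
    EuclideanSpace ℂ (Fin n) × ℝ →L[ℝ] ℝ :=
  ContinuousLinearMap.snd ℝ _ _
    - (fderiv ℝ φ p.1).comp ((mulI n).comp (ContinuousLinearMap.fst ℝ _ _))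

theorem thetaCoeff_apply {n : ℕ} (φ : EuclideanSpace ℂ (Fin n) → ℝ)
    (p q : EuclideanSpace ℂ (Fin n) × ℝ) :
    thetaCoeff φ p q = q.2 - fderiv ℝ φ p.1 (Complex.I • q.1) := rfl

theorem differentiableAt_fderiv_fst {n : ℕ} {φ : EuclideanSpace ℂ (Fin n) → ℝ}
    {O : Set (EuclideanSpace ℂ (Fin n))} (hO : IsOpen O) (hφ : ContDiffOn ℝ ∞ φ O)
    {p : EuclideanSpace ℂ (Fin n) × ℝ} (hp : p.1 ∈ O) :
    DifferentiableAt ℝ (fderiv ℝ φ) p.1 :=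
  differentiableAt_of_contDiffOn hO (hφ.fderiv_of_isOpen (m := ∞) hO (by simp)) hp

theorem hasFDerivAt_thetaCoeff_apply {n : ℕ} {φ : EuclideanSpace ℂ (Fin n) → ℝ}
    {O : Set (EuclideanSpace ℂ (Fin n))} (hO : IsOpen O) (hφ : ContDiffOn ℝ ∞ φ O)
    {p : EuclideanSpace ℂ (Fin n) × ℝ} (hp : p.1 ∈ O) (v q : EuclideanSpace ℂ (Fin n) × ℝ) :
    DifferentiableAt ℝ (thetaCoeff φ) p ∧ fderiv ℝ (thetaCoeff φ) p v q
      = -fderiv ℝ (fderiv ℝ φ) p.1 v.1 (Complex.I • q.1) := by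
  have hd := differentiableAt_fderiv_fst hO hφ hp
  have h1 : HasFDerivAt (fun p : EuclideanSpace ℂ (Fin n) × ℝ => fderiv ℝ φ p.1)
      ((fderiv ℝ (fderiv ℝ φ) p.1).comp (ContinuousLinearMap.fst ℝ _ _)) p :=
    hd.hasFDerivAt.comp p hasFDerivAt_fst
  have h2 := (hasFDerivAt_const (ContinuousLinearMap.snd ℝ (EuclideanSpace ℂ (Fin n)) ℝ) p).sub
    (h1.clm_comp (hasFDerivAt_const ((mulI n).comp
      (ContinuousLinearMap.fst ℝ (EuclideanSpace ℂ (Fin n)) ℝ)) p))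
  have h3 : HasFDerivAt (thetaCoeff φ) _ p := h2
  refine ⟨h3.differentiableAt, ?_⟩
  rw [h3.fderiv]
  simp

/-! ### The BRT frame, its dual forms and the contact form. -/

namespace BRTTrivialization

variable {n : ℕ} {X : Type*} [TopologicalSpace X]
  [ChartedSpace (EuclideanSpace ℝ (Fin (2 * n + 1))) X]
  [IsManifold (𝓡 (2 * n + 1)) ∞ X] [MulAction Circle X] {S : CRStructure n X}
  (B : BRTTrivialization S)

theorem isSmoothChart : IsSmoothChart B.coord := ⟨B.coord_smooth, B.coord_symm_smooth⟩

theorem isOpen_D : IsOpen B.D := B.coord.open_source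

/-- The domain of the potential. -/
def ball : Set (EuclideanSpace ℂ (Fin n)) := Metric.ball 0 B.δ

theorem isOpen_ball : IsOpen B.ball := Metric.isOpen_ball

/-- The coordinates `z` of a point. -/
def zc (y : X) : EuclideanSpace ℂ (Fin n) := (B.coord y).1

theorem zc_mem {y : X} (hy : y ∈ B.D) : B.zc y ∈ B.ball := by
  have h := B.coord.map_source hy
  rw [B.target_eq] at h
  simpa [ball, zc] using h.1

theorem smooth_φ : ContDiffOn ℝ ∞ B.φ B.ball := B.φ_smooth

theorem differentiableAt_φ {y : X} (hy : y ∈ B.D) : DifferentiableAt ℝ B.φ (B.zc y) :=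
  differentiableAt_of_contDiffOn B.isOpen_ball B.smooth_φ (B.zc_mem hy)

/-- The conjugate frame. -/
def Zbar (j : Fin n) : CField n X := fun y => cConj (B.Z j y)

/-- The complexified field `∂/∂θ`. -/
def T : CField n X := fun y => (1 : ℂ) ⊗ₜ[ℝ] coordField B.coord idxLast y

section Extension

variable {F : Type*} [AddCommGroup F] [Module ℝ F] [Module ℂ F] [IsScalarTower ℝ ℂ F]
  {y : X} {ψ : RT n y →ₗ[ℝ] F} {Λ : EuclideanSpace ℂ (Fin n) × ℝ → F}

theorem cExt_coordField (hy : y ∈ B.D) (hψ : ∀ v, ψ v = Λ (chartVec B.coord y v))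
    (k : Fin (2 * n + 1)) : ψ (coordField B.coord k y) = Λ (coordBasis n k) := by
  rw [hψ, coordField_eq_constField, B.isSmoothChart.chartVec_constField hy]

/-- Evaluations on `Z_j` are reduced to this formula. The target `F` may itself be a space of linear
maps, so it also expands a bilinear form in its first slot. -/
theorem cExt_Z (hy : y ∈ B.D) (hψ : ∀ v, ψ v = Λ (chartVec B.coord y v)) (j : Fin n) :
    cExt ψ (B.Z j y) = (1 / 2 : ℂ) • (Λ (EuclideanSpace.single j 1, 0)
        - Complex.I • Λ (EuclideanSpace.single j Complex.I, 0))
      + (Complex.I * wirtinger B.φ j (B.zc y)) • Λ (0, 1) := by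
  simp only [Z, brtFrame, tmul_eq_smul Complex.I, tmul_eq_smul (Complex.I * _), map_add, map_sub,
    map_smul, cExt_one_tmul, B.cExt_coordField hy hψ, coordBasis_idxRe, coordBasis_idxIm,
    coordBasis_idxLast]
  rfl

theorem cExt_Zbar (hy : y ∈ B.D) (hψ : ∀ v, ψ v = Λ (chartVec B.coord y v)) (j : Fin n) :
    cExt ψ (B.Zbar j y) = (1 / 2 : ℂ) • (Λ (EuclideanSpace.single j 1, 0)
        + Complex.I • Λ (EuclideanSpace.single j Complex.I, 0))
      - (Complex.I * starRingEnd ℂ (wirtinger B.φ j (B.zc y))) • Λ (0, 1) := by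
  have h2 : starRingEnd ℂ (1 / 2) = 1 / 2 := by
    rw [map_div₀, map_one, map_ofNat]
  simp only [Zbar, Z, brtFrame, map_add, map_sub, cConj_smul, cConj_tmul, h2, map_mul, map_one,
    Complex.conj_I]
  simp only [tmul_eq_smul (-Complex.I), tmul_eq_smul (-Complex.I * _), map_sub,
    map_smul, cExt_one_tmul, B.cExt_coordField hy hψ, coordBasis_idxRe, coordBasis_idxIm,
    coordBasis_idxLast]
  change _ + (-Complex.I * starRingEnd ℂ (wirtinger B.φ j (B.zc y))) • _ = _
  module

theorem cExt_T (hy : y ∈ B.D) (hψ : ∀ v, ψ v = Λ (chartVec B.coord y v)) :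
    cExt ψ (B.T y) = Λ (0, 1) := by
  rw [T, cExt_one_tmul, B.cExt_coordField hy hψ, coordBasis_idxLast]

end Extension

/-- The form `dz_j`. -/
def dzForm (j : Fin n) (y : X) : CT n y →ₗ[ℂ] ℂ :=
  cExt { toFun := fun v : RT n y => (chartVec B.coord y v).1 j
         map_add' := fun v w => by simp
         map_smul' := fun c v => by simp }

/-- The form `dz̄_j`. -/
def dzbarForm (j : Fin n) (y : X) : CT n y →ₗ[ℂ] ℂ :=
  cExt { toFun := fun v : RT n y => starRingEnd ℂ ((chartVec B.coord y v).1 j)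
         map_add' := fun v w => by simp
         map_smul' := fun c v => by simp }

/-- The form `dθ`. -/
def dthetaForm (y : X) : CT n y →ₗ[ℂ] ℂ :=
  cExt { toFun := fun v : RT n y => ((chartVec B.coord y v).2 : ℂ)
         map_add' := fun v w => by simp
         map_smul' := fun c v => by simp }

variable {y : X}

theorem dzForm_Z (hy : y ∈ B.D) (j k : Fin n) :
    B.dzForm j y (B.Z k y) = if j = k then 1 else 0 := by
  rw [dzForm, B.cExt_Z hy (Λ := fun p => p.1 j) fun v => rfl]
  rcases eq_or_ne j k with rfl | h <;> simp [*]; norm_num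

theorem dzForm_Zbar (hy : y ∈ B.D) (j k : Fin n) : B.dzForm j y (B.Zbar k y) = 0 := by
  rw [dzForm, B.cExt_Zbar hy (Λ := fun p => p.1 j) fun v => rfl]
  rcases eq_or_ne j k with rfl | h <;> simp [*]

theorem dzForm_T (hy : y ∈ B.D) (j : Fin n) : B.dzForm j y (B.T y) = 0 := by
  rw [dzForm, B.cExt_T hy (Λ := fun p => p.1 j) fun v => rfl]
  simp

theorem dzbarForm_Z (hy : y ∈ B.D) (j k : Fin n) : B.dzbarForm j y (B.Z k y) = 0 := by
  rw [dzbarForm, B.cExt_Z hy (Λ := fun p => starRingEnd ℂ (p.1 j)) fun v => rfl]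
  rcases eq_or_ne j k with rfl | h <;> simp [*]

theorem dzbarForm_Zbar (hy : y ∈ B.D) (j k : Fin n) :
    B.dzbarForm j y (B.Zbar k y) = if j = k then 1 else 0 := by
  rw [dzbarForm, B.cExt_Zbar hy (Λ := fun p => starRingEnd ℂ (p.1 j)) fun v => rfl]
  rcases eq_or_ne j k with rfl | h <;> simp [*]; norm_num

theorem dzbarForm_T (hy : y ∈ B.D) (j : Fin n) : B.dzbarForm j y (B.T y) = 0 := by
  rw [dzbarForm, B.cExt_T hy (Λ := fun p => starRingEnd ℂ (p.1 j)) fun v => rfl]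
  simp

theorem dthetaForm_Z (hy : y ∈ B.D) (k : Fin n) :
    B.dthetaForm y (B.Z k y) = Complex.I * wirtinger B.φ k (B.zc y) := by
  rw [dthetaForm, B.cExt_Z hy (Λ := fun p => (p.2 : ℂ)) fun v => rfl]
  simp

theorem dthetaForm_Zbar (hy : y ∈ B.D) (k : Fin n) :
    B.dthetaForm y (B.Zbar k y) = -(Complex.I * starRingEnd ℂ (wirtinger B.φ k (B.zc y))) := by
  rw [dthetaForm, B.cExt_Zbar hy (Λ := fun p => (p.2 : ℂ)) fun v => rfl]
  simp

theorem dthetaForm_T (hy : y ∈ B.D) : B.dthetaForm y (B.T y) = 1 := by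
  rw [dthetaForm, B.cExt_T hy (Λ := fun p => (p.2 : ℂ)) fun v => rfl]
  simp

/-- For `U = u + iv`, the vanishing of `dz_j` and the conjugate of that of `dz̄_j` give `dz_j(u) ± i
dz_j(v) = 0`, hence `dz_j(u) = dz_j(v) = 0`; `dθ` is real and settles the last component. Brackets
of frame fields are identified through these forms. -/
theorem eq_zero_of_forms {U : CT n y} (hy : y ∈ B.D) (h1 : ∀ j, B.dzForm j y U = 0)
    (h2 : ∀ j, B.dzbarForm j y U = 0) (h3 : B.dthetaForm y U = 0) : U = 0 := by
  have e1 : chartVec B.coord y (cRe U) = 0 ∧ chartVec B.coord y (cIm U) = 0 := by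
    have hz : ∀ j, (chartVec B.coord y (cRe U)).1 j = 0 ∧ (chartVec B.coord y (cIm U)).1 j = 0 := by
      intro j
      have a := h1 j
      have b := h2 j
      simp only [dzForm, dzbarForm, cExt_apply, LinearMap.coe_mk, AddHom.coe_mk, smul_eq_mul] at a b
      have b' := congrArg (starRingEnd ℂ) b
      simp only [map_add, map_mul, Complex.conj_conj, Complex.conj_I, map_zero] at b'
      constructor
      · linear_combination (1 / 2 : ℂ) * a + (1 / 2 : ℂ) * b'
      · have : Complex.I * (chartVec B.coord y (cIm U)).1 j = 0 := by
          linear_combination (1 / 2 : ℂ) * a - (1 / 2 : ℂ) * b'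
        simpa using this
    have ht : (chartVec B.coord y (cRe U)).2 = 0 ∧ (chartVec B.coord y (cIm U)).2 = 0 := by
      simp only [dthetaForm, cExt_apply, LinearMap.coe_mk, AddHom.coe_mk, smul_eq_mul] at h3
      constructor
      · simpa using congrArg Complex.re h3
      · simpa using congrArg Complex.im h3
    exact ⟨Prod.ext (by ext j; exact (hz j).1) ht.1, Prod.ext (by ext j; exact (hz j).2) ht.2⟩
  have inj := B.isSmoothChart.chartVec_injective hy
  apply cExt_ext
  · rw [map_zero]; exact inj (e1.1.trans (map_zero _).symm)
  · rw [map_zero]; exact inj (e1.2.trans (map_zero _).symm)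

/-- The expansion of a complex tangent vector in the frame `Z_j, Z̄_j, T`. -/
theorem expansion (hy : y ∈ B.D) (U : CT n y) :
    ∃ c : ℂ, U = (∑ j, B.dzForm j y U • B.Z j y) + (∑ j, B.dzbarForm j y U • B.Zbar j y)
      + c • B.T y := by
  -- The coefficient of `T` is not `dθ(U)`, since `dθ` need not vanish on `Z_j` and `Z̄_j`; it is
  -- `dθ` of what remains after their parts are removed.
  refine ⟨B.dthetaForm y (U - (∑ j, B.dzForm j y U • B.Z j y)
    - (∑ j, B.dzbarForm j y U • B.Zbar j y)), ?_⟩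
  rw [← sub_eq_zero]
  apply B.eq_zero_of_forms hy
  · intro j
    simp [B.dzForm_Z hy, B.dzForm_Zbar hy, B.dzForm_T hy]
  · intro j
    simp [B.dzbarForm_Z hy, B.dzbarForm_Zbar hy, B.dzbarForm_T hy]
  · simp only [map_sub, map_add, map_smul, B.dthetaForm_T hy]
    simp

theorem Z_mem (hy : y ∈ B.D) (j : Fin n) : B.Z j y ∈ S.T10 y := by
  rw [← B.frame_span y hy]
  exact Submodule.subset_span ⟨j, rfl⟩

theorem expansion_T10 (hy : y ∈ B.D) {U : CT n y} (hU : U ∈ S.T10 y) :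
    U = ∑ j, B.dzForm j y U • B.Z j y := by
  rw [← B.frame_span y hy] at hU
  obtain ⟨c, rfl⟩ := (Submodule.mem_span_range_iff_exists_fun ℂ).1 hU
  have : ∀ j, B.dzForm j y (∑ i, c i • brtFrame B.coord B.φ i y) = c j := by
    intro j
    have h := fun k => B.dzForm_Z hy j k
    simp only [Z] at h
    simp [h]
  simp only [this]
  rfl

/-- The contact form in canonical coordinates. -/
theorem theta₀_eq (hS : S.IsTransversalCRAction) (hy : y ∈ B.D) (v : RT n y) :
    S.theta₀ hS y v = thetaCoeff B.φ (B.coord y) (chartVec B.coord y v) := by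
  -- `ω₀` is known only through its defining properties. The coordinate expression `ψ` is shown to
  -- have them, and uniqueness in `existsUnique_form` identifies the two.
  let ψ : RT n y →ₗ[ℝ] ℝ :=
    -((thetaCoeff B.φ (B.coord y)).toLinearMap ∘ₗ (chartVec B.coord y).toLinearMap)
  have hψ : ∀ v, ψ v = -thetaCoeff B.φ (B.coord y) (chartVec B.coord y v) := fun v => rfl
  have hT : ψ (circleField n X y) = -1 := by
    rw [hψ, B.circleField_eq y hy, coordField_eq_constField,
      B.isSmoothChart.chartVec_constField hy, coordBasis_idxLast, thetaCoeff_apply]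
    simp
  have hc : ∀ U, cEval (fun v => (ψ v : ℂ)) U
      = cExt (Complex.ofRealCLM.toLinearMap ∘ₗ ψ) U := fun U => rfl
  -- Since `ψ` is real, vanishing on `T^{1,0}X` implies vanishing on `T^{0,1}X`.
  have hconj : ∀ U : CT n y, cEval (fun v => (ψ v : ℂ)) (cConj U)
      = starRingEnd ℂ (cEval (fun v => (ψ v : ℂ)) U) := by
    intro U
    simp [cEval]
  have h10 : ∀ U ∈ S.T10 y, cEval (fun v => (ψ v : ℂ)) U = 0 := by
    intro U hU
    rw [B.expansion_T10 hy hU, hc, map_sum]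
    refine Finset.sum_eq_zero fun j _ => ?_
    rw [map_smul, B.cExt_Z hy
      (Λ := fun p => ((-thetaCoeff B.φ (B.coord y) p : ℝ) : ℂ)) fun v => rfl]
    simp only [thetaCoeff_apply, wirtinger, smul_eq_mul]
    have e1 : Complex.I • (EuclideanSpace.single j (1 : ℂ) : EuclideanSpace ℂ (Fin n))
        = EuclideanSpace.single j Complex.I := by
      ext i; by_cases h : i = j <;> simp [h]
    have e2 : Complex.I • (EuclideanSpace.single j Complex.I : EuclideanSpace ℂ (Fin n))
        = -EuclideanSpace.single j 1 := by
      ext i; by_cases h : i = j <;> simp [h]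
    rw [e1, e2, smul_zero, map_zero, map_neg]
    change _ * (_ + (Complex.I * (1 / 2 * (((fderiv ℝ B.φ (B.coord y).1) _ : ℝ)
      - Complex.I * ((fderiv ℝ B.φ (B.coord y).1) _ : ℝ)))) * _) = 0
    push_cast
    ring_nf
    simp only [Complex.I_sq]
    ring
  have h := (existsUnique_form (hS.locallyFree y) (hS.transversal y)).unique
    (S.omega₀_spec hS y) (y₂ := ψ) ⟨hT, fun U hU => ?_⟩
  · rw [CRStructure.theta₀, LinearMap.neg_apply, h, hψ, neg_neg]
  · obtain ⟨a, ha, b, hb, rfl⟩ := Submodule.mem_sup.1 hU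
    rw [hc, map_add, ← hc, ← hc, h10 a ha, zero_add]
    have hb' := hconj b
    rw [h10 _ hb] at hb'
    exact (map_eq_zero _).1 hb'.symm

theorem theta₀_eventually (hS : S.IsTransversalCRAction) (hy : y ∈ B.D) :
    ∀ᶠ z in nhds y, ∀ v, S.theta₀ hS z v = thetaCoeff B.φ (B.coord z) (chartVec B.coord z v) := by
  filter_upwards [B.isOpen_D.mem_nhds hy] with z hz v using B.theta₀_eq hS hz v

theorem dForm_theta₀ (hS : S.IsTransversalCRAction) (hy : y ∈ B.D) (u v : RT n y) :
    dForm (S.theta₀ hS) y u v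
      = chartTwo B.coord y (fderiv ℝ (thetaCoeff B.φ) (B.coord y)) u v :=
  B.isSmoothChart.dForm_eq hy (hasFDerivAt_thetaCoeff_apply B.isOpen_ball B.smooth_φ
    (B.zc_mem hy) 0 0).1 (B.theta₀_eventually hS hy) u v

theorem dForm_omega₀ (hS : S.IsTransversalCRAction) (hy : y ∈ B.D) (u v : RT n y) :
    dForm (S.omega₀ hS) y u v = -dForm (S.theta₀ hS) y u v := by
  have hd := (hasFDerivAt_thetaCoeff_apply B.isOpen_ball B.smooth_φ
    (B.zc_mem hy) 0 0).1
  rw [B.isSmoothChart.dForm_eq (L := fun p => -thetaCoeff B.φ p) hy hd.neg ?_, B.dForm_theta₀ hS hy,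
    chartTwo_apply, chartTwo_apply, fderiv_fun_neg]
  · simp only [neg_apply]; ring
  · filter_upwards [B.theta₀_eventually hS hy] with z hz v
    rw [neg_apply, ← hz, CRStructure.theta₀, LinearMap.neg_apply, neg_neg]

/-- The complex bilinear extension of `dθ₀`. -/
def dtheta₀ (y : X) : CT n y →ₗ[ℂ] CT n y →ₗ[ℂ] ℂ :=
  cExt₂ ((chartTwo B.coord y (fderiv ℝ (thetaCoeff B.φ) (B.coord y))).compr₂
    Complex.ofRealCLM.toLinearMap)

theorem cEval₂_dForm_theta₀ (hS : S.IsTransversalCRAction) (hy : y ∈ B.D) (U V : CT n y) :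
    cEval₂ (dForm (S.theta₀ hS) y) U V = B.dtheta₀ y U V :=
  cEval₂_eq_cExt₂ _ _ (fun u v => by rw [B.dForm_theta₀ hS hy]; rfl) U V

theorem cEval₂_dForm_omega₀ (hS : S.IsTransversalCRAction) (hy : y ∈ B.D) (U V : CT n y) :
    cEval₂ (dForm (S.omega₀ hS) y) U V = -B.dtheta₀ y U V := by
  rw [← B.cEval₂_dForm_theta₀ hS hy]
  simp only [cEval₂, cEval, B.dForm_omega₀ hS hy]
  push_cast
  ring

end BRTTrivialization

/-! ### Values of `dθ₀` on the BRT frame. -/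

namespace BRTTrivialization

variable {n : ℕ} {X : Type*} [TopologicalSpace X]
  [ChartedSpace (EuclideanSpace ℝ (Fin (2 * n + 1))) X]
  [IsManifold (𝓡 (2 * n + 1)) ∞ X] [MulAction Circle X] {S : CRStructure n X}
  (B : BRTTrivialization S)

variable {y : X}

/-- The two-form `dθ₀` in canonical coordinates. -/
def dthetaCoeff (y : X) (p q : EuclideanSpace ℂ (Fin n) × ℝ) : ℂ :=
  ((fderiv ℝ (thetaCoeff B.φ) (B.coord y) p q - fderiv ℝ (thetaCoeff B.φ) (B.coord y) q p : ℝ) : ℂ)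

/-- The contraction of `dθ₀` with a constant field. -/
def dthetaSlice (y : X) (p : EuclideanSpace ℂ (Fin n) × ℝ) : CT n y →ₗ[ℂ] ℂ :=
  cExt { toFun := fun v : RT n y => B.dthetaCoeff y p (chartVec B.coord y v)
         map_add' := fun v w => by simp [dthetaCoeff]; ring
         map_smul' := fun c v => by simp [dthetaCoeff]; ring }

theorem dthetaCoeff_eq (hy : y ∈ B.D) (p q : EuclideanSpace ℂ (Fin n) × ℝ) :
    B.dthetaCoeff y p q = ((fderiv ℝ (fderiv ℝ B.φ) (B.zc y) q.1 (Complex.I • p.1)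
      - fderiv ℝ (fderiv ℝ B.φ) (B.zc y) p.1 (Complex.I • q.1) : ℝ) : ℂ) := by
  rw [dthetaCoeff,
    (hasFDerivAt_thetaCoeff_apply B.isOpen_ball B.smooth_φ (B.zc_mem hy) p q).2,
    (hasFDerivAt_thetaCoeff_apply B.isOpen_ball B.smooth_φ (B.zc_mem hy) q p).2]
  congr 1
  rw [zc]; ring

theorem dtheta₀_Z (hy : y ∈ B.D) (j : Fin n) (V : CT n y) :
    B.dtheta₀ y (B.Z j y) V = (1 / 2 : ℂ) * (B.dthetaSlice y (EuclideanSpace.single j 1, 0) V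
        - Complex.I * B.dthetaSlice y (EuclideanSpace.single j Complex.I, 0) V)
      + (Complex.I * wirtinger B.φ j (B.zc y)) * B.dthetaSlice y (0, 1) V := by
  rw [dtheta₀, cExt₂, B.cExt_Z hy (Λ := fun p => B.dthetaSlice y p) fun v => rfl]
  simp

theorem dthetaSlice_snd (hy : y ∈ B.D) (c : ℝ) : B.dthetaSlice y (0, c) = 0 := by
  ext U
  simp [dthetaSlice, B.dthetaCoeff_eq hy]

theorem dtheta₀_T (hy : y ∈ B.D) (V : CT n y) : B.dtheta₀ y (B.T y) V = 0 := by
  rw [dtheta₀, cExt₂, B.cExt_T hy (Λ := fun p => B.dthetaSlice y p) fun v => rfl,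
    B.dthetaSlice_snd hy, LinearMap.zero_apply]

theorem dtheta₀_antisymm (U V : CT n y) : B.dtheta₀ y U V = -B.dtheta₀ y V U := by
  simp only [dtheta₀, cExt₂_apply, LinearMap.compr₂_apply, chartTwo_apply]
  simp
  ring

theorem I_smul_single (j : Fin n) (c : ℂ) :
    Complex.I • (EuclideanSpace.single j c : EuclideanSpace ℂ (Fin n))
      = EuclideanSpace.single j (Complex.I * c) := by
  ext i; by_cases h : i = j <;> simp [h]

theorem single_neg (j : Fin n) (c : ℂ) :
    (EuclideanSpace.single j (-c) : EuclideanSpace ℂ (Fin n)) = -EuclideanSpace.single j c := by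
  ext i; by_cases h : i = j <;> simp [h]

theorem hessian_symm (hy : y ∈ B.D) (v w : EuclideanSpace ℂ (Fin n)) :
    fderiv ℝ (fderiv ℝ B.φ) (B.zc y) v w = fderiv ℝ (fderiv ℝ B.φ) (B.zc y) w v := by
  have h : ContDiffAt ℝ ∞ B.φ (B.zc y) :=
    B.smooth_φ.contDiffAt (B.isOpen_ball.mem_nhds (B.zc_mem hy))
  exact (h.isSymmSndFDerivAt (by rw [minSmoothness_of_isRCLikeNormedField]; exact WithTop.coe_le_coe.2 le_top)) v w

/-- In coordinates `dθ₀(p, q) = Hess φ(q, ip) - Hess φ(p, iq)`, which is invariant under `(p, q) ↦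
(ip, iq)` because the Hessian is symmetric; such a form has type `(1,1)`. -/
theorem dtheta₀_Z_Z (hy : y ∈ B.D) (j k : Fin n) : B.dtheta₀ y (B.Z j y) (B.Z k y) = 0 := by
  rw [B.dtheta₀_Z hy, B.dthetaSlice_snd hy, LinearMap.zero_apply]
  simp only [dthetaSlice]
  rw [B.cExt_Z hy (Λ := fun p => B.dthetaCoeff y _ p) fun v => rfl,
    B.cExt_Z hy (Λ := fun p => B.dthetaCoeff y _ p) fun v => rfl]
  simp only [B.dthetaCoeff_eq hy, I_smul_single, mul_one, Complex.I_mul_I, single_neg, smul_zero,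
    map_zero, map_neg, neg_apply, zero_apply, smul_eq_mul,
    B.hessian_symm hy (EuclideanSpace.single k _)]
  push_cast
  ring_nf
  simp only [Complex.I_sq]
  ring

/-- The factor `2i` fixes the normalizations: it makes the Webster metric `2G` and the Levi metric
`G/π` in the BRT frame. -/
theorem dtheta₀_Z_Zbar (hy : y ∈ B.D) (j k : Fin n) :
    B.dtheta₀ y (B.Z j y) (B.Zbar k y) = 2 * Complex.I * hess B.φ (B.zc y) j k := by
  rw [B.dtheta₀_Z hy, B.dthetaSlice_snd hy, LinearMap.zero_apply]
  simp only [dthetaSlice]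
  rw [B.cExt_Zbar hy (Λ := fun p => B.dthetaCoeff y _ p) fun v => rfl,
    B.cExt_Zbar hy (Λ := fun p => B.dthetaCoeff y _ p) fun v => rfl,
    hess_apply B.isOpen_ball B.smooth_φ (B.zc_mem hy)]
  simp only [B.dthetaCoeff_eq hy, I_smul_single, mul_one, Complex.I_mul_I, single_neg, smul_zero,
    map_zero, map_neg, neg_apply, zero_apply, smul_eq_mul,
    B.hessian_symm hy (EuclideanSpace.single k _)]
  push_cast
  ring_nf
  simp only [Complex.I_sq]
  ring

theorem dtheta₀_conj (U V : CT n y) :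
    B.dtheta₀ y (cConj U) (cConj V) = starRingEnd ℂ (B.dtheta₀ y U V) := by
  simp only [dtheta₀, cExt₂_apply, LinearMap.compr₂_apply, cRe_cConj, cIm_cConj]
  simp
  ring

theorem dtheta₀_Zbar_Zbar (hy : y ∈ B.D) (j k : Fin n) :
    B.dtheta₀ y (B.Zbar j y) (B.Zbar k y) = 0 := by
  rw [Zbar, Zbar, dtheta₀_conj, B.dtheta₀_Z_Z hy, map_zero]

end BRTTrivialization

/-! ### Smooth fields; brackets, Levi metric and Reeb field in the BRT frame. -/

section SmoothFields

variable {n : ℕ} {X : Type*} [TopologicalSpace X]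
  [ChartedSpace (EuclideanSpace ℝ (Fin (2 * n + 1))) X]
  [IsManifold (𝓡 (2 * n + 1)) ∞ X]

theorem RSmoothOn.add {V W : RField n X} {D : Set X} (hV : RSmoothOn V D) (hW : RSmoothOn W D) :
    RSmoothOn (fun x => V x + W x) D :=
  ContMDiffOn.add_section hV hW

theorem RSmoothOn.neg {V : RField n X} {D : Set X} (hV : RSmoothOn V D) :
    RSmoothOn (fun x => -V x) D :=
  ContMDiffOn.neg_section hV

theorem RSmoothOn.smul {f : X → ℝ} {V : RField n X} {D : Set X}
    (hf : ContMDiffOn (𝓡 (2 * n + 1)) 𝓘(ℝ, ℝ) ∞ f D) (hV : RSmoothOn V D) :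
    RSmoothOn (fun x => f x • V x) D :=
  ContMDiffOn.smul_section hf hV

theorem RSmoothOn.const_smul (c : ℝ) {V : RField n X} {D : Set X} (hV : RSmoothOn V D) :
    RSmoothOn (fun x => c • V x) D :=
  RSmoothOn.smul contMDiffOn_const hV

theorem CSmoothOn.conj {Z : CField n X} {D : Set X} (hZ : CSmoothOn Z D) :
    CSmoothOn (fun x => cConj (Z x)) D :=
  ⟨by simpa using hZ.1, by simpa using hZ.2.neg⟩

end SmoothFields

namespace BRTTrivialization

variable {n : ℕ} {X : Type*} [TopologicalSpace X]
  [ChartedSpace (EuclideanSpace ℝ (Fin (2 * n + 1))) X]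
  [IsManifold (𝓡 (2 * n + 1)) ∞ X] [MulAction Circle X] {S : CRStructure n X}
  (B : BRTTrivialization S)

variable {y : X}

section Derivatives

variable {F : Type*} [NormedAddCommGroup F] [NormedSpace ℝ F]

theorem contMDiffOn_comp_zc {h : EuclideanSpace ℂ (Fin n) → F} (hh : ContDiffOn ℝ ∞ h B.ball) :
    ContMDiffOn (𝓡 (2 * n + 1)) 𝓘(ℝ, F) ∞ (fun y => h (B.zc y)) B.D := by
  have h1 : ContMDiffOn (𝓡 (2 * n + 1)) 𝓘(ℝ, EuclideanSpace ℂ (Fin n)) ∞ B.zc B.D :=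
    contDiff_fst.contMDiff.comp_contMDiffOn B.coord_smooth
  exact hh.contMDiffOn.comp h1 fun y hy => B.zc_mem hy

theorem fDiffAt_comp_zc {h : EuclideanSpace ℂ (Fin n) → F} (hy : y ∈ B.D)
    (hh : DifferentiableAt ℝ h (B.zc y)) : FDiffAt (n := n) (fun y => h (B.zc y)) y :=
  B.isSmoothChart.fDiffAt_comp hy (g := fun p => h p.1)
    (DifferentiableAt.comp (g := h) (B.coord y) hh differentiableAt_fst)

theorem mvfderiv_comp_zc {h : EuclideanSpace ℂ (Fin n) → F} (hy : y ∈ B.D)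
    (hh : DifferentiableAt ℝ h (B.zc y)) (v : RT n y) :
    mvfderiv (𝓡 (2 * n + 1)) (fun y => h (B.zc y)) y v
      = fderiv ℝ h (B.zc y) (chartVec B.coord y v).1 := by
  have h1 : HasFDerivAt (fun p : EuclideanSpace ℂ (Fin n) × ℝ => h p.1)
      ((fderiv ℝ h (B.zc y)).comp (ContinuousLinearMap.fst ℝ _ _)) (B.coord y) :=
    HasFDerivAt.comp (g := h) (B.coord y) hh.hasFDerivAt hasFDerivAt_fst
  have h2 := B.isSmoothChart.mvfderiv_comp hy h1.differentiableAt v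
  rw [h1.fderiv] at h2
  exact h2

theorem cDeriv_comp_coord {g : EuclideanSpace ℂ (Fin n) × ℝ → ℂ} (hy : y ∈ B.D)
    (hg : DifferentiableAt ℝ g (B.coord y)) {ψ : RT n y →ₗ[ℝ] ℂ}
    (hψ : ∀ v, ψ v = fderiv ℝ g (B.coord y) (chartVec B.coord y v)) (U : CT n y) :
    cDeriv U (fun y => g (B.coord y)) = cExt ψ U := by
  rw [cDeriv, cEval, cExt_apply, hψ, hψ, smul_eq_mul]
  congr 1
  · exact B.isSmoothChart.mvfderiv_comp hy hg _
  · rw [← B.isSmoothChart.mvfderiv_comp hy hg]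

variable {h : EuclideanSpace ℂ (Fin n) → ℂ}

theorem cDeriv_Z_comp_zc (hy : y ∈ B.D) (hh : DifferentiableAt ℝ h (B.zc y)) (j : Fin n) :
    cDeriv (B.Z j y) (fun y => h (B.zc y)) = dz j h (B.zc y) := by
  rw [cDeriv_eq_cExt, B.cExt_Z hy (Λ := fun p => fderiv ℝ h (B.zc y) p.1)
    fun v => B.mvfderiv_comp_zc hy hh v]
  simp [dz]

theorem cDeriv_Zbar_comp_zc (hy : y ∈ B.D) (hh : DifferentiableAt ℝ h (B.zc y)) (j : Fin n) :
    cDeriv (B.Zbar j y) (fun y => h (B.zc y)) = dzbar j h (B.zc y) := by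
  rw [cDeriv_eq_cExt, B.cExt_Zbar hy (Λ := fun p => fderiv ℝ h (B.zc y) p.1)
    fun v => B.mvfderiv_comp_zc hy hh v]
  simp [dzbar]

theorem cDeriv_T_comp_zc (hy : y ∈ B.D) (hh : DifferentiableAt ℝ h (B.zc y)) :
    cDeriv (B.T y) (fun y => h (B.zc y)) = 0 := by
  rw [cDeriv_eq_cExt, B.cExt_T hy (Λ := fun p => fderiv ℝ h (B.zc y) p.1)
    fun v => B.mvfderiv_comp_zc hy hh v]
  simp

theorem cDeriv_const (U : CT n y) (c : ℂ) : cDeriv U (fun _ => c) = 0 := by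
  rw [cDeriv_eq_cExt, cExt_apply]
  have h : ∀ v : RT n y, mvfderiv (𝓡 (2 * n + 1)) (fun _ : X => c) y v = 0 := by
    intro v
    rw [mvfderiv_const]; rfl
  change mvfderiv (𝓡 (2 * n + 1)) (fun _ : X => c) y (cRe U)
    + Complex.I • mvfderiv (𝓡 (2 * n + 1)) (fun _ : X => c) y (cIm U) = 0
  rw [h, h, smul_zero, add_zero]

theorem cDeriv_eventually_const {f : X → ℂ} {c : ℂ} (hf : ∀ᶠ z in nhds y, f z = c) (U : CT n y) :
    cDeriv U f = 0 := by
  rw [cDeriv_congr (g := fun _ => c) hf, cDeriv_const]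

/-- The complex coordinate `z_j` as a function. -/
def zfun (j : Fin n) (y : X) : ℂ := (B.coord y).1 j

/-- The conjugate coordinate. -/
def zbarfun (j : Fin n) (y : X) : ℂ := starRingEnd ℂ ((B.coord y).1 j)

/-- The coordinate `θ`. -/
def thetafun (y : X) : ℂ := ((B.coord y).2 : ℂ)

theorem contMDiffAt_of_coord (hy : y ∈ B.D) (L : EuclideanSpace ℂ (Fin n) × ℝ →L[ℝ] ℂ) :
    ContMDiffAt (𝓡 (2 * n + 1)) 𝓘(ℝ, ℂ) ∞ (fun y => L (B.coord y)) y :=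
  L.contDiff.contMDiff.contMDiffAt.comp y (B.isSmoothChart.contMDiffAt hy)

/-- The coordinate `z_j` as a linear form. -/
def zL (j : Fin n) : EuclideanSpace ℂ (Fin n) × ℝ →L[ℝ] ℂ :=
  ((EuclideanSpace.proj (𝕜 := ℂ) j).restrictScalars ℝ).comp (ContinuousLinearMap.fst ℝ _ _)

/-- The coordinate `z̄_j` as a linear form. -/
def zbarL (j : Fin n) : EuclideanSpace ℂ (Fin n) × ℝ →L[ℝ] ℂ :=
  Complex.conjCLE.toContinuousLinearMap.comp (zL j)

/-- The coordinate `θ` as a linear form. -/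
def thetaL : EuclideanSpace ℂ (Fin n) × ℝ →L[ℝ] ℂ :=
  Complex.ofRealCLM.comp (ContinuousLinearMap.snd ℝ _ _)

theorem contMDiffAt_zfun (hy : y ∈ B.D) (j : Fin n) :
    ContMDiffAt (𝓡 (2 * n + 1)) 𝓘(ℝ, ℂ) ∞ (B.zfun j) y :=
  B.contMDiffAt_of_coord hy (zL j)

theorem contMDiffAt_zbarfun (hy : y ∈ B.D) (j : Fin n) :
    ContMDiffAt (𝓡 (2 * n + 1)) 𝓘(ℝ, ℂ) ∞ (B.zbarfun j) y :=
  B.contMDiffAt_of_coord hy (zbarL j)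

theorem contMDiffAt_thetafun (hy : y ∈ B.D) :
    ContMDiffAt (𝓡 (2 * n + 1)) 𝓘(ℝ, ℂ) ∞ B.thetafun y :=
  B.contMDiffAt_of_coord hy thetaL

theorem cDeriv_zfun (hy : y ∈ B.D) (j : Fin n) (U : CT n y) :
    cDeriv U (B.zfun j) = B.dzForm j y U :=
  B.cDeriv_comp_coord hy (g := zL j) (zL j).differentiableAt
    (fun v => by rw [ContinuousLinearMap.fderiv]; rfl) U

theorem cDeriv_zbarfun (hy : y ∈ B.D) (j : Fin n) (U : CT n y) :
    cDeriv U (B.zbarfun j) = B.dzbarForm j y U :=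
  B.cDeriv_comp_coord hy (g := zbarL j) (zbarL j).differentiableAt
    (fun v => by rw [ContinuousLinearMap.fderiv]; rfl) U

theorem cDeriv_thetafun (hy : y ∈ B.D) (U : CT n y) :
    cDeriv U B.thetafun = B.dthetaForm y U :=
  B.cDeriv_comp_coord hy (g := thetaL) thetaL.differentiableAt
    (fun v => by rw [ContinuousLinearMap.fderiv]; rfl) U

end Derivatives

section Smoothness

theorem rSmoothOn_coordField (k : Fin (2 * n + 1)) : RSmoothOn (coordField B.coord k) B.D :=
  B.isSmoothChart.rSmoothOn_constField _

theorem contDiffOn_wirtinger (j : Fin n) : ContDiffOn ℝ ∞ (wirtinger B.φ j) B.ball :=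
  (contDiffOn_dz B.isOpen_ball (contDiffOn_ofReal B.smooth_φ) j).congr fun _ hz =>
    wirtinger_eq_dz (differentiableAt_of_contDiffOn B.isOpen_ball B.smooth_φ hz) j

theorem cSmoothOn_Z (j : Fin n) : CSmoothOn (B.Z j) B.D := by
  have hw := B.contMDiffOn_comp_zc (B.contDiffOn_wirtinger j)
  have hre : ContMDiffOn (𝓡 (2 * n + 1)) 𝓘(ℝ, ℝ) ∞ (fun y => (wirtinger B.φ j (B.zc y)).re) B.D :=
    Complex.reCLM.contDiff.contMDiff.comp_contMDiffOn hw
  have him : ContMDiffOn (𝓡 (2 * n + 1)) 𝓘(ℝ, ℝ) ∞ (fun y => -(wirtinger B.φ j (B.zc y)).im) B.D :=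
    (-Complex.imCLM).contDiff.contMDiff.comp_contMDiffOn hw
  constructor
  · refine (((B.rSmoothOn_coordField (idxRe j)).const_smul (1 / 2)).add
      (RSmoothOn.smul him (B.rSmoothOn_coordField idxLast))).congr fun y _ => ?_
    congr 1
    simp [Z, brtFrame, zc]
  · refine (((B.rSmoothOn_coordField (idxIm j)).const_smul (-(1 / 2))).add
      (RSmoothOn.smul hre (B.rSmoothOn_coordField idxLast))).congr fun y _ => ?_
    congr 1
    simp [Z, brtFrame, zc]

theorem cDiffAt_Z (hy : y ∈ B.D) (j : Fin n) : CDiffAt (B.Z j) y :=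
  (B.cSmoothOn_Z j).cDiffAt B.isOpen_D hy

theorem cDiffAt_Zbar (hy : y ∈ B.D) (j : Fin n) : CDiffAt (B.Zbar j) y :=
  (B.cDiffAt_Z hy j).conj

theorem cDiffAt_T (hy : y ∈ B.D) : CDiffAt B.T y :=
  ((B.rSmoothOn_coordField idxLast).rDiffAt B.isOpen_D hy).ofReal

end Smoothness

section Brackets

theorem eventually_D (hy : y ∈ B.D) : ∀ᶠ z in nhds y, z ∈ B.D := B.isOpen_D.mem_nhds hy

theorem differentiableAt_dz_φ (hy : y ∈ B.D) (j : Fin n) :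
    DifferentiableAt ℝ (dz j fun z => (B.φ z : ℂ)) (B.zc y) :=
  differentiableAt_of_contDiffOn B.isOpen_ball
    (contDiffOn_dz B.isOpen_ball (contDiffOn_ofReal B.smooth_φ) j) (B.zc_mem hy)

theorem differentiableAt_dzbar_φ (hy : y ∈ B.D) (j : Fin n) :
    DifferentiableAt ℝ (dzbar j fun z => (B.φ z : ℂ)) (B.zc y) :=
  differentiableAt_of_contDiffOn B.isOpen_ball
    (contDiffOn_dzbar B.isOpen_ball (contDiffOn_ofReal B.smooth_φ) j) (B.zc_mem hy)

theorem cDeriv_const_mul {f : X → ℂ} (hf : FDiffAt (n := n) f y) (c : ℂ) (U : CT n y) :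
    cDeriv U (fun z => c * f z) = c * cDeriv U f := by
  have h : ∀ v : RT n y, mvfderiv (𝓡 (2 * n + 1)) (fun z => c * f z) y v
      = c * mvfderiv (𝓡 (2 * n + 1)) f y v := fun v =>
    mvfderiv_clm_comp hf (ContinuousLinearMap.restrictScalars ℝ
      (ContinuousLinearMap.mul ℂ ℂ c)) v
  simp only [cDeriv, cEval, h]
  ring

/-- The bracket is read off from its action on `z_l`, `z̄_l` and `θ`. The frame fields map `z_l` and
`z̄_l` to constants, so only the `θ` component survives: `Z_j(-i ∂φ/∂z̄_k) - Z̄_k(i ∂φ/∂z_j)`. -/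
theorem cBracket_Z_Zbar (hy : y ∈ B.D) (j k : Fin n) :
    cBracket (B.Z j) (B.Zbar k) y = (-2 * Complex.I * hess B.φ (B.zc y) j k) • B.T y := by
  have hC := contDiffOn_ofReal B.smooth_φ
  rw [← sub_eq_zero]
  apply B.eq_zero_of_forms hy
  · intro l
    rw [map_sub, ← B.cDeriv_zfun hy, B.isSmoothChart.cDeriv_cBracket hy (B.contMDiffAt_zfun hy l)
      (B.cDiffAt_Z hy j) (B.cDiffAt_Zbar hy k), map_smul, B.dzForm_T hy,
      cDeriv_eventually_const (c := 0) ?_, cDeriv_eventually_const (c := if l = j then 1 else 0) ?_]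
    · simp
    · filter_upwards [B.eventually_D hy] with z hz
      rw [B.cDeriv_zfun hz, B.dzForm_Z hz]
    · filter_upwards [B.eventually_D hy] with z hz
      rw [B.cDeriv_zfun hz, B.dzForm_Zbar hz]
  · intro l
    rw [map_sub, ← B.cDeriv_zbarfun hy, B.isSmoothChart.cDeriv_cBracket hy
      (B.contMDiffAt_zbarfun hy l) (B.cDiffAt_Z hy j) (B.cDiffAt_Zbar hy k), map_smul,
      B.dzbarForm_T hy, cDeriv_eventually_const (c := if l = k then 1 else 0) ?_,
      cDeriv_eventually_const (c := 0) ?_]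
    · simp
    · filter_upwards [B.eventually_D hy] with z hz
      rw [B.cDeriv_zbarfun hz, B.dzbarForm_Z hz]
    · filter_upwards [B.eventually_D hy] with z hz
      rw [B.cDeriv_zbarfun hz, B.dzbarForm_Zbar hz]
  · have e1 : (fun z => cDeriv (B.Zbar k z) B.thetafun) =ᶠ[nhds y]
        fun z => -Complex.I * dzbar k (fun z => (B.φ z : ℂ)) (B.zc z) := by
      filter_upwards [B.eventually_D hy] with z hz
      rw [B.cDeriv_thetafun hz, B.dthetaForm_Zbar hz,
        conj_wirtinger_eq_dzbar (B.differentiableAt_φ hz)]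
      ring
    have e2 : (fun z => cDeriv (B.Z j z) B.thetafun) =ᶠ[nhds y]
        fun z => Complex.I * dz j (fun z => (B.φ z : ℂ)) (B.zc z) := by
      filter_upwards [B.eventually_D hy] with z hz
      rw [B.cDeriv_thetafun hz, B.dthetaForm_Z hz, wirtinger_eq_dz (B.differentiableAt_φ hz)]
    rw [map_sub, ← B.cDeriv_thetafun hy, B.isSmoothChart.cDeriv_cBracket hy
      (B.contMDiffAt_thetafun hy) (B.cDiffAt_Z hy j) (B.cDiffAt_Zbar hy k), map_smul,
      B.dthetaForm_T hy, cDeriv_congr e1, cDeriv_congr e2,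
      cDeriv_const_mul (B.fDiffAt_comp_zc hy (B.differentiableAt_dzbar_φ hy k)),
      cDeriv_const_mul (B.fDiffAt_comp_zc hy (B.differentiableAt_dz_φ hy j)),
      B.cDeriv_Z_comp_zc hy (B.differentiableAt_dzbar_φ hy k),
      B.cDeriv_Zbar_comp_zc hy (B.differentiableAt_dz_φ hy j),
      ← dz_dzbar_comm B.isOpen_ball hC (B.zc_mem hy)]
    simp only [hess, Matrix.of_apply, smul_eq_mul]
    ring

/-- Rigidity: the coefficients of `Z_j` depend on `z` alone, so `T` annihilates them. -/
theorem cBracket_T_Z (hy : y ∈ B.D) (j : Fin n) : cBracket B.T (B.Z j) y = 0 := by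
  apply B.eq_zero_of_forms hy
  · intro l
    rw [← B.cDeriv_zfun hy, B.isSmoothChart.cDeriv_cBracket hy (B.contMDiffAt_zfun hy l)
      (B.cDiffAt_T hy) (B.cDiffAt_Z hy j),
      cDeriv_eventually_const (c := if l = j then 1 else 0) ?_,
      cDeriv_eventually_const (c := 0) ?_]
    · simp
    · filter_upwards [B.eventually_D hy] with z hz
      rw [B.cDeriv_zfun hz, B.dzForm_T hz]
    · filter_upwards [B.eventually_D hy] with z hz
      rw [B.cDeriv_zfun hz, B.dzForm_Z hz]
  · intro l
    rw [← B.cDeriv_zbarfun hy, B.isSmoothChart.cDeriv_cBracket hy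
      (B.contMDiffAt_zbarfun hy l) (B.cDiffAt_T hy) (B.cDiffAt_Z hy j),
      cDeriv_eventually_const (c := 0) ?_, cDeriv_eventually_const (c := 0) ?_]
    · simp
    · filter_upwards [B.eventually_D hy] with z hz
      rw [B.cDeriv_zbarfun hz, B.dzbarForm_T hz]
    · filter_upwards [B.eventually_D hy] with z hz
      rw [B.cDeriv_zbarfun hz, B.dzbarForm_Z hz]
  · have e2 : (fun z => cDeriv (B.Z j z) B.thetafun) =ᶠ[nhds y]
        fun z => Complex.I * dz j (fun z => (B.φ z : ℂ)) (B.zc z) := by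
      filter_upwards [B.eventually_D hy] with z hz
      rw [B.cDeriv_thetafun hz, B.dthetaForm_Z hz, wirtinger_eq_dz (B.differentiableAt_φ hz)]
    rw [← B.cDeriv_thetafun hy, B.isSmoothChart.cDeriv_cBracket hy
      (B.contMDiffAt_thetafun hy) (B.cDiffAt_T hy) (B.cDiffAt_Z hy j), cDeriv_congr e2,
      cDeriv_const_mul (B.fDiffAt_comp_zc hy (B.differentiableAt_dz_φ hy j)),
      B.cDeriv_T_comp_zc hy (B.differentiableAt_dz_φ hy j), cDeriv_eventually_const (c := 1) ?_]
    · simp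
    · filter_upwards [B.eventually_D hy] with z hz
      rw [B.cDeriv_thetafun hz, B.dthetaForm_T hz]

end Brackets

section Metric

variable (hS : S.IsTransversalCRAction)

theorem leviForm_eq (hy : y ∈ B.D) (U V : CT n y) :
    S.leviForm hS U V = 1 / (2 * Complex.I) * B.dtheta₀ y U (cConj V) := by
  rw [CRStructure.leviForm, B.cEval₂_dForm_omega₀ hS hy]
  ring

theorem leviForm_sum (hy : y ∈ B.D) (v : Fin n → ℂ) :
    S.leviForm hS (∑ j, v j • B.Z j y) (∑ j, v j • B.Z j y)
      = ∑ k, (∑ j, v j * hess B.φ (B.zc y) j k) * starRingEnd ℂ (v k) := by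
  have h1 : cConj (∑ j, v j • B.Z j y) = ∑ j, starRingEnd ℂ (v j) • B.Zbar j y := by
    simp [map_sum, cConj_smul, Zbar]
  rw [B.leviForm_eq hS hy, h1]
  simp only [map_sum, map_smul, LinearMap.sum_apply, LinearMap.smul_apply,
    B.dtheta₀_Z_Zbar hy, smul_eq_mul, Finset.mul_sum, Finset.sum_mul]
  refine Finset.sum_congr rfl fun k _ => Finset.sum_congr rfl fun j _ => ?_
  field_simp

/-- `G` is the matrix of the Levi form in the frame `Z_j`. A kernel vector would give a nonzero
vector of type `(1,0)` on which the Levi form vanishes. -/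
theorem det_hess_ne_zero (hpsc : S.IsStronglyPseudoconvex hS) (hy : y ∈ B.D) :
    (hess B.φ (B.zc y)).det ≠ 0 := by
  intro h0
  obtain ⟨v, hv, hv0⟩ := Matrix.exists_vecMul_eq_zero_iff.2 h0
  have hU : ∑ j, v j • B.Z j y ∈ S.T10 y :=
    Submodule.sum_mem _ fun j _ => Submodule.smul_mem _ _ (B.Z_mem hy j)
  have hU0 : ∑ j, v j • B.Z j y ≠ 0 := by
    intro h
    exact hv (funext (Fintype.linearIndependent_iff.1 (B.frame_linearIndependent y hy) v h))
  have hpos := hpsc y _ hU hU0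
  rw [B.leviForm_sum hS hy] at hpos
  have : ∀ k, ∑ j, v j * hess B.φ (B.zc y) j k = 0 := fun k => congrFun hv0 k
  simp [this] at hpos

theorem leviMetric_Z (hy : y ∈ B.D) (l m : Fin n) :
    S.leviMetric hS (B.Z l y) (B.Z m y) = (Real.pi : ℂ)⁻¹ * hess B.φ (B.zc y) l m := by
  rw [CRStructure.leviMetric, B.cEval₂_dForm_omega₀ hS hy]
  change _ * (Complex.I * -(B.dtheta₀ y (B.Z l y)) (B.Zbar m y)) = _
  rw [B.dtheta₀_Z_Zbar hy]
  have hpi : (Real.pi : ℂ) ≠ 0 := by exact_mod_cast Real.pi_ne_zero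
  field_simp
  linear_combination -hess B.φ (B.zc y) l m * Complex.I_sq

/-- Pairing `ξ` with `Z̄_k` under `dθ₀` leaves `2i ∑ dz_j(ξ) G_{jk} = 0`, so `dz_j(ξ) = 0` as `G` is
invertible. The normalization `θ₀(ξ) = 1` then gives `dθ(ξ) = 1`. -/
theorem reeb_eq (hpsc : S.IsStronglyPseudoconvex hS) {ξ : RField n X}
    (hξ : IsReebField (S.theta₀ hS) ξ) (hy : y ∈ B.D) : ξ y = coordField B.coord idxLast y := by
  have h0 : ∀ V, B.dtheta₀ y ((1 : ℂ) ⊗ₜ[ℝ] ξ y) V = 0 := by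
    intro V
    rw [← B.cEval₂_dForm_theta₀ hS hy]
    have h0 : ∀ v, dForm (S.theta₀ hS) y 0 v = 0 := fun v => by
      rw [B.dForm_theta₀ hS hy, map_zero, LinearMap.zero_apply]
    simp [cEval₂, cEval, hξ.d_eq_zero, h0]
  have ha : (fun j => B.dzForm j y ((1 : ℂ) ⊗ₜ[ℝ] ξ y)) = 0 := by
    obtain ⟨c, hc⟩ := B.expansion hy ((1 : ℂ) ⊗ₜ[ℝ] ξ y)
    refine Matrix.eq_zero_of_vecMul_eq_zero (B.det_hess_ne_zero hS hpsc hy) (funext fun k => ?_)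
    have h1 := h0 (B.Zbar k y)
    rw [hc] at h1
    simp only [map_add, map_sum, map_smul, LinearMap.add_apply, LinearMap.sum_apply,
      LinearMap.smul_apply, B.dtheta₀_Z_Zbar hy, B.dtheta₀_Zbar_Zbar hy, B.dtheta₀_T hy,
      mul_zero, Finset.sum_const_zero, add_zero, smul_eq_mul] at h1
    have hI : (2 : ℂ) * Complex.I ≠ 0 := by simp
    apply mul_left_cancel₀ hI
    change 2 * Complex.I * ∑ j, _ * _ = 2 * Complex.I * 0
    rw [mul_zero, ← h1, Finset.mul_sum]
    exact Finset.sum_congr rfl fun j _ => by ring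
  have h1 : (chartVec B.coord y (ξ y)).1 = 0 := by
    ext j
    have := congrFun ha j
    rw [dzForm, cExt_one_tmul] at this
    exact this
  have h2 := hξ.apply_eq_one y
  rw [B.theta₀_eq hS hy, thetaCoeff_apply, h1, smul_zero, map_zero, sub_zero] at h2
  rw [coordField_eq_constField, coordBasis_idxLast,
    ← B.isSmoothChart.constField_chartVec hy (ξ y)]
  congr 1
  exact Prod.ext h1 h2

end Metric

end BRTTrivialization

/-! ### Global extension of local sections; horizontal vectors and `J`. -/

variable {n : ℕ} {X : Type*} [TopologicalSpace X]
  [ChartedSpace (EuclideanSpace ℝ (Fin (2 * n + 1))) X]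
  [IsManifold (𝓡 (2 * n + 1)) ∞ X]

/-- The axioms of `IsTanakaWebster` on `HX`, `J` and `dθ₀` speak of globally smooth fields, whereas
frames are local. Cutoffs and the locality of the connection bridge the gap. -/
theorem exists_cutoff [T2Space X] {D : Set X} (hD : IsOpen D) {y : X} (hy : y ∈ D) :
    ∃ ψ : X → ℝ, ContMDiff (𝓡 (2 * n + 1)) 𝓘(ℝ, ℝ) ∞ ψ ∧ tsupport ψ ⊆ D ∧
      ∀ᶠ z in nhds y, ψ z = 1 := by
  obtain ⟨f, -, hf⟩ := (SmoothBumpFunction.nhds_basis_tsupport (I := 𝓡 (2 * n + 1)) y).mem_iff.1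
    (hD.mem_nhds hy)
  exact ⟨f, f.contMDiff, hf, f.eventuallyEq_one⟩

theorem RSmoothOn.cutoff {V : RField n X} {D : Set X} (hV : RSmoothOn V D) (hD : IsOpen D)
    {ψ : X → ℝ} (hψ : ContMDiff (𝓡 (2 * n + 1)) 𝓘(ℝ, ℝ) ∞ ψ) (hs : tsupport ψ ⊆ D) :
    RSmoothOn (fun x => ψ x • V x) Set.univ :=
  (ContMDiffOn.smul_section_of_tsupport hψ.contMDiffOn hD hs hV).contMDiffOn

/-- A local section of `T^{1,0}X` agrees near a given point with a global one. -/
theorem exists_global_section [T2Space X] (S : CRStructure n X) {Z : CField n X} {D : Set X}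
    (hZ : CSmoothOn Z D) (hD : IsOpen D) (hZ' : ∀ x ∈ D, Z x ∈ S.T10 x) {y : X} (hy : y ∈ D) :
    ∃ W : CField n X, CSmoothOn W Set.univ ∧ (∀ x, W x ∈ S.T10 x) ∧
      ∀ᶠ z in nhds y, Z z = W z := by
  obtain ⟨ψ, hψ, hs, h1⟩ := exists_cutoff (n := n) hD hy
  refine ⟨fun x => (ψ x : ℂ) • Z x, ⟨?_, ?_⟩, fun x => ?_, ?_⟩
  · refine (hZ.1.cutoff hD hψ hs).congr fun x _ => ?_
    beta_reduce
    rw [cRe_smul, Complex.ofReal_re, Complex.ofReal_im, zero_smul, sub_zero]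
  · refine (hZ.2.cutoff hD hψ hs).congr fun x _ => ?_
    beta_reduce
    rw [cIm_smul, Complex.ofReal_re, Complex.ofReal_im, zero_smul, add_zero]
  · by_cases hx : x ∈ D
    · exact Submodule.smul_mem _ _ (hZ' x hx)
    · have h0 : ψ x = 0 := image_eq_zero_of_notMem_tsupport fun h => hx (hs h)
      simp [h0]
  · filter_upwards [h1] with z hz
    simp [hz]

theorem FDiffAt.fun_add {F : Type*} [NormedAddCommGroup F] [NormedSpace ℝ F] {f g : X → F} {x : X}
    (hf : FDiffAt (n := n) f x) (hg : FDiffAt (n := n) g x) :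
    FDiffAt (n := n) (fun y => f y + g y) x :=
  MDifferentiableAt.add hf hg

namespace CRStructure

variable (S : CRStructure n X)

/-- The difference is purely imaginary, so its conjugate is its negative, and it lies in `T^{1,0}X ∩
T^{0,1}X = 0`. -/
theorem eq_of_cRe_eq {x : X} {U W : CT n x} (hU : U ∈ S.T10 x) (hW : W ∈ S.T10 x)
    (h : cRe U = cRe W) : U = W := by
  have h1 : U - W ∈ S.T10 x := Submodule.sub_mem _ hU hW
  have h2 : U - W ∈ conjSubmodule (S.T10 x) := by
    change cConj (U - W) ∈ S.T10 x
    have : cConj (U - W) = -(U - W) := by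
      apply cExt_ext
      · simp [h]
      · simp only [cIm_cConj, map_neg]
    rw [this]
    exact Submodule.neg_mem _ h1
  exact sub_eq_zero.1 ((Submodule.disjoint_def.1 (S.disjoint x)) _ h1 h2)

theorem isHorizontal_cRe {x : X} {U : CT n x} (hU : U ∈ S.T10 x) : S.IsHorizontal (cRe U) := by
  refine ⟨(1 / 2 : ℂ) • U, Submodule.smul_mem _ _ hU, ?_⟩
  apply cExt_ext
  · simp only [cRe_tmul, map_add, cRe_smul, cRe_cConj, Complex.one_re]
    norm_num
    module
  · simp

/-- `J` is defined with a chosen `W`. A vector of type `(1,0)` is determined by its real part, so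
`2W = U`, and `J` becomes `Re U ↦ Re(iU)`. -/
theorem J_cRe {x : X} {U : CT n x} (hU : U ∈ S.T10 x) : S.J (cRe U) = -cIm U := by
  have h := S.isHorizontal_cRe hU
  rw [J, dif_pos h]
  obtain ⟨h1, h2⟩ := h.choose_spec
  generalize Exists.choose h = W at h1 h2 ⊢
  have h3 : (2 : ℂ) • W = U := by
    apply S.eq_of_cRe_eq (Submodule.smul_mem _ _ h1) hU
    have := congrArg cRe h2
    simp only [cRe_tmul, map_add, cRe_cConj, Complex.one_re, one_smul] at this
    rw [this, cRe_smul]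
    norm_num
    module
  rw [← h3]
  simp

/-- Every horizontal vector is the real part of a vector of type `(1,0)`. -/
theorem exists_of_isHorizontal {x : X} {u : RT n x} (hu : S.IsHorizontal u) :
    ∃ W ∈ S.T10 x, cRe W = u := by
  obtain ⟨W, hW, h⟩ := hu
  refine ⟨(2 : ℂ) • W, Submodule.smul_mem _ _ hW, ?_⟩
  have := congrArg cRe h
  simp only [cRe_tmul, map_add, cRe_cConj, Complex.one_re, one_smul] at this
  rw [this, cRe_smul]
  norm_num
  module

theorem isHorizontal_cIm {x : X} {U : CT n x} (hU : U ∈ S.T10 x) : S.IsHorizontal (cIm U) := by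
  have h := S.isHorizontal_cRe (Submodule.smul_mem _ (-Complex.I) hU)
  simpa using h

/-- The vectors `u - iJu` with `u` horizontal are of type `(1,0)`; this is how a statement about `J`
becomes one about types. -/
theorem cMk_mem {x : X} {u : RT n x} (hu : S.IsHorizontal u) : cMk u (-S.J u) ∈ S.T10 x := by
  obtain ⟨W, hW, rfl⟩ := S.exists_of_isHorizontal hu
  rw [S.J_cRe hW, neg_neg, cMk_cRe_cIm]
  exact hW

end CRStructure

/-! ### The Tanaka–Webster connection: torsion and types. -/

/-- The complex bilinear extension of the torsion. -/
def cTorsion (nab : Connection n X) (x : X) (U V : CT n x) : CT n x :=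
  cMk (nab.torsion x (cRe U) (cRe V) - nab.torsion x (cIm U) (cIm V))
    (nab.torsion x (cRe U) (cIm V) + nab.torsion x (cIm U) (cRe V))

theorem cTorsion_eq (nab : Connection n X) {x : X} {U V : CField n X} (hU : CDiffAt U x)
    (hV : CDiffAt V x) : cTorsion nab x (U x) (V x)
      = cNabla nab V x (U x) - cNabla nab U x (V x) - cBracket U V x := by
  have h11 := nab.torsion_apply hU.1 hV.1
  have h12 := nab.torsion_apply hU.1 hV.2
  have h21 := nab.torsion_apply hU.2 hV.1
  have h22 := nab.torsion_apply hU.2 hV.2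
  apply cExt_ext
  · simp only [cTorsion, cNabla, cBracket, map_sub, cRe_cMk, h11, h22]
    abel
  · simp only [cTorsion, cNabla, cBracket, map_sub, cIm_cMk, h12, h21]
    abel

namespace IsTanakaWebster

variable {S : CRStructure n X} {θ₀ : OneForm n X} {ξ : RField n X} {nab : Connection n X}

/-- A section of type `(1,0)` is `V - iJV` with `V` its real part. As `HX` and `J` are parallel, its
derivative in a real direction is `∇V - iJ∇V`, again of type `(1,0)`; complex directions follow by
linearity. -/
theorem cNabla_mem [T2Space X] (h : IsTanakaWebster S θ₀ ξ nab) {Z : CField n X} {D : Set X}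
    (hZ : CSmoothOn Z D) (hD : IsOpen D) (hZ' : ∀ x ∈ D, Z x ∈ S.T10 x) {y : X} (hy : y ∈ D)
    (U : CT n y) : cNabla nab Z y U ∈ S.T10 y := by
  obtain ⟨W, hW, hW', hev⟩ := exists_global_section S hZ hD hZ' hy
  rw [cNabla_congr nab (hZ.cDiffAt hD hy) hev, cNabla_eq_cExt]
  have key : ∀ u : RT n y, cNablaReal nab W y u ∈ S.T10 y := by
    intro u
    have hH : ∀ x, S.IsHorizontal (cRe (W x)) := fun x => S.isHorizontal_cRe (hW' x)
    have h1 := h.horizontal_parallel _ hW.1 hH y u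
    have h2 := h.J_parallel _ hW.1 hH y u
    have h3 : (fun x => S.J (cRe (W x))) = fun x => -cIm (W x) :=
      funext fun x => S.J_cRe (hW' x)
    rw [h3, nab_neg nab (hW.cDiffAt isOpen_univ (Set.mem_univ y)).2] at h2
    have h4 := S.cMk_mem h1
    rw [← h2, neg_neg] at h4
    exact h4
  exact Submodule.add_mem _ (key _) (Submodule.smul_mem _ _ (key _))

end IsTanakaWebster

namespace BRTTrivialization

variable [MulAction Circle X] {S : CRStructure n X} (B : BRTTrivialization S)

variable {y : X}

theorem fDiffAt_dForm (hS : S.IsTransversalCRAction) (hy : y ∈ B.D) {V W : RField n X}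
    (hV : RDiffAt V y) (hW : RDiffAt W y) :
    FDiffAt (n := n) (fun z => dForm (S.theta₀ hS) z (V z) (W z)) y := by
  have hO : IsOpen (Prod.fst ⁻¹' B.ball : Set (EuclideanSpace ℂ (Fin n) × ℝ)) :=
    B.isOpen_ball.preimage continuous_fst
  have hc : ContDiffOn ℝ ∞ (thetaCoeff B.φ) (Prod.fst ⁻¹' B.ball) := by
    have h1 : ContDiffOn ℝ ∞ (fderiv ℝ B.φ) B.ball :=
      B.smooth_φ.fderiv_of_isOpen (m := ∞) B.isOpen_ball (by simp)
    have h2 : ContDiffOn ℝ ∞ (fun p : EuclideanSpace ℂ (Fin n) × ℝ => fderiv ℝ B.φ p.1)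
        (Prod.fst ⁻¹' B.ball) := h1.comp contDiff_fst.contDiffOn fun p hp => hp
    exact contDiffOn_const.sub (h2.clm_comp contDiffOn_const)
  have hd : DifferentiableAt ℝ (fderiv ℝ (thetaCoeff B.φ)) (B.coord y) :=
    differentiableAt_of_contDiffOn hO (hc.fderiv_of_isOpen (m := ∞) hO (by simp)) (B.zc_mem hy)
  have h1 := B.isSmoothChart.fDiffAt_chartVec hy hV
  have h2 := B.isSmoothChart.fDiffAt_chartVec hy hW
  have h3 := B.isSmoothChart.fDiffAt_comp
    (F := EuclideanSpace ℂ (Fin n) × ℝ →L[ℝ] EuclideanSpace ℂ (Fin n) × ℝ →L[ℝ] ℝ) hy hd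
  have h4 : FDiffAt (n := n) (fun z => fderiv ℝ (thetaCoeff B.φ) (B.coord z)
      (chartVec B.coord z (V z)) (chartVec B.coord z (W z))) y :=
    MDifferentiableAt.clm_apply (MDifferentiableAt.clm_apply h3 h1) h2
  have h5 : FDiffAt (n := n) (fun z => fderiv ℝ (thetaCoeff B.φ) (B.coord z)
      (chartVec B.coord z (W z)) (chartVec B.coord z (V z))) y :=
    MDifferentiableAt.clm_apply (MDifferentiableAt.clm_apply h3 h2) h1
  refine FDiffAt.congr (MDifferentiableAt.sub h4 h5) ?_
  filter_upwards [B.eventually_D hy] with z hz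
  rw [B.dForm_theta₀ hS hz, chartTwo_apply]
  rfl

/-- The complex bilinear extension of `∇dθ₀ = 0`. -/
theorem cDeriv_dtheta₀ (hS : S.IsTransversalCRAction) {ξ : RField n X} {nab : Connection n X}
    (h : IsTanakaWebster S (S.theta₀ hS) ξ nab) (hy : y ∈ B.D) {V W : CField n X}
    (hV : CSmoothOn V Set.univ) (hW : CSmoothOn W Set.univ) (U : CT n y) :
    cDeriv U (fun z => cEval₂ (dForm (S.theta₀ hS) z) (V z) (W z))
      = B.dtheta₀ y (cNabla nab V y U) (W y) + B.dtheta₀ y (V y) (cNabla nab W y U) := by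
  have hV' := hV.cDiffAt isOpen_univ (Set.mem_univ y)
  have hW' := hW.cDiffAt isOpen_univ (Set.mem_univ y)
  have hd : ∀ {A C : RField n X}, RDiffAt A y → RDiffAt C y → ∀ c : ℂ,
      FDiffAt (n := n) (fun z => c * ((dForm (S.theta₀ hS) z (A z) (C z) : ℝ) : ℂ)) y :=
    fun hA hC c => (B.fDiffAt_dForm hS hy hA hC).clm_comp
      ((ContinuousLinearMap.mul ℝ ℂ c).comp Complex.ofRealCLM)
  have hm : ∀ {A C : RField n X}, RSmoothOn A Set.univ → RSmoothOn C Set.univ → ∀ (c : ℂ)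
      (u : RT n y), mvfderiv (𝓡 (2 * n + 1))
        (fun z => c * ((dForm (S.theta₀ hS) z (A z) (C z) : ℝ) : ℂ)) y u
      = c * ((dForm (S.theta₀ hS) y (nab A y u) (C y) : ℝ)
        + (dForm (S.theta₀ hS) y (A y) (nab C y u) : ℝ)) := by
    intro A C hA hC c u
    rw [← Complex.ofReal_add, ← h.d_parallel A C hA hC]
    exact mvfderiv_clm_comp (B.fDiffAt_dForm hS hy (hA.rDiffAt isOpen_univ (Set.mem_univ y))
      (hC.rDiffAt isOpen_univ (Set.mem_univ y)))
      ((ContinuousLinearMap.mul ℝ ℂ c).comp Complex.ofRealCLM) u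
  have hexp : (fun z => cEval₂ (dForm (S.theta₀ hS) z) (V z) (W z)) = fun z =>
      1 * ((dForm (S.theta₀ hS) z (cRe (V z)) (cRe (W z)) : ℝ) : ℂ)
      + Complex.I * ((dForm (S.theta₀ hS) z (cRe (V z)) (cIm (W z)) : ℝ) : ℂ)
      + Complex.I * ((dForm (S.theta₀ hS) z (cIm (V z)) (cRe (W z)) : ℝ) : ℂ)
      + (-1) * ((dForm (S.theta₀ hS) z (cIm (V z)) (cIm (W z)) : ℝ) : ℂ) := by
    funext z
    simp only [cEval₂, cEval]
    linear_combination ((dForm (S.theta₀ hS) z (cIm (V z)) (cIm (W z)) : ℝ) : ℂ) * Complex.I_sq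
  have hreal : ∀ u : RT n y, mvfderiv (𝓡 (2 * n + 1))
      (fun z => cEval₂ (dForm (S.theta₀ hS) z) (V z) (W z)) y u
      = B.dtheta₀ y (cNablaReal nab V y u) (W y) + B.dtheta₀ y (V y) (cNablaReal nab W y u) := by
    intro u
    have d1 := hd hV'.1 hW'.1 1
    have d2 := hd hV'.1 hW'.2 Complex.I
    have d3 := hd hV'.2 hW'.1 Complex.I
    have d4 := hd hV'.2 hW'.2 (-1)
    rw [hexp, mvfderiv_fun_add ((d1.fun_add d2).fun_add d3) d4,
      mvfderiv_fun_add (d1.fun_add d2) d3,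
      mvfderiv_fun_add d1 d2]
    simp only [add_apply, hm hV.1 hW.1, hm hV.1 hW.2, hm hV.2 hW.1, hm hV.2 hW.2,
      ← B.cEval₂_dForm_theta₀ hS hy, cEval₂, cEval, cNablaReal, LinearMap.coe_mk, AddHom.coe_mk,
      cRe_cMk, cIm_cMk]
    ring_nf
    simp only [Complex.I_sq]
    ring
  have key := hreal (cRe U)
  have key' := hreal (cIm U)
  rw [cDeriv, cEval, key, key', cNabla_eq_cExt, cNabla_eq_cExt, cExt_apply, cExt_apply]
  simp only [map_add, map_smul, LinearMap.add_apply, LinearMap.smul_apply, smul_eq_mul]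
  ring

section Connection

variable [T2Space X] (hS : S.IsTransversalCRAction) (hpsc : S.IsStronglyPseudoconvex hS)
  {ξ : RField n X} (hξ : IsReebField (S.theta₀ hS) ξ) {nab : Connection n X}
  (h : IsTanakaWebster S (S.theta₀ hS) ξ nab)

include h

theorem cNabla_Z_mem (hy : y ∈ B.D) (j : Fin n) (U : CT n y) :
    cNabla nab (B.Z j) y U ∈ S.T10 y :=
  h.cNabla_mem (B.cSmoothOn_Z j) B.isOpen_D (fun _ hx => B.Z_mem hx j) hy U

theorem cNabla_Zbar_mem (hy : y ∈ B.D) (j : Fin n) (U : CT n y) :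
    cNabla nab (B.Zbar j) y U ∈ S.T01 y := by
  change cConj _ ∈ S.T10 y
  rw [← cNabla_conj nab (B.cDiffAt_Zbar hy j)]
  simp only [Zbar, cConj_cConj]
  exact B.cNabla_Z_mem hS h hy j _

include hpsc hξ

/-- The torsion `dθ₀(Z_j, Z̄_k) T` equals `-[Z_j, Z̄_k]`, so the torsion identity reduces to
`∇_{Z_j} Z̄_k = ∇_{Z̄_k} Z_j`. The two sides have types `(0,1)` and `(1,0)`, so both vanish. -/
theorem cNabla_mixed (hy : y ∈ B.D) (j k : Fin n) :
    cNabla nab (B.Zbar k) y (B.Z j y) = 0 ∧ cNabla nab (B.Z j) y (B.Zbar k y) = 0 := by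
  have h1 := cTorsion_eq nab (B.cDiffAt_Z hy j) (B.cDiffAt_Zbar hy k)
  have hj := B.Z_mem hy j
  have hk := B.Z_mem hy k
  have hξT : (1 : ℂ) ⊗ₜ[ℝ] ξ y = B.T y := by rw [B.reeb_eq hS hpsc hξ hy, T]
  have h2 : cTorsion nab y (B.Z j y) (B.Zbar k y)
      = B.dtheta₀ y (B.Z j y) (B.Zbar k y) • B.T y := by
    rw [← hξT, ← B.cEval₂_dForm_theta₀ hS hy]
    have e1 : S.IsHorizontal (cRe (B.Zbar k y)) := by
      simpa [Zbar] using S.isHorizontal_cRe hk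
    have e2 : S.IsHorizontal (cIm (B.Zbar k y)) := by
      have := S.isHorizontal_cIm (Submodule.neg_mem _ hk)
      simpa [Zbar] using this
    simp only [cTorsion, h.torsion_horizontal _ _ _ (S.isHorizontal_cRe hj) e1,
      h.torsion_horizontal _ _ _ (S.isHorizontal_cRe hj) e2,
      h.torsion_horizontal _ _ _ (S.isHorizontal_cIm hj) e1,
      h.torsion_horizontal _ _ _ (S.isHorizontal_cIm hj) e2]
    apply cExt_ext
    · simp [cEval₂, cEval]
      module
    · simp [cEval₂, cEval]
      module
  rw [h2, B.cBracket_Z_Zbar hy, B.dtheta₀_Z_Zbar hy] at h1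
  have h3 : cNabla nab (B.Zbar k) y (B.Z j y) = cNabla nab (B.Z j) y (B.Zbar k y) := by
    rw [← sub_eq_zero]
    linear_combination (norm := module) -h1
  have h4 := B.cNabla_Zbar_mem hS h hy k (B.Z j y)
  have h5 := B.cNabla_Z_mem hS h hy j (B.Zbar k y)
  have h6 := h5
  rw [← h3] at h6
  have h7 := (Submodule.disjoint_def.1 (S.disjoint y)) _ h6 h4
  exact ⟨h7, h3 ▸ h7⟩

/-- With `∇T = 0` and `[T, Z_j] = 0`, the vector `W = ∇_T Z_j` is the torsion `τ(T, Z_j)`.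
Anticommutation of `τ(ξ, ·)` with `J` gives `Im W = J Re W`, while type `(1,0)` gives `Im W = -J Re
W`. So `W` is real of type `(1,0)`, hence zero. -/
theorem cNabla_T (hy : y ∈ B.D) (j : Fin n) : cNabla nab (B.Z j) y (B.T y) = 0 := by
  have hj := B.Z_mem hy j
  have h1 := cTorsion_eq nab (B.cDiffAt_T hy) (B.cDiffAt_Z hy j)
  have h2 : ∀ U, cNabla nab B.T y U = 0 := by
    intro U
    -- Differentiating requires `T = ξ` near `y`, not only at `y`.
    have hev : ∀ᶠ z in nhds y, B.T z = (1 : ℂ) ⊗ₜ[ℝ] ξ z := by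
      filter_upwards [B.eventually_D hy] with z hz
      rw [B.reeb_eq hS hpsc hξ hz, T]
    rw [cNabla_congr nab (B.cDiffAt_T hy) hev, cNabla]
    have e0 := nab_zero nab y
    apply cExt_ext <;> simp [h.reeb_parallel, e0]
  rw [h2, B.cBracket_T_Z hy, sub_zero, sub_zero] at h1
  have hT : B.T y = (1 : ℂ) ⊗ₜ[ℝ] ξ y := by rw [B.reeb_eq hS hpsc hξ hy, T]
  have h3 := h.torsion_reeb y _ (S.isHorizontal_cRe hj)
  rw [S.J_cRe hj, map_neg, neg_inj] at h3
  have h4 := B.cNabla_Z_mem hS h hy j (B.T y)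
  set W := cNabla nab (B.Z j) y (B.T y) with hW
  have h5 : cRe W = nab.torsion y (ξ y) (cRe (B.Z j y)) := by
    rw [← h1, hT]
    simp [cTorsion]
  have h6 : cIm W = S.J (cRe W) := by
    rw [h5, ← h3, ← h1, hT]
    simp [cTorsion]
  rw [S.J_cRe h4] at h6
  have h7 : cIm W = 0 := by
    have : (2 : ℝ) • cIm W = 0 := by
      rw [two_smul]; nth_rewrite 1 [h6]; simp
    simpa using this
  have h8 : cConj W = W := by apply cExt_ext <;> simp [h7]
  have h9 : W ∈ conjSubmodule (S.T10 y) := by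
    change cConj W ∈ S.T10 y
    rw [h8]; exact h4
  exact (Submodule.disjoint_def.1 (S.disjoint y)) _ h4 h9

end Connection

end BRTTrivialization

/-! ### Smoothness of inverse matrices and the coefficients `∂G · G⁻¹`. -/

section MatrixFunctions

variable {n : ℕ} {E : Type*} [NormedAddCommGroup E] [NormedSpace ℝ E]

theorem contDiff_det {M : E → Matrix (Fin n) (Fin n) ℂ}
    (hM : ∀ i j, ContDiff ℝ ∞ fun x => M x i j) : ContDiff ℝ ∞ fun x => (M x).det := by
  simp only [Matrix.det_apply']
  exact ContDiff.sum fun σ _ => contDiff_const.mul (contDiff_prod fun i _ => hM _ _)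

/-- By Cramer's rule an entry of the inverse is a quotient of polynomials in the entries with
denominator `det`. -/
theorem contDiffAt_inv_apply {M : Fin n → Fin n → ℂ} (hM : (Matrix.of M).det ≠ 0) (i j : Fin n) :
    ContDiffAt ℝ ∞ (fun M : Fin n → Fin n → ℂ => (Matrix.of M)⁻¹ i j) M := by
  have hentry : ∀ i j, ContDiff ℝ ∞ fun M : Fin n → Fin n → ℂ => Matrix.of M i j := fun i j =>
    contDiff_apply_apply ℝ ℂ i j
  have hdet := contDiff_det hentry
  have hadj : ContDiff ℝ ∞ fun M : Fin n → Fin n → ℂ => (Matrix.of M).adjugate i j := by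
    simp only [Matrix.adjugate_apply]
    refine contDiff_det fun k l => ?_
    by_cases h : k = j
    · subst h
      simpa using contDiff_const
    · simpa [h] using hentry k l
  simp only [Matrix.inv_def, Ring.inverse_eq_inv', Matrix.smul_apply, smul_eq_mul]
  exact (hdet.contDiffAt.inv hM).mul hadj.contDiffAt

end MatrixFunctions

section Christoffel

variable {n : ℕ} {O : Set (EuclideanSpace ℂ (Fin n))} {z : EuclideanSpace ℂ (Fin n)}

theorem dzbar_congr {f g : EuclideanSpace ℂ (Fin n) → ℂ} (h : f =ᶠ[nhds z] g) (j : Fin n) :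
    dzbar j f z = dzbar j g z := by
  simp only [dzbar, h.fderiv_eq]

theorem dz_mul {f g : EuclideanSpace ℂ (Fin n) → ℂ} (hf : DifferentiableAt ℝ f z)
    (hg : DifferentiableAt ℝ g z) (j : Fin n) :
    dz j (fun w => f w * g w) z = dz j f z * g z + f z * dz j g z := by
  simp only [dz, fderiv_fun_mul hf hg, add_apply, smul_apply, smul_eq_mul]
  ring

theorem dzbar_mul {f g : EuclideanSpace ℂ (Fin n) → ℂ} (hf : DifferentiableAt ℝ f z)
    (hg : DifferentiableAt ℝ g z) (j : Fin n) :
    dzbar j (fun w => f w * g w) z = dzbar j f z * g z + f z * dzbar j g z := by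
  simp only [dzbar, fderiv_fun_mul hf hg, add_apply, smul_apply, smul_eq_mul]
  ring

theorem dzbar_sum {ι : Type*} {s : Finset ι} {f : ι → EuclideanSpace ℂ (Fin n) → ℂ}
    (hf : ∀ i ∈ s, DifferentiableAt ℝ (f i) z) (j : Fin n) :
    dzbar j (fun w => ∑ i ∈ s, f i w) z = ∑ i ∈ s, dzbar j (f i) z := by
  simp only [dzbar, fderiv_fun_sum hf, sum_apply, Finset.mul_sum, Finset.sum_add_distrib, mul_add]

/-- The coefficients `∂_j G · G⁻¹` of the connection of the Kähler metric with the matrix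
`G = (∂²φ/∂z_a∂z̄_b)`. -/
def gam (φ : EuclideanSpace ℂ (Fin n) → ℝ) (j : Fin n) (z : EuclideanSpace ℂ (Fin n)) :
    Matrix (Fin n) (Fin n) ℂ :=
  (Matrix.of fun a m => dz j (fun w => hess φ w a m) z) * (hess φ z)⁻¹

theorem contDiffAt_hess_inv {φ : EuclideanSpace ℂ (Fin n) → ℝ} (hO : IsOpen O)
    (hφ : ContDiffOn ℝ ∞ φ O) (hz : z ∈ O) (hdet : (hess φ z).det ≠ 0) (i j : Fin n) :
    ContDiffAt ℝ ∞ (fun w => (hess φ w)⁻¹ i j) z := by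
  have h1 : ContDiffAt ℝ ∞ (fun w => (fun i j => hess φ w i j : Fin n → Fin n → ℂ)) z :=
    contDiffAt_pi.2 fun i => contDiffAt_pi.2 fun j =>
      (contDiffOn_hess hO hφ i j).contDiffAt (hO.mem_nhds hz)
  exact ContDiffAt.comp z (contDiffAt_inv_apply (M := fun i j => hess φ z i j) hdet i j) h1

theorem contDiffAt_gam {φ : EuclideanSpace ℂ (Fin n) → ℝ} (hO : IsOpen O)
    (hφ : ContDiffOn ℝ ∞ φ O) (hz : z ∈ O) (hdet : (hess φ z).det ≠ 0) (j a b : Fin n) :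
    ContDiffAt ℝ ∞ (fun w => gam φ j w a b) z := by
  simp only [gam, Matrix.mul_apply, Matrix.of_apply]
  exact ContDiffAt.sum fun m _ =>
    ((contDiffOn_dz hO (contDiffOn_hess hO hφ a m) j).contDiffAt (hO.mem_nhds hz)).mul
      (contDiffAt_hess_inv hO hφ hz hdet m b)

end Christoffel

/-! ### The Tanaka–Webster connection in the BRT frame. -/

namespace BRTTrivialization

variable {n : ℕ} {X : Type*} [TopologicalSpace X]
  [ChartedSpace (EuclideanSpace ℝ (Fin (2 * n + 1))) X]
  [IsManifold (𝓡 (2 * n + 1)) ∞ X]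

variable [MulAction Circle X] {S : CRStructure n X} (B : BRTTrivialization S)

variable {y : X}

section Connection

variable [T2Space X] (hS : S.IsTransversalCRAction) (hpsc : S.IsStronglyPseudoconvex hS)
  {ξ : RField n X} (hξ : IsReebField (S.theta₀ hS) ξ) {nab : Connection n X}
  (h : IsTanakaWebster S (S.theta₀ hS) ξ nab)

include hpsc hξ h

/-- Differentiate `dθ₀(Z_a, Z̄_m) = 2i G_{am}` along `Z_j`. As `dθ₀` is parallel and `∇_{Z_j} Z̄_m =
0`, the coefficients `c` of `∇_{Z_j} Z_a` satisfy `∑_b c_b G_{bm} = ∂_j G_{am}`, and `G` is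
invertible. -/
theorem cNabla_Z_Z (hy : y ∈ B.D) (j a : Fin n) :
    cNabla nab (B.Z a) y (B.Z j y) = ∑ b, gam B.φ j (B.zc y) a b • B.Z b y := by
  have hmem := B.cNabla_Z_mem hS h hy a (B.Z j y)
  set c : Fin n → ℂ := fun b => B.dzForm b y (cNabla nab (B.Z a) y (B.Z j y)) with hc
  have hexp : cNabla nab (B.Z a) y (B.Z j y) = ∑ b, c b • B.Z b y := B.expansion_T10 hy hmem
  have key : ∀ m, ∑ b, c b * hess B.φ (B.zc y) b m = dz j (fun w => hess B.φ w a m) (B.zc y) := by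
    intro m
    obtain ⟨V, hV, -, hVZ⟩ := exists_global_section S (B.cSmoothOn_Z a) B.isOpen_D
      (fun x hx => B.Z_mem hx a) hy
    obtain ⟨W, hW, -, hWZ⟩ := exists_global_section S (B.cSmoothOn_Z m) B.isOpen_D
      (fun x hx => B.Z_mem hx m) hy
    have h1 := B.cDeriv_dtheta₀ hS h hy hV hW.conj (B.Z j y)
    have hd : DifferentiableAt ℝ (fun w => hess B.φ w a m) (B.zc y) :=
      differentiableAt_of_contDiffOn B.isOpen_ball (contDiffOn_hess B.isOpen_ball B.smooth_φ a m)
        (B.zc_mem hy)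
    have h2 : (fun z => cEval₂ (dForm (S.theta₀ hS) z) (V z) (cConj (W z))) =ᶠ[nhds y]
        fun z => (2 * Complex.I) * hess B.φ (B.zc z) a m := by
      filter_upwards [hVZ, hWZ, B.eventually_D hy] with z h1 h2 hz
      rw [← h1, ← h2, B.cEval₂_dForm_theta₀ hS hz]
      exact B.dtheta₀_Z_Zbar hz a m
    have h3 : cNabla nab V y (B.Z j y) = ∑ b, c b • B.Z b y := by
      rw [← hexp, cNabla_congr nab (B.cDiffAt_Z hy a) hVZ]
    have h4 : cNabla nab (fun x => cConj (W x)) y (B.Z j y) = 0 := by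
      rw [← (B.cNabla_mixed hS hpsc hξ h hy j m).1, cNabla_congr nab (B.cDiffAt_Zbar hy m)]
      exact hWZ.mono fun z hz => congrArg cConj hz
    rw [cDeriv_congr h2, cDeriv_const_mul (B.fDiffAt_comp_zc hy hd), B.cDeriv_Z_comp_zc hy hd,
      h3, h4, map_zero, add_zero, ← hWZ.self_of_nhds] at h1
    change _ = B.dtheta₀ y _ (B.Zbar m y) at h1
    simp only [map_sum, map_smul, LinearMap.sum_apply, LinearMap.smul_apply,
      B.dtheta₀_Z_Zbar hy, smul_eq_mul] at h1
    have hI : (2 : ℂ) * Complex.I ≠ 0 := by simp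
    apply mul_left_cancel₀ hI
    rw [h1, Finset.mul_sum]
    exact Finset.sum_congr rfl fun b _ => by ring
  have hcG : c = Matrix.vecMul (fun m => dz j (fun w => hess B.φ w a m) (B.zc y))
      (hess B.φ (B.zc y))⁻¹ := by
    have hk : Matrix.vecMul c (hess B.φ (B.zc y))
        = fun m => dz j (fun w => hess B.φ w a m) (B.zc y) := funext key
    rw [← hk, Matrix.vecMul_vecMul, Matrix.mul_nonsing_inv _
      (isUnit_iff_ne_zero.2 (B.det_hess_ne_zero hS hpsc hy)), Matrix.vecMul_one]
  rw [hexp]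
  refine Finset.sum_congr rfl fun b _ => ?_
  rw [hcG]
  rfl

/-- The Tanaka–Webster connection in the BRT frame. -/
theorem cNabla_Z (hy : y ∈ B.D) (a : Fin n) (U : CT n y) :
    cNabla nab (B.Z a) y U
      = ∑ b, (∑ j, B.dzForm j y U * gam B.φ j (B.zc y) a b) • B.Z b y := by
  obtain ⟨c, hc⟩ := B.expansion hy U
  have h1 : cNabla nab (B.Z a) y U = ∑ j, B.dzForm j y U • cNabla nab (B.Z a) y (B.Z j y) := by
    have e1 : ∀ k, cExt (cNablaReal nab (B.Z a) y) (B.Zbar k y) = 0 := fun k => by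
      rw [← cNabla_eq_cExt, (B.cNabla_mixed hS hpsc hξ h hy a k).2]
    have e2 : cExt (cNablaReal nab (B.Z a) y) (B.T y) = 0 := by
      rw [← cNabla_eq_cExt, B.cNabla_T hS hpsc hξ h hy]
    conv_lhs => rw [hc]
    simp only [cNabla_eq_cExt, map_add, map_sum, map_smul, e1, e2, smul_zero,
      Finset.sum_const_zero, add_zero]
  rw [h1]
  simp only [B.cNabla_Z_Z hS hpsc hξ h hy, Finset.smul_sum, Finset.sum_smul, smul_smul]
  rw [Finset.sum_comm]

end Connection

end BRTTrivialization

/-! ### Leibniz rules and the change of frame. -/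

variable {n : ℕ} {X : Type*} [TopologicalSpace X]
  [ChartedSpace (EuclideanSpace ℝ (Fin (2 * n + 1))) X]
  [IsManifold (𝓡 (2 * n + 1)) ∞ X]

section Leibniz

variable {y : X}

theorem cDeriv_mul {f g : X → ℂ} (hf : FDiffAt (n := n) f y) (hg : FDiffAt (n := n) g y)
    (U : CT n y) : cDeriv U (fun z => f z * g z) = cDeriv U f * g y + f y * cDeriv U g := by
  have h : ∀ v : RT n y, mvfderiv (𝓡 (2 * n + 1)) (fun z => f z * g z) y v
      = mvfderiv (𝓡 (2 * n + 1)) f y v * g y + f y * mvfderiv (𝓡 (2 * n + 1)) g y v := by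
    intro v
    have hm : HasMFDerivAt (𝓡 (2 * n + 1)) 𝓘(ℝ, ℂ) (f * g) y _ :=
      hf.hasMFDerivAt.mul hg.hasMFDerivAt
    have h2 := congrArg (fun L => L v) hm.mfderiv
    refine Eq.trans h2 ?_
    change f y * mvfderiv (𝓡 (2 * n + 1)) g y v + g y * mvfderiv (𝓡 (2 * n + 1)) f y v = _
    ring
  simp only [cDeriv, cEval, h]
  ring

theorem FDiffAt.fun_mul {f g : X → ℂ} (hf : FDiffAt (n := n) f y) (hg : FDiffAt (n := n) g y) :
    FDiffAt (n := n) (fun z => f z * g z) y :=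
  MDifferentiableAt.mul hf hg

theorem cDeriv_add {f g : X → ℂ} (hf : FDiffAt (n := n) f y) (hg : FDiffAt (n := n) g y)
    (U : CT n y) : cDeriv U (fun z => f z + g z) = cDeriv U f + cDeriv U g := by
  simp only [cDeriv, cEval, mvfderiv_fun_add hf hg, add_apply]
  ring

theorem FDiffAt.fun_sum {ι : Type*} {s : Finset ι} {f : ι → X → ℂ}
    (hf : ∀ i ∈ s, FDiffAt (n := n) (f i) y) : FDiffAt (n := n) (fun z => ∑ i ∈ s, f i z) y := by
  classical
  induction s using Finset.induction_on with
  | empty => simpa using mdifferentiableAt_const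
  | insert a s ha ih =>
    simp only [Finset.sum_insert ha]
    exact (hf a (by simp)).fun_add (ih fun i hi => hf i (by simp [hi]))

theorem cDeriv_sum {ι : Type*} {s : Finset ι} {f : ι → X → ℂ}
    (hf : ∀ i ∈ s, FDiffAt (n := n) (f i) y) (U : CT n y) :
    cDeriv U (fun z => ∑ i ∈ s, f i z) = ∑ i ∈ s, cDeriv U (f i) := by
  classical
  induction s using Finset.induction_on with
  | empty =>
    have h : ∀ v : RT n y, mvfderiv (𝓡 (2 * n + 1)) (fun _ : X => (0 : ℂ)) y v = 0 := by
      intro v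
      rw [mvfderiv_const]; rfl
    simp [cDeriv, cEval, h]
  | insert a s ha ih =>
    simp only [Finset.sum_insert ha]
    rw [cDeriv_add (hf a (by simp)) (FDiffAt.fun_sum fun i hi => hf i (by simp [hi])),
      ih fun i hi => hf i (by simp [hi])]

end Leibniz

theorem IsSmoothChart.fDiffAt_cDeriv {e : OpenPartialHomeomorph X (EuclideanSpace ℂ (Fin n) × ℝ)}
    (he : IsSmoothChart e) {f : X → ℂ} {y : X} (hy : y ∈ e.source)
    (hf : ContMDiffAt (𝓡 (2 * n + 1)) 𝓘(ℝ, ℂ) ∞ f y) {V : CField n X} (hV : CDiffAt V y) :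
    FDiffAt (n := n) (fun z => cDeriv (V z) f) y := by
  have hg : ContDiffAt ℝ ∞ (f ∘ e.symm) (e y) := by
    rw [← e.left_inv hy] at hf
    exact (hf.comp (e y) (he.contMDiffAt_symm (e.map_source hy))).contDiffAt
  have hL : DifferentiableAt ℝ (fderiv ℝ (f ∘ e.symm)) (e y) :=
    (hg.fderiv_right (m := 1) (WithTop.coe_le_coe.2 le_top)).differentiableAt (by simp)
  have hev : ∀ᶠ z in nhds y, FDiffAt (n := n) f z := by
    have h1 := (contMDiffAt_iff_contMDiffAt_nhds (by simp)).1 (hf.of_le (m := 1) (by simp))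
    exact h1.mono fun z hz => hz.mdifferentiableAt (by simp)
  have hη : ∀ᶠ z in nhds y, ∀ v : RT n z, mvfderiv (𝓡 (2 * n + 1)) f z v
      = fderiv ℝ (f ∘ e.symm) (e z) (chartVec e z v) := by
    filter_upwards [hev, e.open_source.mem_nhds hy] with z hz hz' v
    rw [he.mvfderiv_eq hz' hz]
  have h1 := he.fDiffAt_form hy hL hη hV.1
  have h2 := he.fDiffAt_form hy hL hη hV.2
  exact h1.fun_add (h2.clm_comp (ContinuousLinearMap.mul ℝ ℂ Complex.I))

namespace BRTTrivialization

variable [MulAction Circle X] {S : CRStructure n X} (B : BRTTrivialization S) {ξ : RField n X}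
  (F : CRFrame S ξ)

variable {y : X}

theorem contMDiffAt_dzForm {Z : CField n X} {D : Set X} (hZ : CSmoothOn Z D) (hD : IsOpen D)
    (hy : y ∈ B.D) (hyD : y ∈ D) (j : Fin n) :
    ContMDiffAt (𝓡 (2 * n + 1)) 𝓘(ℝ, ℂ) ∞ (fun z => B.dzForm j z (Z z)) y := by
  have h1 := B.isSmoothChart.contMDiffAt_chartVec hy (hZ.1.contMDiffAt (hD.mem_nhds hyD))
  have h2 := B.isSmoothChart.contMDiffAt_chartVec hy (hZ.2.contMDiffAt (hD.mem_nhds hyD))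
  have h3 := (zL j).contDiff.contMDiff.contMDiffAt.comp y h1
  have h4 := ((ContinuousLinearMap.mul ℝ ℂ Complex.I).comp
    (zL j)).contDiff.contMDiff.contMDiffAt.comp y h2
  exact h3.add h4

/-- The matrix that expresses the frame `F` in the BRT frame. -/
def gauge (y : X) : Matrix (Fin n) (Fin n) ℂ := Matrix.of fun α a => B.dzForm a y (F.Z α y)

theorem contMDiffAt_gauge (hy : y ∈ B.D) (hyF : y ∈ F.D) (α a : Fin n) :
    ContMDiffAt (𝓡 (2 * n + 1)) 𝓘(ℝ, ℂ) ∞ (fun z => B.gauge F z α a) y :=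
  B.contMDiffAt_dzForm (F.smooth α) F.isOpen hy hyF a

theorem fDiffAt_gauge (hy : y ∈ B.D) (hyF : y ∈ F.D) (α a : Fin n) :
    FDiffAt (n := n) (fun z => B.gauge F z α a) y :=
  (B.contMDiffAt_gauge F hy hyF α a).mdifferentiableAt (by simp)

theorem frame_mem (hyF : y ∈ F.D) (α : Fin n) : F.Z α y ∈ S.T10 y := by
  rw [← F.span y hyF]
  exact Submodule.subset_span ⟨α, rfl⟩

theorem frame_eq (hy : y ∈ B.D) (hyF : y ∈ F.D) (α : Fin n) :
    F.Z α y = ∑ a, B.gauge F y α a • B.Z a y :=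
  B.expansion_T10 hy (frame_mem F hyF α)

theorem frame_conj_eq (hy : y ∈ B.D) (hyF : y ∈ F.D) (α : Fin n) :
    cConj (F.Z α y) = ∑ a, starRingEnd ℂ (B.gauge F y α a) • B.Zbar a y := by
  rw [B.frame_eq F hy hyF, map_sum]
  simp only [cConj_smul]
  rfl

theorem det_gauge_ne_zero (hy : y ∈ B.D) (hyF : y ∈ F.D) : (B.gauge F y).det ≠ 0 := by
  intro h0
  obtain ⟨v, hv, hv0⟩ := Matrix.exists_vecMul_eq_zero_iff.2 h0
  apply hv
  refine funext (Fintype.linearIndependent_iff.1 (F.linearIndependent y hyF) v ?_)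
  simp only [B.frame_eq F hy hyF, Finset.smul_sum, smul_smul]
  rw [Finset.sum_comm]
  refine Finset.sum_eq_zero fun a _ => ?_
  rw [← Finset.sum_smul]
  have : ∑ α, v α * B.gauge F y α a = 0 := congrFun hv0 a
  rw [this, zero_smul]

theorem fDiffAt_gauge_inv (hy : y ∈ B.D) (hyF : y ∈ F.D) (a α : Fin n) :
    FDiffAt (n := n) (fun z => (B.gauge F z)⁻¹ a α) y := by
  have h1 : ContMDiffAt (𝓡 (2 * n + 1)) 𝓘(ℝ, Fin n → Fin n → ℂ) ∞
      (fun z => (fun i j => B.gauge F z i j : Fin n → Fin n → ℂ)) y :=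
    contMDiffAt_pi_space.2 fun i => contMDiffAt_pi_space.2 fun j => B.contMDiffAt_gauge F hy hyF i j
  have h2 := (contDiffAt_inv_apply (M := fun i j => B.gauge F y i j)
    (B.det_gauge_ne_zero F hy hyF) a α).contMDiffAt
  exact (ContMDiffAt.comp y h2 h1).mdifferentiableAt (by simp)

section Connection

variable [T2Space X] (hS : S.IsTransversalCRAction) (hpsc : S.IsStronglyPseudoconvex hS)
  (hξ : IsReebField (S.theta₀ hS) ξ) {nab : Connection n X}
  (h : IsTanakaWebster S (S.theta₀ hS) ξ nab)

/-- The connection forms in the BRT frame. -/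
def brtConnection (a b : Fin n) (y : X) (U : CT n y) : ℂ :=
  ∑ j, B.dzForm j y U * gam B.φ j (B.zc y) a b

theorem frame_expansion (hyF : y ∈ F.D) {U : CT n y} (hU : U ∈ S.T10 y) :
    U = ∑ β, F.θ β y U • F.Z β y := by
  rw [← F.span y hyF] at hU
  obtain ⟨c, rfl⟩ := (Submodule.mem_span_range_iff_exists_fun ℂ).1 hU
  have : ∀ β, F.θ β y (∑ α, c α • F.Z α y) = c β := by
    intro β
    simp [F.θ_apply_Z y hyF]
  simp only [this]

include hpsc hξ h

/-- The change of the connection forms under a change of the frame. -/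
theorem connectionForm_gauge (hy : y ∈ B.D) (hyF : y ∈ F.D) (α a : Fin n) (U : CT n y) :
    ∑ β, F.connectionForm nab α β y U * B.gauge F y β a
      = cDeriv U (fun z => B.gauge F z α a)
        + ∑ b, B.gauge F y α b * B.brtConnection b a y U := by
  -- The Leibniz rule on `∑_b A_{αb} Z_b`, with `A` the gauge matrix, is the source of `ωA = dA +
  -- Aγ`.
  have h1 : cNabla nab (F.Z α) y U
      = ∑ b, (cDeriv U (fun z => B.gauge F z α b) • B.Z b y
        + B.gauge F y α b • cNabla nab (B.Z b) y U) := by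
    have hev : ∀ᶠ z in nhds y, F.Z α z = ∑ b, B.gauge F z α b • B.Z b z := by
      filter_upwards [B.eventually_D hy, F.isOpen.mem_nhds hyF] with z hz hzF
      exact B.frame_eq F hz hzF α
    rw [cNabla_congr nab ((F.smooth α).cDiffAt F.isOpen hyF) hev, cNabla_sum nab _
      fun b _ => CDiffAt.smul (B.fDiffAt_gauge F hy hyF α b) (B.cDiffAt_Z hy b)]
    exact Finset.sum_congr rfl fun b _ =>
      cNabla_smul nab (B.fDiffAt_gauge F hy hyF α b) (B.cDiffAt_Z hy b) U
  have hmem := h.cNabla_mem (F.smooth α) F.isOpen (fun x hx => frame_mem F hx α) hyF U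
  have h2 : ∑ β, F.connectionForm nab α β y U * B.gauge F y β a
      = B.dzForm a y (cNabla nab (F.Z α) y U) := by
    conv_rhs => rw [frame_expansion F hyF hmem]
    simp only [map_sum, map_smul, smul_eq_mul]
    rfl
  rw [h2, h1]
  simp only [B.cNabla_Z hS hpsc hξ h hy, map_sum, map_add, map_smul, smul_eq_mul,
    B.dzForm_Z hy, mul_ite, mul_one, mul_zero, Finset.sum_ite_eq, Finset.mem_univ, if_true,
    Finset.sum_add_distrib, brtConnection]

/-- The dual frame of a `CRFrame` is not assumed smooth, so differentiability is read off from `ω =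
(dA + Aγ)A⁻¹`, where every factor is known to be differentiable. -/
theorem fDiffAt_connectionForm (hy : y ∈ B.D) (hyF : y ∈ F.D) (α β : Fin n) {U : CField n X}
    {D : Set X} (hU : CSmoothOn U D) (hD : IsOpen D) (hyD : y ∈ D) :
    FDiffAt (n := n) (fun z => F.connectionForm nab α β z (U z)) y := by
  have hU' := hU.cDiffAt hD hyD
  have hgam : ∀ j a b, FDiffAt (n := n) (fun z => gam B.φ j (B.zc z) a b) y := fun j a b =>
    B.fDiffAt_comp_zc (h := fun w => gam B.φ j w a b) hy
      ((contDiffAt_gam B.isOpen_ball B.smooth_φ (B.zc_mem hy)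
        (B.det_hess_ne_zero hS hpsc hy) j a b).differentiableAt (by simp))
  have hdz : ∀ j, FDiffAt (n := n) (fun z => B.dzForm j z (U z)) y := fun j =>
    (B.contMDiffAt_dzForm hU hD hy hyD j).mdifferentiableAt (by simp)
  have h1 : FDiffAt (n := n) (fun z => ∑ a, (cDeriv (U z) (fun z => B.gauge F z α a)
      + ∑ b, B.gauge F z α b * B.brtConnection b a z (U z)) * (B.gauge F z)⁻¹ a β) y := by
    refine FDiffAt.fun_sum fun a _ => FDiffAt.fun_mul (FDiffAt.fun_add ?_ ?_)
      (B.fDiffAt_gauge_inv F hy hyF a β)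
    · exact B.isSmoothChart.fDiffAt_cDeriv hy (B.contMDiffAt_gauge F hy hyF α a) hU'
    · exact FDiffAt.fun_sum fun b _ => (B.fDiffAt_gauge F hy hyF α b).fun_mul
        (FDiffAt.fun_sum fun j _ => (hdz j).fun_mul (hgam j b a))
  refine h1.congr ?_
  filter_upwards [B.eventually_D hy, F.isOpen.mem_nhds hyF] with z hz hzF
  simp only [← B.connectionForm_gauge F hS hpsc hξ h hz hzF]
  have h2 : ∑ a, (∑ γ, F.connectionForm nab α γ z (U z) * B.gauge F z γ a) * (B.gauge F z)⁻¹ a β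
      = (Matrix.vecMul (Matrix.vecMul (fun γ => F.connectionForm nab α γ z (U z)) (B.gauge F z))
        (B.gauge F z)⁻¹) β := rfl
  rw [h2, Matrix.vecMul_vecMul, Matrix.mul_nonsing_inv _
    (isUnit_iff_ne_zero.2 (B.det_gauge_ne_zero F hz hzF)), Matrix.vecMul_one]

end Connection

end BRTTrivialization

/-! ### Curvature in an arbitrary frame. -/

variable {n : ℕ} {X : Type*} [TopologicalSpace X]
  [ChartedSpace (EuclideanSpace ℝ (Fin (2 * n + 1))) X]
  [IsManifold (𝓡 (2 * n + 1)) ∞ X]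

theorem cDeriv_sum_smul {ι : Type*} (s : Finset ι) {y : X} (c : ι → ℂ) (U : ι → CT n y) (f : X → ℂ) :
    cDeriv (∑ i ∈ s, c i • U i) f = ∑ i ∈ s, c i * cDeriv (U i) f := by
  simp only [cDeriv_eq_cExt, map_sum, map_smul, smul_eq_mul]

/-- The curvature of a matrix of one-forms, evaluated algebraically: `u, v` are the values of the
connection forms on two vectors, `w` those on the bracket, and primes denote derivatives. -/
theorem curvature_algebra (A : Matrix (Fin n) (Fin n) ℂ) {ωu ωv dω UA VA UVA VUA BA ωw : Matrix (Fin n) (Fin n) ℂ}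
    {γu γw Vγu Uωv Vωu : Matrix (Fin n) (Fin n) ℂ}
    (hv : ωv * A = VA) (hu : ωu * A = UA + A * γu) (hw : ωw * A = BA + A * γw)
    (hUv : Uωv * A + ωv * UA = UVA) (hVu : Vωu * A + ωu * VA = VUA + (VA * γu + A * Vγu))
    (hB : BA = UVA - VUA) (hd : dω = Uωv - Vωu - ωw) :
    (dω - (ωu * ωv - ωv * ωu)) * A = -(A * (Vγu + γw)) := by
  -- The hypotheses are `ωA = dA + Aγ` and its derivatives, with `γ(V) = 0`. The terms in `dA`
  -- cancel, and `-(Vγ(U) + γ([U, V]))` is all that remains of `dγ(U, V)`, the quadratic term in `γ`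
  -- being zero.
  have e1 : (ωu * ωv) * A = ωu * VA := by rw [Matrix.mul_assoc, hv]
  have e2 : (ωv * ωu) * A = ωv * UA + VA * γu := by
    rw [Matrix.mul_assoc, hu, Matrix.mul_add, ← Matrix.mul_assoc, hv]
  have e3 : Uωv * A = UVA - ωv * UA := eq_sub_of_add_eq hUv
  have e4 : Vωu * A = VUA + (VA * γu + A * Vγu) - ωu * VA := eq_sub_of_add_eq hVu
  rw [hd, Matrix.sub_mul, Matrix.sub_mul, Matrix.sub_mul, Matrix.sub_mul, e1, e2, e3, e4, hw, hB,
    Matrix.mul_add]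
  abel

namespace BRTTrivialization

variable [MulAction Circle X] {S : CRStructure n X} (B : BRTTrivialization S) {ξ : RField n X}
  (F : CRFrame S ξ)

variable {y : X}

section Connection

variable [T2Space X] (hS : S.IsTransversalCRAction) (hpsc : S.IsStronglyPseudoconvex hS)
  (hξ : IsReebField (S.theta₀ hS) ξ) {nab : Connection n X}
  (h : IsTanakaWebster S (S.theta₀ hS) ξ nab)

theorem dzForm_conj_frame (hy : y ∈ B.D) (hyF : y ∈ F.D) (j k : Fin n) :
    B.dzForm j y (cConj (F.Z k y)) = 0 := by
  rw [B.frame_conj_eq F hy hyF]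
  simp [B.dzForm_Zbar hy]

include hpsc hξ h

/-- This is the transformation law of curvature, multiplied by `A` on the right to avoid
differentiating `A⁻¹`. The BRT connection form `γ` has type `(1,0)` and kills the conjugate frame,
so only `∂̄γ` contributes. -/
theorem curvatureForm_gauge (hy : y ∈ B.D) (hyF : y ∈ F.D) (α a j k : Fin n) :
    ∑ β, F.curvature nab α β j k y * B.gauge F y β a
      = -∑ b, B.gauge F y α b * ∑ l, B.gauge F y j l * ∑ m, starRingEnd ℂ (B.gauge F y k m)
        * dzbar m (fun w => gam B.φ l w b a) (B.zc y) := by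
  set U : CField n X := F.Z j with hUdef
  set V : CField n X := fun z => cConj (F.Z k z) with hVdef
  have hUs : CSmoothOn U F.D := F.smooth j
  have hVs : CSmoothOn V F.D := (F.smooth k).conj
  have hU := hUs.cDiffAt F.isOpen hyF
  have hV := hVs.cDiffAt F.isOpen hyF
  have hev : ∀ᶠ z in nhds y, z ∈ B.D ∧ z ∈ F.D :=
    (B.eventually_D hy).and (F.isOpen.mem_nhds hyF)
  have hgam : ∀ j a b, DifferentiableAt ℝ (fun w => gam B.φ j w a b) (B.zc y) := fun j a b =>
    (contDiffAt_gam B.isOpen_ball B.smooth_φ (B.zc_mem hy)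
      (B.det_hess_ne_zero hS hpsc hy) j a b).differentiableAt (by simp)
  have hgam' : ∀ j a b, FDiffAt (n := n) (fun z => gam B.φ j (B.zc z) a b) y := fun j a b =>
    B.fDiffAt_comp_zc (h := fun w => gam B.φ j w a b) hy (hgam j a b)
  have hdz : ∀ l, FDiffAt (n := n) (fun z => B.dzForm l z (U z)) y := fun l =>
    (B.contMDiffAt_dzForm hUs F.isOpen hy hyF l).mdifferentiableAt (by simp)
  have hA := fun α a => B.contMDiffAt_gauge F hy hyF α a
  have hAd := fun α a => B.fDiffAt_gauge F hy hyF α a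
  have hωU := fun α β => B.fDiffAt_connectionForm F hS hpsc hξ h hy hyF α β hUs F.isOpen hyF
  have hωV := fun α β => B.fDiffAt_connectionForm F hS hpsc hξ h hy hyF α β hVs F.isOpen hyF
  have hγU : ∀ b a, FDiffAt (n := n) (fun z => B.brtConnection b a z (U z)) y := fun b a =>
    FDiffAt.fun_sum fun l _ => (hdz l).fun_mul (hgam' l b a)
  have hdzV : ∀ l, ∀ᶠ z in nhds y, B.dzForm l z (V z) = 0 := fun l =>
    hev.mono fun z hz => B.dzForm_conj_frame F hz.1 hz.2 l k
  have hγV : ∀ b a, ∀ᶠ z in nhds y, B.brtConnection b a z (V z) = 0 := by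
    intro b a
    filter_upwards [hev] with z hz
    simp only [brtConnection]
    refine Finset.sum_eq_zero fun l _ => ?_
    rw [B.dzForm_conj_frame F hz.1 hz.2, zero_mul]
  have key := curvature_algebra (B.gauge F y)
    (ωu := Matrix.of fun α β => F.connectionForm nab α β y (U y))
    (ωv := Matrix.of fun α β => F.connectionForm nab α β y (V y))
    (ωw := Matrix.of fun α β => F.connectionForm nab α β y (cBracket U V y))
    (dω := Matrix.of fun α β => cdForm (F.connectionForm nab α β) U V y)
    (UA := Matrix.of fun α a => cDeriv (U y) fun z => B.gauge F z α a)
    (VA := Matrix.of fun α a => cDeriv (V y) fun z => B.gauge F z α a)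
    (UVA := Matrix.of fun α a => cDeriv (U y) fun z => cDeriv (V z) fun z => B.gauge F z α a)
    (VUA := Matrix.of fun α a => cDeriv (V y) fun z => cDeriv (U z) fun z => B.gauge F z α a)
    (BA := Matrix.of fun α a => cDeriv (cBracket U V y) fun z => B.gauge F z α a)
    (γu := Matrix.of fun b a => B.brtConnection b a y (U y))
    (γw := Matrix.of fun b a => B.brtConnection b a y (cBracket U V y))
    (Vγu := Matrix.of fun b a => cDeriv (V y) fun z => B.brtConnection b a z (U z))
    (Uωv := Matrix.of fun α β => cDeriv (U y) fun z => F.connectionForm nab α β z (V z))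
    (Vωu := Matrix.of fun α β => cDeriv (V y) fun z => F.connectionForm nab α β z (U z))
    (by
      ext α a
      simp only [Matrix.mul_apply, Matrix.of_apply]
      rw [B.connectionForm_gauge F hS hpsc hξ h hy hyF, Finset.sum_eq_zero, add_zero]
      intro b _
      rw [(hγV b a).self_of_nhds, mul_zero])
    (by
      ext α a
      simp only [Matrix.mul_apply, Matrix.of_apply, Matrix.add_apply]
      exact B.connectionForm_gauge F hS hpsc hξ h hy hyF _ _ _)
    (by
      ext α a
      simp only [Matrix.mul_apply, Matrix.of_apply, Matrix.add_apply]
      exact B.connectionForm_gauge F hS hpsc hξ h hy hyF _ _ _)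
    (by
      ext α a
      simp only [Matrix.mul_apply, Matrix.of_apply, Matrix.add_apply]
      have e : (fun z => cDeriv (V z) fun z => B.gauge F z α a) =ᶠ[nhds y]
          fun z => ∑ β, F.connectionForm nab α β z (V z) * B.gauge F z β a := by
        filter_upwards [hev, Filter.eventually_all.2 fun b => hγV b a] with z hz hz'
        rw [B.connectionForm_gauge F hS hpsc hξ h hz.1 hz.2, Finset.sum_eq_zero, add_zero]
        intro b _
        rw [hz', mul_zero]
      rw [cDeriv_congr e, cDeriv_sum fun β _ => (hωV α β).fun_mul (hAd β a),
        ← Finset.sum_add_distrib]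
      exact Finset.sum_congr rfl fun β _ => (cDeriv_mul (hωV α β) (hAd β a) _).symm)
    (by
      ext α a
      simp only [Matrix.mul_apply, Matrix.of_apply, Matrix.add_apply]
      have e : (fun z => ∑ β, F.connectionForm nab α β z (U z) * B.gauge F z β a) =ᶠ[nhds y]
          fun z => (cDeriv (U z) fun z => B.gauge F z α a)
            + ∑ b, B.gauge F z α b * B.brtConnection b a z (U z) := by
        filter_upwards [hev] with z hz
        exact B.connectionForm_gauge F hS hpsc hξ h hz.1 hz.2 _ _ _
      have e' := cDeriv_congr e (V y)
      rw [cDeriv_sum fun β _ => (hωU α β).fun_mul (hAd β a),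
        cDeriv_add (B.isSmoothChart.fDiffAt_cDeriv hy (hA α a) hU)
          (FDiffAt.fun_sum fun b _ => (hAd α b).fun_mul (hγU b a)),
        cDeriv_sum fun b _ => (hAd α b).fun_mul (hγU b a)] at e'
      rw [← Finset.sum_add_distrib, ← Finset.sum_add_distrib]
      calc _ = _ := Finset.sum_congr rfl fun β _ => (cDeriv_mul (hωU α β) (hAd β a) _).symm
        _ = _ := e'
        _ = _ := congrArg _ (Finset.sum_congr rfl fun b _ => cDeriv_mul (hAd α b) (hγU b a) _))
    (by
      ext α a
      simp only [Matrix.of_apply, Matrix.sub_apply]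
      exact B.isSmoothChart.cDeriv_cBracket hy (hA α a) hU hV)
    (by
      ext α a
      rfl)
  have hcurv : ∀ α β, F.curvature nab α β j k y
      = ((Matrix.of fun α β => cdForm (F.connectionForm nab α β) U V y)
        - ((Matrix.of fun α β => F.connectionForm nab α β y (U y))
          * (Matrix.of fun α β => F.connectionForm nab α β y (V y))
        - (Matrix.of fun α β => F.connectionForm nab α β y (V y))
          * (Matrix.of fun α β => F.connectionForm nab α β y (U y)))) α β := by
    intro α β
    simp only [CRFrame.curvature, CRFrame.curvatureForm, Matrix.sub_apply, Matrix.mul_apply,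
      Matrix.of_apply, Finset.sum_sub_distrib]
    rfl
  have hlhs := congrFun (congrFun key α) a
  rw [Matrix.mul_apply] at hlhs
  simp only [← hcurv] at hlhs
  rw [hlhs, Matrix.neg_apply, Matrix.mul_apply]
  congr 1
  refine Finset.sum_congr rfl fun b _ => ?_
  congr 1
  simp only [Matrix.add_apply, Matrix.of_apply]
  -- As `dz_l` is closed and kills `V`, the bracket term cancels the derivative of the coefficients
  -- of `U`; only the derivatives of the Kähler coefficients survive.
  have hbr : ∀ l, B.dzForm l y (cBracket U V y) = -cDeriv (V y) fun z => B.dzForm l z (U z) := by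
    intro l
    rw [← B.cDeriv_zfun hy, B.isSmoothChart.cDeriv_cBracket hy (B.contMDiffAt_zfun hy l) hU hV,
      cDeriv_eventually_const (c := 0) ?_, zero_sub]
    · congr 1
      refine cDeriv_congr ?_ _
      filter_upwards [hev] with z hz
      rw [B.cDeriv_zfun hz.1]
    · filter_upwards [hev, hdzV l] with z hz hz'
      rw [B.cDeriv_zfun hz.1, hz']
  simp only [brtConnection]
  rw [cDeriv_sum fun l _ => (hdz l).fun_mul (hgam' l b a), ← Finset.sum_add_distrib]
  refine Finset.sum_congr rfl fun l _ => ?_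
  rw [cDeriv_mul (hdz l) (hgam' l b a), hbr]
  have hVg : cDeriv (V y) (fun z => gam B.φ l (B.zc z) b a)
      = ∑ m, starRingEnd ℂ (B.gauge F y k m) * dzbar m (fun w => gam B.φ l w b a) (B.zc y) := by
    rw [show V y = _ from B.frame_conj_eq F hy hyF k, cDeriv_sum_smul]
    exact Finset.sum_congr rfl fun m _ => by
      rw [B.cDeriv_Zbar_comp_zc (h := fun w => gam B.φ l w b a) hy (hgam l b a)]
  rw [hVg]
  change _ + B.gauge F y j l * _ + _ = _
  ring

end Connection

end BRTTrivialization

/-! ### Jacobi's formula and the logarithm of `det G`. -/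

section Jacobi

variable {n : ℕ}

/-- Jacobi's formula. -/
theorem fderiv_det {E : Type*} [NormedAddCommGroup E] [NormedSpace ℝ E]
    {M : E → Matrix (Fin n) (Fin n) ℂ} {x : E}
    (hM : ∀ i j, DifferentiableAt ℝ (fun x => M x i j) x) (v : E) :
    fderiv ℝ (fun x => (M x).det) x v
      = ((M x).adjugate * Matrix.of fun i j => fderiv ℝ (fun x => M x i j) x v).trace := by
  have h1 : HasFDerivAt (fun x => (M x).det) (∑ σ : Equiv.Perm (Fin n),
      ((Equiv.Perm.sign σ : ℤ) : ℂ) • ∑ i, (∏ j ∈ Finset.univ.erase i, M x (σ j) j) •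
        fderiv ℝ (fun x => M x (σ i) i) x) x := by
    simp only [Matrix.det_apply']
    refine HasFDerivAt.fun_sum fun σ _ => ?_
    have := (HasFDerivAt.finsetProd (u := Finset.univ) (x := x)
      fun i _ => (hM (σ i) i).hasFDerivAt).const_mul ((Equiv.Perm.sign σ : ℤ) : ℂ)
    exact this
  -- By Cramer's rule a diagonal entry of `adj(M) · M'` is the determinant of `M` with one column
  -- differentiated; the product rule applied to the Leibniz expansion gives the sum of these.
  have h2 : ∀ i, ∑ j, (M x).adjugate i j * fderiv ℝ (fun x => M x j i) x v
      = ((M x).updateCol i fun r => fderiv ℝ (fun x => M x r i) x v).det := by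
    intro i
    rw [← Matrix.cramer_apply, Matrix.cramer_eq_adjugate_mulVec]
    rfl
  rw [h1.fderiv]
  simp only [Matrix.trace, Matrix.diag_apply, Matrix.mul_apply, Matrix.of_apply, h2,
    Matrix.det_apply', sum_apply, smul_apply, smul_eq_mul, Finset.mul_sum]
  rw [Finset.sum_comm]
  refine Finset.sum_congr rfl fun i _ => Finset.sum_congr rfl fun σ _ => ?_
  congr 1
  rw [← Finset.mul_prod_erase Finset.univ _ (Finset.mem_univ i), mul_comm, Matrix.updateCol_self]
  congr 1
  refine Finset.prod_congr rfl fun j hj => ?_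
  rw [Matrix.updateCol_ne (Finset.ne_of_mem_erase hj)]

variable {z : EuclideanSpace ℂ (Fin n)}

theorem dz_det {M : EuclideanSpace ℂ (Fin n) → Matrix (Fin n) (Fin n) ℂ}
    (hM : ∀ i j, DifferentiableAt ℝ (fun x => M x i j) z) (b : Fin n) :
    dz b (fun x => (M x).det) z
      = ((M z).adjugate * Matrix.of fun i j => dz b (fun x => M x i j) z).trace := by
  simp only [dz, fderiv_det hM, Matrix.trace, Matrix.diag_apply, Matrix.mul_apply,
    Matrix.of_apply, Finset.mul_sum, ← Finset.sum_sub_distrib]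
  refine Finset.sum_congr rfl fun i _ => Finset.sum_congr rfl fun j _ => ?_
  ring

variable {O : Set (EuclideanSpace ℂ (Fin n))}

theorem contDiffOn_det_hess {φ : EuclideanSpace ℂ (Fin n) → ℝ} (hO : IsOpen O)
    (hφ : ContDiffOn ℝ ∞ φ O) : ContDiffOn ℝ ∞ (fun w => (hess φ w).det) O := by
  simp only [Matrix.det_apply']
  exact ContDiffOn.sum fun σ _ => contDiffOn_const.mul
    (contDiffOn_prod fun i _ => contDiffOn_hess hO hφ _ _)

/-- The trace of the connection of a Kähler metric is `∂ log det G`. -/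
theorem sum_gam {φ : EuclideanSpace ℂ (Fin n) → ℝ} (hO : IsOpen O)
    (hφ : ContDiffOn ℝ ∞ φ O) (hz : z ∈ O) (b : Fin n) :
    ∑ l, gam φ l z b l = dz b (fun w => (hess φ w).det) z * ((hess φ z).det)⁻¹ := by
  have hM := fun i j => differentiableAt_of_contDiffOn hO (contDiffOn_hess hO hφ i j) hz
  rw [dz_det hM]
  simp only [gam, Matrix.mul_apply, Matrix.of_apply, Matrix.trace, Matrix.diag_apply,
    Matrix.inv_def, Ring.inverse_eq_inv', Matrix.smul_apply, smul_eq_mul, Finset.sum_mul]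
  rw [Finset.sum_comm]
  refine Finset.sum_congr rfl fun m _ => Finset.sum_congr rfl fun l _ => ?_
  -- The Kähler condition `∂_l G_{bm} = ∂_b G_{lm}` turns the contraction of the direction index
  -- with the upper index into the trace of `∂_b G · G⁻¹`.
  rw [dz_hess_symm hO hφ hz l b m]
  ring

end Jacobi

/-- The matrix `∂̄_m ∂_b log det G`. -/
def logHess {n : ℕ} (D : EuclideanSpace ℂ (Fin n) → ℂ) (z : EuclideanSpace ℂ (Fin n)) :
    Matrix (Fin n) (Fin n) ℂ :=
  Matrix.of fun b m => dzbar m (fun w => dz b D w * (D w)⁻¹) z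

theorem dz_inv {n : ℕ} {z : EuclideanSpace ℂ (Fin n)} {D : EuclideanSpace ℂ (Fin n) → ℂ}
    (hD : DifferentiableAt ℝ D z) (h0 : D z ≠ 0) (j : Fin n) :
    dz j (fun w => (D w)⁻¹) z = -dz j D z * ((D z)⁻¹) ^ 2 := by
  have h : fderiv ℝ (fun w => (D w)⁻¹) z = _ :=
    ((hasFDerivAt_inv' (𝕜 := ℝ) h0).comp z hD.hasFDerivAt).fderiv
  simp only [dz, h, ContinuousLinearMap.comp_apply, neg_apply, ContinuousLinearMap.mulLeftRight_apply]
  ring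

theorem dzbar_inv {n : ℕ} {z : EuclideanSpace ℂ (Fin n)} {D : EuclideanSpace ℂ (Fin n) → ℂ}
    (hD : DifferentiableAt ℝ D z) (h0 : D z ≠ 0) (j : Fin n) :
    dzbar j (fun w => (D w)⁻¹) z = -dzbar j D z * ((D z)⁻¹) ^ 2 := by
  have h : fderiv ℝ (fun w => (D w)⁻¹) z = _ :=
    ((hasFDerivAt_inv' (𝕜 := ℝ) h0).comp z hD.hasFDerivAt).fderiv
  simp only [dzbar, h, ContinuousLinearMap.comp_apply, neg_apply, ContinuousLinearMap.mulLeftRight_apply]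
  ring

/-- Mixed logarithmic derivatives commute. -/
theorem logHess_apply {n : ℕ} {z : EuclideanSpace ℂ (Fin n)} {D : EuclideanSpace ℂ (Fin n) → ℂ}
    {O : Set (EuclideanSpace ℂ (Fin n))} (hO : IsOpen O) (hD : ContDiffOn ℝ ∞ D O) (hz : z ∈ O)
    (h0 : D z ≠ 0) (b m : Fin n) :
    logHess D z b m = dz b (fun w => dzbar m D w * (D w)⁻¹) z := by
  have hd := differentiableAt_of_contDiffOn hO hD hz
  have h1 := differentiableAt_of_contDiffOn hO (contDiffOn_dz hO hD b) hz
  have h2 := differentiableAt_of_contDiffOn hO (contDiffOn_dzbar hO hD m) hz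
  -- Quotients `∂D · D⁻¹` stand for `∂ log D`, so no branch of the logarithm of the complex-valued
  -- `D` is needed. The Ricci tensor yields one order of differentiation, the rigid Laplacian the
  -- other.
  rw [logHess, Matrix.of_apply, dzbar_mul h1 (hd.fun_inv h0), dz_mul h2 (hd.fun_inv h0), dz_inv hd h0,
    dzbar_inv hd h0, dz_dzbar_comm hO hD hz]
  ring

/-! ### Ricci and scalar curvature of the Tanaka–Webster connection. -/

namespace BRTTrivialization

variable {n : ℕ} {X : Type*} [TopologicalSpace X]
  [ChartedSpace (EuclideanSpace ℝ (Fin (2 * n + 1))) X]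
  [IsManifold (𝓡 (2 * n + 1)) ∞ X]

variable [MulAction Circle X] {S : CRStructure n X} (B : BRTTrivialization S) {ξ : RField n X}
  (F : CRFrame S ξ)

variable {y : X}

theorem metric_eq (hS : S.IsTransversalCRAction) (hy : y ∈ B.D) (hyF : y ∈ F.D) :
    F.metric (S.theta₀ hS) y
      = B.gauge F y * ((2 : ℂ) • hess B.φ (B.zc y)) * (B.gauge F y).conjTranspose := by
  ext α β
  rw [CRFrame.metric, Matrix.of_apply, B.cEval₂_dForm_theta₀ hS hy, B.frame_conj_eq F hy hyF,
    B.frame_eq F hy hyF]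
  simp only [map_sum, map_smul, LinearMap.sum_apply, LinearMap.smul_apply, B.dtheta₀_Z_Zbar hy,
    smul_eq_mul, Matrix.mul_apply, Matrix.smul_apply, Matrix.conjTranspose_apply, Finset.mul_sum,
    Finset.sum_mul]
  refine Finset.sum_congr rfl fun m _ => Finset.sum_congr rfl fun a _ => ?_
  change _ = _ * starRingEnd ℂ _
  linear_combination (-2 * starRingEnd ℂ (B.gauge F y β m) * B.gauge F y α a
    * hess B.φ (B.zc y) a m) * Complex.I_sq

section Connection

variable [T2Space X] (hS : S.IsTransversalCRAction) (hpsc : S.IsStronglyPseudoconvex hS)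
  (hξ : IsReebField (S.theta₀ hS) ξ) {nab : Connection n X}
  (h : IsTanakaWebster S (S.theta₀ hS) ξ nab)

include hpsc hξ h

/-- In the contraction of `β` with `j`, the factors `A⁻¹` and `A` combine to a Kronecker delta, so
the trace is taken in the BRT frame, where `sum_gam` evaluates it. The two free indices keep the
factors `A` and `A*`. -/
theorem ricci_eq (hy : y ∈ B.D) (hyF : y ∈ F.D) :
    (Matrix.of fun α k => F.ricci nab α k y)
      = -(B.gauge F y * logHess (fun w => (hess B.φ w).det) (B.zc y)
        * (B.gauge F y).conjTranspose) := by
  have hdet := isUnit_iff_ne_zero.2 (B.det_gauge_ne_zero F hy hyF)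
  have hR : ∀ α β j k, F.curvature nab α β j k y
      = ∑ a, (-∑ b, B.gauge F y α b * ∑ l, B.gauge F y j l * ∑ m, starRingEnd ℂ (B.gauge F y k m)
        * dzbar m (fun w => gam B.φ l w b a) (B.zc y)) * (B.gauge F y)⁻¹ a β := by
    intro α β j k
    simp only [← B.curvatureForm_gauge F hS hpsc hξ h hy hyF α _ j k]
    change _ = (Matrix.vecMul (Matrix.vecMul (fun β => F.curvature nab α β j k y) (B.gauge F y))
      (B.gauge F y)⁻¹) β
    rw [Matrix.vecMul_vecMul, Matrix.mul_nonsing_inv _ hdet, Matrix.vecMul_one]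
  have hδ : ∀ a l, ∑ β, (B.gauge F y)⁻¹ a β * B.gauge F y β l = if a = l then 1 else 0 := by
    intro a l
    rw [← Matrix.mul_apply, Matrix.nonsing_inv_mul _ hdet, Matrix.one_apply]
  have hgam : ∀ j a b, DifferentiableAt ℝ (fun w => gam B.φ j w a b) (B.zc y) := fun j a b =>
    (contDiffAt_gam B.isOpen_ball B.smooth_φ (B.zc_mem hy)
      (B.det_hess_ne_zero hS hpsc hy) j a b).differentiableAt (by simp)
  have hQ : ∀ b m, ∑ l, dzbar m (fun w => gam B.φ l w b l) (B.zc y)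
      = logHess (fun w => (hess B.φ w).det) (B.zc y) b m := by
    intro b m
    rw [← dzbar_sum fun l _ => hgam l b l, logHess, Matrix.of_apply]
    refine dzbar_congr ?_ m
    filter_upwards [B.isOpen_ball.mem_nhds (B.zc_mem hy)] with w hw
    exact sum_gam B.isOpen_ball B.smooth_φ hw b
  ext α k
  rw [Matrix.of_apply, CRFrame.ricci, Matrix.neg_apply]
  simp only [hR, Matrix.mul_apply, Matrix.conjTranspose_apply, ← hQ, neg_mul,
    Finset.sum_neg_distrib]
  congr 1
  have hterm : ∀ a b l m, ∑ β, (B.gauge F y α b * (B.gauge F y β l *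
      (starRingEnd ℂ (B.gauge F y k m) * dzbar m (fun w => gam B.φ l w b a) (B.zc y)))
        * (B.gauge F y)⁻¹ a β)
      = if a = l then B.gauge F y α b * (starRingEnd ℂ (B.gauge F y k m)
        * dzbar m (fun w => gam B.φ l w b a) (B.zc y)) else 0 := by
    intro a b l m
    have h1 : ∀ β, (B.gauge F y α b * (B.gauge F y β l *
      (starRingEnd ℂ (B.gauge F y k m) * dzbar m (fun w => gam B.φ l w b a) (B.zc y)))
        * (B.gauge F y)⁻¹ a β) = (B.gauge F y α b * (starRingEnd ℂ (B.gauge F y k m)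
        * dzbar m (fun w => gam B.φ l w b a) (B.zc y)))
        * ((B.gauge F y)⁻¹ a β * B.gauge F y β l) := fun β => by ring
    rw [Finset.sum_congr rfl fun β _ => h1 β, ← Finset.mul_sum, hδ]
    simp
  simp only [Finset.mul_sum, Finset.sum_mul]
  calc _ = ∑ a, ∑ b, ∑ l, ∑ m, ∑ β, (B.gauge F y α b * (B.gauge F y β l *
      (starRingEnd ℂ (B.gauge F y k m) * dzbar m (fun w => gam B.φ l w b a) (B.zc y)))
        * (B.gauge F y)⁻¹ a β) := by
        rw [Finset.sum_comm]
        refine Finset.sum_congr rfl fun a _ => ?_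
        rw [Finset.sum_comm]
        refine Finset.sum_congr rfl fun b _ => ?_
        rw [Finset.sum_comm]
        refine Finset.sum_congr rfl fun l _ => ?_
        rw [Finset.sum_comm]
    _ = ∑ a, ∑ b, ∑ m, B.gauge F y α b * (starRingEnd ℂ (B.gauge F y k m)
        * dzbar m (fun w => gam B.φ a w b a) (B.zc y)) := by
        simp only [hterm]
        refine Finset.sum_congr rfl fun a _ => Finset.sum_congr rfl fun b _ => ?_
        rw [Finset.sum_comm]
        refine Finset.sum_congr rfl fun m _ => ?_
        simp
    _ = ∑ m, ∑ b, ∑ a, B.gauge F y α b * (starRingEnd ℂ (B.gauge F y k m)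
        * dzbar m (fun w => gam B.φ a w b a) (B.zc y)) := by
        rw [Finset.sum_comm, Finset.sum_comm (γ := Fin n) (s := Finset.univ (α := Fin n))
          (t := Finset.univ (α := Fin n))
          (f := fun m b => ∑ a, B.gauge F y α b * (starRingEnd ℂ (B.gauge F y k m)
            * dzbar m (fun w => gam B.φ a w b a) (B.zc y)))]
        refine Finset.sum_congr rfl fun b _ => ?_
        rw [Finset.sum_comm]
    _ = _ := by
        refine Finset.sum_congr rfl fun m _ => Finset.sum_congr rfl fun b _ =>
          Finset.sum_congr rfl fun a _ => ?_
        change _ = _ * starRingEnd ℂ _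
        ring

/-- In `tr((A · 2G · A*)⁻¹ · A Q A*)` the gauge matrices cancel cyclically, and the factor `1/2`
comes from `2G`. -/
theorem scalarCurvature_eq (hy : y ∈ B.D) (hyF : y ∈ F.D) :
    F.scalarCurvature (S.theta₀ hS) nab y
      = -(1 / 2) * ((hess B.φ (B.zc y))⁻¹
        * logHess (fun w => (hess B.φ w).det) (B.zc y)).trace := by
  have hdet := isUnit_iff_ne_zero.2 (B.det_gauge_ne_zero F hy hyF)
  have hdet' : IsUnit (B.gauge F y).conjTranspose.det := by
    rw [Matrix.det_conjTranspose]; exact hdet.star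
  have h1 : F.scalarCurvature (S.theta₀ hS) nab y
      = ((F.metric (S.theta₀ hS) y)⁻¹ * Matrix.of fun α k => F.ricci nab α k y).trace := by
    rw [CRFrame.scalarCurvature, Finset.sum_comm]
    rfl
  have h2 : ((2 : ℂ) • hess B.φ (B.zc y))⁻¹ = (1 / 2 : ℂ) • (hess B.φ (B.zc y))⁻¹ := by
    have := Matrix.inv_smul' (A := hess B.φ (B.zc y)) (Units.mk0 (2 : ℂ) two_ne_zero)
      (isUnit_iff_ne_zero.2 (B.det_hess_ne_zero hS hpsc hy))
    simpa [Units.smul_def] using this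
  rw [h1, B.ricci_eq F hS hpsc hξ h hy hyF, B.metric_eq F hS hy hyF, Matrix.mul_inv_rev,
    Matrix.mul_inv_rev, h2, Matrix.mul_neg, Matrix.trace_neg]
  set A := B.gauge F y
  set C := A.conjTranspose
  set H := (hess B.φ (B.zc y))⁻¹
  set Q := logHess (fun w => (hess B.φ w).det) (B.zc y)
  have h3 : C⁻¹ * ((1 / 2 : ℂ) • H * A⁻¹) * (A * Q * C) = (1 / 2 : ℂ) • (C⁻¹ * (H * Q * C)) := by
    have : A⁻¹ * (A * (Q * C)) = Q * C := by
      rw [← Matrix.mul_assoc, Matrix.nonsing_inv_mul _ hdet, Matrix.one_mul]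
    simp only [Matrix.mul_assoc, Matrix.smul_mul, Matrix.mul_smul, this]
  rw [h3, Matrix.trace_smul, Matrix.trace_mul_comm, Matrix.mul_assoc,
    Matrix.mul_nonsing_inv _ hdet', Matrix.mul_one, smul_eq_mul]
  ring

end Connection

end BRTTrivialization

/-! ### Top exterior powers as determinants. -/

section Wedge

variable {n : ℕ}

/-- The indices of the real parts, the imaginary parts and `θ`. -/
abbrev CoordIdx (n : ℕ) : Type := (Fin n ⊕ Fin n) ⊕ Unit

/-- The numbering of the coordinates. -/
def coordEquiv (n : ℕ) : CoordIdx n ≃ Fin (2 * n + 1) :=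
  Equiv.ofBijective (Sum.elim (Sum.elim idxRe idxIm) fun _ => idxLast)
    ((Fintype.bijective_iff_injective_and_card _).2 ⟨by
      rintro ((i | i) | i) ((j | j) | j) h <;>
        simp only [Sum.elim_inl, Sum.elim_inr, idxRe, idxIm, idxLast, Fin.mk.injEq] at h <;>
        first
        | (congr 2; ext; omega)
        | rfl
        | omega, by simp; omega⟩)

/-- The square matrix with the rows `r_k`, `s_k` and `t`. -/
def rowsMatrix (r s : Fin n → CoordIdx n → ℂ) (t : CoordIdx n → ℂ) :
    Matrix (CoordIdx n) (CoordIdx n) ℂ :=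
  Matrix.of (Sum.elim (Sum.elim r s) fun _ => t)

/-- The real parts of the coefficients of the term number `m` of an expanded power. -/
def selRe (m : Fin n → Fin n × Bool) : Matrix (Fin n) (Fin n) ℂ :=
  Matrix.of fun j k => if m j = (k, true) then 1 else 0

/-- The imaginary parts of the coefficients of the term number `m` of an expanded power. -/
def selIm (m : Fin n → Fin n × Bool) : Matrix (Fin n) (Fin n) ℂ :=
  Matrix.of fun j k => if m j = (k, false) then -1 else 0

/-- The coefficient matrix of the term number `m` of an expanded power. -/
def selMatrix (m : Fin n → Fin n × Bool) : Matrix (CoordIdx n) (CoordIdx n) ℂ :=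
  Matrix.fromBlocks (Matrix.fromBlocks (selRe m) (selIm m) (-selIm m) (selRe m)) 0 0 1

/-- A unipotent change of basis makes the block matrix triangular with diagonal blocks `A ± iB`. -/
theorem det_fromBlocks_conj (A B : Matrix (Fin n) (Fin n) ℂ) :
    (Matrix.fromBlocks A B (-B) A).det = (A + Complex.I • B).det * (A - Complex.I • B).det := by
  have h1 : Matrix.fromBlocks (1 : Matrix (Fin n) (Fin n) ℂ) 0 (-Complex.I • 1) 1
      * Matrix.fromBlocks A B (-B) A * Matrix.fromBlocks 1 0 (Complex.I • 1) 1
      = Matrix.fromBlocks (A + Complex.I • B) B 0 (A - Complex.I • B) := by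
    simp only [Matrix.fromBlocks_multiply, Matrix.one_mul, Matrix.mul_one, Matrix.zero_mul,
      Matrix.mul_zero, add_zero, zero_add, Matrix.smul_mul, Matrix.mul_smul]
    congr 1
    · rw [smul_add, smul_smul, mul_neg, Complex.I_mul_I, neg_neg, one_smul, neg_smul]
      abel
    · rw [neg_smul]; abel
  have h2 := congrArg Matrix.det h1
  rw [Matrix.det_mul, Matrix.det_mul, Matrix.det_fromBlocks_zero₁₂, Matrix.det_fromBlocks_zero₁₂,
    Matrix.det_fromBlocks_zero₂₁] at h2
  simpa using h2

/-- The entries of `selRe` and `selIm` are real, so the two factors of the block determinant are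
conjugate. This gives a sign to every term of the expansion. -/
theorem det_selMatrix (m : Fin n → Fin n × Bool) :
    (selMatrix m).det = (Complex.normSq (selRe m + Complex.I • selIm m).det : ℝ) := by
  rw [selMatrix, Matrix.det_fromBlocks_zero₁₂, det_fromBlocks_conj, Matrix.det_one, mul_one,
    Complex.normSq_eq_conj_mul_self, mul_comm]
  congr 1
  rw [RingHom.map_det]
  congr 1
  ext j k
  simp only [RingHom.mapMatrix_apply, Matrix.map_apply, Matrix.sub_apply, Matrix.add_apply,
    Matrix.smul_apply, smul_eq_mul, map_add, map_mul, Complex.conj_I, selRe, selIm, Matrix.of_apply]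
  split_ifs <;> simp

/-- The number of terms, with multiplicities, of the top power of a symplectic form. -/
def wedgeConst (n : ℕ) : ℂ := ∑ m : Fin n → Fin n × Bool, (selMatrix m).det

/-- It is a sum of squared moduli in which the choice `j ↦ (j, true)` contributes `1`. The exact
value is irrelevant, since only logarithmic derivatives of the volume density are used. -/
theorem wedgeConst_ne_zero (n : ℕ) : wedgeConst n ≠ 0 := by
  have h1 : wedgeConst n = ((∑ m : Fin n → Fin n × Bool,
      Complex.normSq (selRe m + Complex.I • selIm m).det : ℝ) : ℂ) := by
    rw [wedgeConst, Complex.ofReal_sum]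
    exact Finset.sum_congr rfl fun m _ => det_selMatrix m
  rw [h1, Complex.ofReal_ne_zero]
  refine (Finset.sum_pos' (fun m _ => Complex.normSq_nonneg _)
    ⟨fun j => (j, true), Finset.mem_univ _, ?_⟩).ne'
  have h2 : selRe (fun j : Fin n => (j, true)) = 1 := by
    ext j k
    simp [selRe, Matrix.one_apply]
  have h3 : selIm (fun j : Fin n => (j, true)) = 0 := by
    ext j k
    simp [selIm]
  simp [h2, h3]

variable (r s : Fin n → CoordIdx n → ℂ) (t : CoordIdx n → ℂ)

/-- The first factor of a term of the expanded power. -/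
def selFst (q : Fin n × Bool) (a : CoordIdx n) : ℂ := if q.2 then r q.1 a else -s q.1 a

/-- The second factor of a term of the expanded power. -/
def selSnd (q : Fin n × Bool) (a : CoordIdx n) : ℂ := if q.2 then s q.1 a else r q.1 a

theorem selMatrix_mul (m : Fin n → Fin n × Bool) :
    selMatrix m * rowsMatrix r s t
      = rowsMatrix (fun j => selFst r s (m j)) (fun j => selSnd r s (m j)) t := by
  ext i b
  rw [Matrix.mul_apply, Fintype.sum_sum_type, Fintype.sum_sum_type]
  rcases i with (j | j) | j
  · rcases hm : m j with ⟨k, _ | _⟩ <;>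
      simp [selMatrix, rowsMatrix, selRe, selIm, selFst, hm]
  · rcases hm : m j with ⟨k, _ | _⟩ <;>
      simp [selMatrix, rowsMatrix, selRe, selIm, selSnd, hm]
  · simp [selMatrix, rowsMatrix]

/-- The top power of a two-form, wedged with a one-form, as a determinant. -/
theorem wedge_sum_eq :
    ∑ σ : Equiv.Perm (CoordIdx n), ((Equiv.Perm.sign σ : ℤ) : ℂ) *
      ((∏ j, ∑ k, (r k (σ (.inl (.inl j))) * s k (σ (.inl (.inr j)))
        - r k (σ (.inl (.inr j))) * s k (σ (.inl (.inl j))))) * t (σ (.inr ())))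
      = wedgeConst n * (rowsMatrix r s t).det := by
  have h1 : ∀ a b, ∑ k, (r k a * s k b - r k b * s k a)
      = ∑ q : Fin n × Bool, selFst r s q a * selSnd r s q b := by
    intro a b
    rw [Fintype.sum_prod_type]
    refine Finset.sum_congr rfl fun k _ => ?_
    simp [selFst, selSnd]
    ring
  -- Each factor is expanded into a choice of `k` and of `r_k ⊗ s_k` or `-s_k ⊗ r_k`. For a fixed
  -- choice `m` the sum over permutations is the determinant of a matrix with rows `±r_k`, `s_k` and
  -- `t`, which is `selMatrix m * rowsMatrix r s t`.
  simp only [h1, Finset.prod_univ_sum, Fintype.piFinset_univ, Finset.sum_mul, Finset.mul_sum]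
  rw [Finset.sum_comm, wedgeConst, Finset.sum_mul]
  refine Finset.sum_congr rfl fun m _ => ?_
  rw [← Matrix.det_mul, selMatrix_mul, ← Matrix.det_transpose, Matrix.det_apply']
  refine Finset.sum_congr rfl fun σ _ => ?_
  rw [Fintype.prod_sum_type, Fintype.prod_sum_type, Finset.prod_mul_distrib]
  simp [rowsMatrix]

theorem wedgePow_eq {V : Type*} (α : V → V → ℝ) (β : V → ℝ) (v : Fin (2 * n + 1) → V) (c : ℂ)
    (hα : ∀ a b, (α (v (coordEquiv n a)) (v (coordEquiv n b)) : ℂ)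
      = c * ∑ k, (r k a * s k b - r k b * s k a))
    (hβ : ∀ a, (β (v (coordEquiv n a)) : ℂ) = t a) :
    (wedgePow α β v : ℂ) = (1 / 2 ^ n * c ^ n * wedgeConst n) * (rowsMatrix r s t).det := by
  rw [mul_assoc, ← wedge_sum_eq, wedgePow]
  push_cast
  rw [mul_assoc, Finset.mul_sum (a := c ^ n)]
  congr 1
  -- Relabelling the coordinates by the block index type preserves signs of permutations.
  refine (Fintype.sum_equiv (coordEquiv n).permCongr _ _ fun σ => ?_).symm
  rw [Equiv.Perm.sign_permCongr]
  have e1 : ∀ j : Fin n, (coordEquiv n).permCongr σ (idxRe j)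
      = coordEquiv n (σ (.inl (.inl j))) := fun j => by
    have : idxRe j = coordEquiv n (.inl (.inl j)) := rfl
    rw [this, Equiv.permCongr_apply, Equiv.symm_apply_apply]
  have e2 : ∀ j : Fin n, (coordEquiv n).permCongr σ (idxIm j)
      = coordEquiv n (σ (.inl (.inr j))) := fun j => by
    have : idxIm j = coordEquiv n (.inl (.inr j)) := rfl
    rw [this, Equiv.permCongr_apply, Equiv.symm_apply_apply]
  have e3 : (coordEquiv n).permCongr σ idxLast = coordEquiv n (σ (.inr ())) := by
    have : (idxLast : Fin (2 * n + 1)) = coordEquiv n (.inr ()) := rfl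
    rw [this, Equiv.permCongr_apply, Equiv.symm_apply_apply]
  simp only [e1, e2, e3, hα, hβ, Finset.prod_mul_distrib, Finset.prod_const, Finset.card_univ,
    Fintype.card_fin]
  ring

end Wedge

/-! ### The volume density as a multiple of `det G`. -/

namespace BRTTrivialization

variable {n : ℕ} {X : Type*} [TopologicalSpace X]
  [ChartedSpace (EuclideanSpace ℝ (Fin (2 * n + 1))) X]
  [IsManifold (𝓡 (2 * n + 1)) ∞ X]

variable [MulAction Circle X] {S : CRStructure n X} (B : BRTTrivialization S)

variable {y : X}

/-- This is `dθ₀ = 2i ∑ G_{jk} dz_j ∧ dz̄_k`, grouped as `∑_k r_k ∧ s_k` with `r_k = ∑_j G_{jk}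
dz_j` and `s_k = dz̄_k`, the shape that `wedgePow_eq` needs. -/
theorem dtheta₀_expansion (hy : y ∈ B.D) (U V : CT n y) :
    B.dtheta₀ y U V = 2 * Complex.I * ∑ k,
      ((∑ j, hess B.φ (B.zc y) j k * B.dzForm j y U) * B.dzbarForm k y V
        - (∑ j, hess B.φ (B.zc y) j k * B.dzForm j y V) * B.dzbarForm k y U) := by
  obtain ⟨c, hc⟩ := B.expansion hy U
  obtain ⟨d, hd⟩ := B.expansion hy V
  have hT : ∀ W, B.dtheta₀ y W (B.T y) = 0 := fun W => by
    rw [B.dtheta₀_antisymm, B.dtheta₀_T hy, neg_zero]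
  have hbar : ∀ j k, B.dtheta₀ y (B.Zbar k y) (B.Z j y)
      = -(2 * Complex.I * hess B.φ (B.zc y) j k) := fun j k => by
    rw [B.dtheta₀_antisymm, B.dtheta₀_Z_Zbar hy]
  conv_lhs => rw [hc, hd]
  simp only [map_add, map_sum, map_smul, LinearMap.add_apply, LinearMap.sum_apply,
    LinearMap.smul_apply, hT, B.dtheta₀_T hy, B.dtheta₀_Z_Z hy, B.dtheta₀_Zbar_Zbar hy,
    B.dtheta₀_Z_Zbar hy, hbar, smul_eq_mul, mul_zero, add_zero, Finset.sum_const_zero, zero_add]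
  have e : ∀ k, 2 * Complex.I * ((∑ j, hess B.φ (B.zc y) j k * B.dzForm j y U) * B.dzbarForm k y V
        - (∑ j, hess B.φ (B.zc y) j k * B.dzForm j y V) * B.dzbarForm k y U)
      = ∑ j, (B.dzbarForm k y V * (B.dzForm j y U * (2 * Complex.I * hess B.φ (B.zc y) j k))
        + B.dzbarForm k y U * (B.dzForm j y V * -(2 * Complex.I * hess B.φ (B.zc y) j k))) := by
    intro k
    rw [Finset.sum_mul, Finset.sum_mul, ← Finset.sum_sub_distrib, Finset.mul_sum]
    exact Finset.sum_congr rfl fun j _ => by ring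
  simp only [Finset.mul_sum (a := 2 * Complex.I), e, Finset.sum_add_distrib]
  rw [add_comm]
  congr 1
  · refine Finset.sum_congr rfl fun k _ => ?_
    rw [Finset.mul_sum]
  · rw [Finset.sum_comm]
    refine Finset.sum_congr rfl fun k _ => ?_
    rw [Finset.mul_sum]
    exact Finset.sum_congr rfl fun j _ => by ring

/-- The rows of the Hessian in the real coordinates. -/
theorem det_rowsMatrix (H : Matrix (Fin n) (Fin n) ℂ) (t : CoordIdx n → ℂ) (ht : t (.inr ()) = 1) :
    (rowsMatrix (fun k b => ∑ j, H j k * (coordBasis n (coordEquiv n b)).1 j)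
      (fun k b => starRingEnd ℂ ((coordBasis n (coordEquiv n b)).1 k)) t).det
      = (-2 * Complex.I) ^ n * H.det := by
  have e1 : ∀ j : Fin n, coordBasis n (coordEquiv n (.inl (.inl j)))
      = (EuclideanSpace.single j 1, 0) := coordBasis_idxRe
  have e2 : ∀ j : Fin n, coordBasis n (coordEquiv n (.inl (.inr j)))
      = (EuclideanSpace.single j Complex.I, 0) := coordBasis_idxIm
  have e3 : coordBasis n (coordEquiv n (.inr ())) = (0, 1) := coordBasis_idxLast
  -- The row matrix factors through the matrix of `(dz, dz̄)` in the coordinates `(x, y)`, of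
  -- determinant `(-2i)^n`. The entries of `t` off the corner do not matter, as the block above the
  -- corner is zero.
  have h1 : rowsMatrix (fun k b => ∑ j, H j k * (coordBasis n (coordEquiv n b)).1 j)
      (fun k b => starRingEnd ℂ ((coordBasis n (coordEquiv n b)).1 k)) t
      = Matrix.fromBlocks (Matrix.fromBlocks H.transpose 0 0 1
          * Matrix.fromBlocks 1 (Complex.I • 1) 1 (-Complex.I • 1)) 0
        (Matrix.of fun _ b => t (.inl b)) 1 := by
    rw [Matrix.fromBlocks_multiply]
    ext (( i | i) | i) ((j | j) | j)
    · simp [rowsMatrix, e1, PiLp.single_apply]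
    · simp [rowsMatrix, e2, PiLp.single_apply, mul_comm]
    · simp [rowsMatrix, e3]
    · simp [rowsMatrix, e1, PiLp.single_apply, Matrix.one_apply]
    · by_cases h : i = j <;> simp [rowsMatrix, e2, h]
    · simp [rowsMatrix, e3]
    · simp [rowsMatrix]
    · simp [rowsMatrix]
    · simp [rowsMatrix, ht]
  rw [h1, Matrix.det_fromBlocks_zero₁₂, Matrix.det_mul, Matrix.det_fromBlocks_zero₁₂,
    Matrix.det_transpose, Matrix.det_one, Matrix.det_one, mul_one, mul_one,
    Matrix.det_fromBlocks_one₁₁, Matrix.one_mul, ← sub_smul, Matrix.det_smul, Matrix.det_one,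
    Fintype.card_fin]
  ring

/-- The constant in the volume density. -/
def volumeConst (n : ℕ) : ℂ :=
  1 / (n.factorial : ℂ) * (1 / 2 ^ n * ((Complex.I / Real.pi) ^ n) * wedgeConst n)
    * (-2 * Complex.I) ^ n

theorem volumeConst_ne_zero (n : ℕ) : volumeConst n ≠ 0 := by
  have h1 : (n.factorial : ℂ) ≠ 0 := by exact_mod_cast n.factorial_ne_zero
  have h2 : (Real.pi : ℂ) ≠ 0 := by exact_mod_cast Real.pi_ne_zero
  have h3 := wedgeConst_ne_zero n
  simp [volumeConst, h1, h2, h3]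

/-- The volume density is a constant multiple of the determinant of the Hessian of `φ`. -/
theorem volumeDensity_eq (hS : S.IsTransversalCRAction) (hy : y ∈ B.D) :
    (B.volumeDensity hS y : ℂ) = volumeConst n * (hess B.φ (B.zc y)).det := by
  have hch : ∀ k, chartVec B.coord y (coordField B.coord k y) = coordBasis n k := fun k => by
    rw [coordField_eq_constField, B.isSmoothChart.chartVec_constField hy]
  have hdz : ∀ j k, B.dzForm j y ((1 : ℂ) ⊗ₜ[ℝ] coordField B.coord k y) = (coordBasis n k).1 j :=
    fun j k => by
      rw [dzForm, cExt_one_tmul, LinearMap.coe_mk, AddHom.coe_mk, hch]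
  have hdzbar : ∀ j k, B.dzbarForm j y ((1 : ℂ) ⊗ₜ[ℝ] coordField B.coord k y)
      = starRingEnd ℂ ((coordBasis n k).1 j) := fun j k => by
    rw [dzbarForm, cExt_one_tmul, LinearMap.coe_mk, AddHom.coe_mk, hch]
  have hd : ∀ a b, ((dForm (S.theta₀ hS) y (coordField B.coord a y) (coordField B.coord b y) : ℝ) : ℂ)
      = B.dtheta₀ y ((1 : ℂ) ⊗ₜ[ℝ] coordField B.coord a y)
        ((1 : ℂ) ⊗ₜ[ℝ] coordField B.coord b y) := fun a b => by
    rw [dtheta₀, cExt₂_one_tmul, B.dForm_theta₀ hS hy]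
    rfl
  rw [volumeDensity]
  push_cast
  -- The constant is `i/π` because `-(1/2π) dω₀ = (1/2π) dθ₀` and `dθ₀` carries the factor `2i`.
  rw [wedgePow_eq (fun k b => ∑ j, hess B.φ (B.zc y) j k * (coordBasis n (coordEquiv n b)).1 j)
    (fun k b => starRingEnd ℂ ((coordBasis n (coordEquiv n b)).1 k))
    (fun b => ((S.theta₀ hS y (coordField B.coord (coordEquiv n b) y) : ℝ) : ℂ)) _ _ _
    (Complex.I / Real.pi) ?_ ?_, det_rowsMatrix, volumeConst]
  · ring
  · have : coordEquiv n (.inr ()) = idxLast := rfl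
    rw [B.theta₀_eq hS hy, hch, this, coordBasis_idxLast, thetaCoeff_apply]
    simp
  · intro a b
    rw [B.dForm_omega₀ hS hy]
    push_cast
    rw [hd, B.dtheta₀_expansion hy]
    simp only [hdz, hdzbar]
    have h2 : (Real.pi : ℂ) ≠ 0 := by exact_mod_cast Real.pi_ne_zero
    field_simp
  · intro a
    rfl

end BRTTrivialization

/-! ### The rigid scalar curvature. -/

namespace BRTTrivialization

variable {n : ℕ} {X : Type*} [TopologicalSpace X]
  [ChartedSpace (EuclideanSpace ℝ (Fin (2 * n + 1))) X]
  [IsManifold (𝓡 (2 * n + 1)) ∞ X]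

variable [MulAction Circle X] {S : CRStructure n X} (B : BRTTrivialization S)

variable {y : X}

/-- The volume density as a function of `z`. -/
theorem volumeConst_mul_det_real (hS : S.IsTransversalCRAction)
    {w : EuclideanSpace ℂ (Fin n)} (hw : w ∈ B.ball) :
    (((volumeConst n * (hess B.φ w).det).re : ℝ) : ℂ) = volumeConst n * (hess B.φ w).det := by
  -- The function is the volume density at the point with coordinates `(w, 0)`, and is therefore
  -- real.
  have ht : (w, (0 : ℝ)) ∈ B.coord.target := by
    rw [B.target_eq]
    exact ⟨by simpa [ball] using hw, by simpa using B.ε_pos⟩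
  have hz : B.zc (B.coord.symm (w, 0)) = w := by rw [zc, B.coord.right_inv ht]
  have h := B.volumeDensity_eq hS (B.coord.map_target ht)
  rw [hz] at h
  rw [← h, Complex.ofReal_re]

variable (hS : S.IsTransversalCRAction) (hpsc : S.IsStronglyPseudoconvex hS)

include hpsc

theorem dualMetric_eq (hy : y ∈ B.D) (j k : Fin n) :
    B.dualMetric hS j k y = Real.pi * (hess B.φ (B.zc y))⁻¹ k j := by
  have hpi : (Real.pi : ℂ) ≠ 0 := by exact_mod_cast Real.pi_ne_zero
  have h1 : (Matrix.of fun l m => S.leviMetric hS (B.Z l y) (B.Z m y))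
      = (Real.pi : ℂ)⁻¹ • hess B.φ (B.zc y) := by
    ext l m
    exact B.leviMetric_Z hS hy l m
  have h2 := Matrix.inv_smul' (A := hess B.φ (B.zc y)) (Units.mk0 (Real.pi : ℂ) hpi)⁻¹
    (isUnit_iff_ne_zero.2 (B.det_hess_ne_zero hS hpsc hy))
  rw [dualMetric, h1]
  have h3 := congrFun (congrFun h2 k) j
  simpa [Units.smul_def] using h3

/-- The constant cancels in the logarithmic derivative. Only `a ≠ 0` is needed, because `Real.log`
has derivative `1/x` at negative arguments as well. -/
theorem cDeriv_Zbar_log (hy : y ∈ B.D) (k : Fin n) :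
    cDeriv (B.Zbar k y) (fun z => ((Real.log (B.volumeDensity hS z) : ℝ) : ℂ))
      = dzbar k (fun w => (hess B.φ w).det) (B.zc y) * ((hess B.φ (B.zc y)).det)⁻¹ := by
  set D : EuclideanSpace ℂ (Fin n) → ℂ := fun w => (hess B.φ w).det with hDdef
  -- Taking the real part gives a real function of `z` to which `Real.log` applies; on the ball
  -- nothing is lost, by `volumeConst_mul_det_real`.
  set g : EuclideanSpace ℂ (Fin n) → ℝ := fun w => (volumeConst n * D w).re with hg
  have hc := volumeConst_ne_zero n
  have hD : DifferentiableAt ℝ D (B.zc y) :=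
    differentiableAt_of_contDiffOn B.isOpen_ball (contDiffOn_det_hess B.isOpen_ball B.smooth_φ)
      (B.zc_mem hy)
  have hD0 : D (B.zc y) ≠ 0 := B.det_hess_ne_zero hS hpsc hy
  have hgD : (fun w => ((g w : ℝ) : ℂ)) =ᶠ[nhds (B.zc y)] fun w => volumeConst n * D w := by
    filter_upwards [B.isOpen_ball.mem_nhds (B.zc_mem hy)] with w hw
    exact B.volumeConst_mul_det_real hS hw
  have hgy : ((g (B.zc y) : ℝ) : ℂ) = volumeConst n * D (B.zc y) := hgD.self_of_nhds
  have hg0 : g (B.zc y) ≠ 0 := by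
    rw [← Complex.ofReal_ne_zero, hgy]
    exact mul_ne_zero hc hD0
  have hgd : DifferentiableAt ℝ g (B.zc y) :=
    Complex.reCLM.differentiableAt.comp (B.zc y) (hD.const_mul (volumeConst n))
  have hlog : DifferentiableAt ℝ (fun w => Real.log (g w)) (B.zc y) := hgd.log hg0
  have hlogC : DifferentiableAt ℝ (fun w => ((Real.log (g w) : ℝ) : ℂ)) (B.zc y) :=
    Complex.ofRealCLM.differentiableAt.comp (B.zc y) hlog
  have hv : ∀ v, fderiv ℝ (fun w => ((Real.log (g w) : ℝ) : ℂ)) (B.zc y) v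
      = (D (B.zc y))⁻¹ * fderiv ℝ D (B.zc y) v := by
    intro v
    have h1 : ((fderiv ℝ g (B.zc y) v : ℝ) : ℂ) = volumeConst n * fderiv ℝ D (B.zc y) v := by
      rw [← fderiv_ofReal hgd, hgD.fderiv_eq, fderiv_const_mul hD]
      rfl
    rw [fderiv_ofReal hlog, fderiv.log hgd hg0, smul_apply, smul_eq_mul]
    push_cast
    rw [h1, hgy]
    field_simp
  have hev : (fun z => ((Real.log (B.volumeDensity hS z) : ℝ) : ℂ)) =ᶠ[nhds y]
      fun z => ((Real.log (g (B.zc z)) : ℝ) : ℂ) := by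
    filter_upwards [B.eventually_D hy] with z hz
    rw [hg, ← Complex.ofReal_re (B.volumeDensity hS z), B.volumeDensity_eq hS hz]
  rw [cDeriv_congr hev,
    B.cDeriv_Zbar_comp_zc (h := fun w => ((Real.log (g w) : ℝ) : ℂ)) hy hlogC, dzbar, dzbar, hv, hv]
  ring

/-- The rigid scalar curvature is a multiple of the trace of `∂∂̄ log det G`. -/
theorem rigidScalarCurvature_eq (hy : y ∈ B.D) :
    B.rigidScalarCurvature hS y = -2 * Real.pi * ((hess B.φ (B.zc y))⁻¹
      * logHess (fun w => (hess B.φ w).det) (B.zc y)).trace := by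
  have hO := B.isOpen_ball
  have hDs := contDiffOn_det_hess hO B.smooth_φ
  have h0 := B.det_hess_ne_zero hS hpsc hy
  have hd : ∀ k, DifferentiableAt ℝ (fun w => dzbar k (fun w => (hess B.φ w).det) w
      * ((hess B.φ w).det)⁻¹) (B.zc y) := fun k =>
    (differentiableAt_of_contDiffOn hO (contDiffOn_dzbar hO hDs k) (B.zc_mem hy)).fun_mul
      ((differentiableAt_of_contDiffOn hO hDs (B.zc_mem hy)).fun_inv h0)
  have h1 : ∀ j k, cDeriv (B.Z j y) (fun z => cDeriv (cConj (B.Z k z))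
      fun z => ((Real.log (B.volumeDensity hS z) : ℝ) : ℂ))
      = logHess (fun w => (hess B.φ w).det) (B.zc y) j k := by
    intro j k
    have hev : (fun z => cDeriv (cConj (B.Z k z))
        fun z => ((Real.log (B.volumeDensity hS z) : ℝ) : ℂ)) =ᶠ[nhds y]
        fun z => dzbar k (fun w => (hess B.φ w).det) (B.zc z) * ((hess B.φ (B.zc z)).det)⁻¹ := by
      filter_upwards [B.eventually_D hy] with z hz
      exact B.cDeriv_Zbar_log hS hpsc hz k
    rw [cDeriv_congr hev, B.cDeriv_Z_comp_zc (h := fun w => dzbar k (fun w => (hess B.φ w).det) w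
      * ((hess B.φ w).det)⁻¹) hy (hd k), logHess_apply hO hDs (B.zc_mem hy) h0]
  rw [rigidScalarCurvature, laplacian]
  -- The dual metric is `π G⁻¹` with indices exchanged, so the double sum is `π` times a trace.
  simp only [h1, B.dualMetric_eq hS hpsc hy]
  simp only [Matrix.trace, Matrix.diag_apply, Matrix.mul_apply, Finset.mul_sum]
  rw [Finset.sum_comm]
  exact Finset.sum_congr rfl fun k _ => Finset.sum_congr rfl fun j _ => by ring

end BRTTrivialization

end RigidCR

end

theorem theorem3p4 {n : ℕ} (hn : 1 ≤ n) {X : Type*} [TopologicalSpace X] [T2Space X]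
    [CompactSpace X] [ConnectedSpace X]
    [ChartedSpace (EuclideanSpace ℝ (Fin (2 * n + 1))) X] [IsManifold (𝓡 (2 * n + 1)) ∞ X]
    [MulAction Circle X] [ContMDiffSMul (𝓡 1) (𝓡 (2 * n + 1)) ∞ Circle X]
    (S : RigidCR.CRStructure n X) (hS : S.IsTransversalCRAction)
    (hpsc : S.IsStronglyPseudoconvex hS)
    (ξ : RigidCR.RField n X) (hξ : RigidCR.IsReebField (S.theta₀ hS) ξ)
    (nab : RigidCR.Connection n X) (hnab : RigidCR.IsTanakaWebster S (S.theta₀ hS) ξ nab)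
    (B : RigidCR.BRTTrivialization S) (F : RigidCR.CRFrame S ξ)
    (x : X) (hxB : x ∈ B.D) (hxF : x ∈ F.D) :
    B.rigidScalarCurvature hS x = 4 * Real.pi * F.scalarCurvature (S.theta₀ hS) nab x := by
  -- Both sides are multiples of one trace, and `-2π = 4π · (-1/2)`.
  rw [B.rigidScalarCurvature_eq hS hpsc hxB, B.scalarCurvature_eq F hS hpsc hξ hnab hxB hxF]
  ring
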